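/- Let $N\ge 1$, $\eta=e^{2\pi i/N}$, $\mathbb Q_N=\mathbb Q(\eta)$. An index $(\mathbf s;\boldsymbol\alpha)$ consists of $\mathbf s=(s_1,\dots,s_d)$ with $s_j\ge1$ and $\boldsymbol\alpha\in(\mathbb Z/N)^d$, $d\ge 0$; its weight is $|\mathbf s|=s_1+\dots+s_d$, and it is called admissible if $d=0$ or $s_1>1$. Elements of $\mathbb Z/N$ are represented in $\{0,\dots,N-1\}$ when they are compared. **Objects.** Put $[\emptyset]=1$ and $$[\mathbf s;\boldsymbol\alpha]=\frac{1}{\prod_j (s_j-1)!}\sum_{n>0}\ \sum_{\substack{u_1v_1+\dots+u_dv_d=n\\ u_1>\dots>u_d>0,\ v_j>0}}\ \prod_j\eta^{\alpha_jv_j}v_j^{s_j-1}\,q^n ,$$ $g_\beta(\mathbf s;\boldsymbol\alpha)=[1,\mathbf s;0,\boldsymbol\alpha]-[1,\mathbf s;\beta,\boldsymbol\alpha]$ (of weight $|\mathbf s|+1$) and $t_N=\sum_{\alpha\in\mathbb Z/N}[1;\alpha]$. For admissible indices let $\zeta_N(\mathbf s;\boldsymbol\alpha)=\sum_{n_1>\dots>n_d>0,\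 n_j\equiv\alpha_j (N)}\prod_j n_j^{-s_j}$ (so $\zeta_N(\emptyset)=1$). Let $\Gamma_0(\mathbf s;\boldsymbol\alpha)=0$, and for $1\le\beta<N$ let $\Gamma_\beta=\Gamma_\beta(\emptyset)=-\frac1\beta+\sum_{n\ge1}\big(\frac1{nN}-\frac1{\beta+nN}\big)$ and, for $d\ge1$, $$\Gamma_\beta(\mathbf s;\boldsymbol\alpha)=\sum_{\substack{n_0>n_1>\dots>n_d>0\\ N\mid n_0,\ n_j\equiv\alpha_j (N)}}\Big(\frac1{n_0}-\frac1{n_0+\beta'}\Big)\prod_{j\ge 1} n_j^{-s_j},\qquad \beta'=\beta\ \text{if}\ \beta\le\alpha_1,\quad \beta'=\beta-N\ \text{otherwise}$$ (of weight $|\mathbf s|+1$). $\mathrm{MD}_N$ is the $\mathbb Q_N$-span of all $[\mathbf s;\boldsymbol\alpha]$; $\mathrm{qMZ}_N$ is the $\mathbb Q_N$-span of the $[\mathbf s;\boldsymbol\alpha]$ with admissible index and of the $g_\beta(\mathbf s;\boldsymbol\alpha)$, $\beta\neq0$; $\mathrm{MZ}_N$ (resp. $\mathrm{MZ}_N(\mathbb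 Q)$) is the $\mathbb Q_N$-span (resp. $\mathbb Q$-span) in $\mathbb C$ of the corresponding numbers $\zeta_N(\mathbf s;\boldsymbol\alpha)$ and $\Gamma_\beta(\mathbf s;\boldsymbol\alpha)$. In each case $\mathrm{Fil}_k$ is the $\mathbb Q_N$-span of the generators of weight $\le k$, $\mathrm{gr}_k=\mathrm{Fil}_k/\mathrm{Fil}_{k-1}$ (with $\mathrm{Fil}_{-1}=0$), $\overline{\mathrm{qMZ}_N}=\bigoplus_k\mathrm{gr}_k\mathrm{qMZ}_N$ and $\overline{\mathrm{MD}_N}=\bigoplus_k\mathrm{gr}_k\mathrm{MD}_N$. $\overline{\mathrm{qMZ}_N}(\mathbb Q)\subset\overline{\mathrm{qMZ}_N}$ is the $\mathbb Q$-span of the classes of the generators, each taken in the degree equal to its weight. The stuffle product $*$ of words in letters $z_{s;\alpha}$ is the bilinear product with unit $1$ and $z_{s;\alpha}w*z_{t;\beta}v=z_{s;\alpha}(w*z_{t;\beta}v)+z_{t;\beta}(z_{s;\alpha}w*v)+\delta_{\alpha,\beta}z_{s+t;\alpha}(w*v)$; a word $z_{s_1;\alpha_1}\cdots z_{s_d;\alpha_d}$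 is identified with its index, and $w\mapsto[w]$ is extended linearly. The regularized values $\zeta^*_N(w)\in\mathbb C[T]$ are defined by recursion on the number of leading letters $z_{1;\cdot}$. If $w$ is admissible, $\zeta_N^*(w)=\zeta_N(w)$. For one leading letter, $\zeta^*_N(1;\beta)=\frac1N\big(T+\sum_\gamma\Gamma_\gamma\big)-\Gamma_\beta$, and for admissible nonempty $s$ the value $\zeta^*_N(z_{1;\beta}s)$ is $\zeta^*_N(1;\beta)\zeta_N(s)$ minus the sum of $\zeta_N(u)$ over the terms $u\ne z_{1;\beta}s$ of $z_{1;\beta}*s$. For $m\ge1$ and admissible $s$, the values $x(\beta_0,\dots,\beta_m)=\zeta^*_N(z_{1;\beta_0}\cdots z_{1;\beta_m}s)$ are the solution of the (nonsingular, integral) linear system $$N\,x(\beta_0,\dots,\beta_m)+\sum_{\ell=1}^m\sum_{\gamma\in\mathbb Z/N}x(\beta_1,\dots,\beta_\ell,\gamma,\beta_{\ell+1},\dots,\beta_m)=T\,\zeta^*_N(w')+\sum_\gamma\Gamma_\gamma(w')-N\,\Gamma_{\beta_0}(w')-\sum_\gamma R_\gamma ,$$ where $w'=z_{1;\beta_1}\cdots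 z_{1;\beta_m}s$ and $R_\gamma$ is the sum of $\zeta^*_N(u)$ over the terms $u$ of $z_{1;\gamma}*w'$ with at most $m$ leading letters $z_{1;\cdot}$. **Theorem.** $\mathrm{qMZ}_N$, $\mathrm{MD}_N$ and $\mathrm{MZ}_N$ are $\mathbb Q_N$-algebras filtered by $\mathrm{Fil}_\bullet$ (so $\overline{\mathrm{qMZ}_N}$ and $\overline{\mathrm{MD}_N}$ inherit multiplications), and $\mathrm{MZ}_N(\mathbb Q)$ and $\overline{\mathrm{qMZ}_N}(\mathbb Q)$ are $\mathbb Q$-algebras. (i) There are $\mathbb Q_N$-linear maps $Z=Z_k:\mathrm{Fil}_k\mathrm{qMZ}_N\to\mathrm{Fil}_k\mathrm{MZ}_N$, $k\ge0$, with $Z_k([\mathbf s;\boldsymbol\alpha])=\zeta_N(\mathbf s;\boldsymbol\alpha)$ for all admissible indices of weight $k$ and $Z_k(g_\beta(\mathbf s;\boldsymbol\alpha))=\Gamma_\beta(\mathbf s;\boldsymbol\alpha)$ for all indices with $|\mathbf s|=k-1$ and all $\beta\in\mathbb Z/N$. They satisfy $Z_0(1)=1$, $Z_{j+k}(fg)=Z_j(f)Z_k(g)$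 for $f\in\mathrm{Fil}_j$, $g\in\mathrm{Fil}_k$, and $Z_{k+1}|_{\mathrm{Fil}_k}=0$; hence they factor through a homomorphism of $\mathbb Q_N$-algebras $\overline Z:\overline{\mathrm{qMZ}_N}\to\mathrm{MZ}_N$. The algebra $\overline{\mathrm{qMZ}_N}$ satisfies the stuffle relations: if each of $x,y$ is an admissible word or a difference $z_{1;0}w-z_{1;\beta}w$, of weights $j$ and $k$, then $[x*y]\in\mathrm{Fil}_{j+k}\mathrm{qMZ}_N$ and the product of the classes of $[x]$ and $[y]$ in $\mathrm{gr}_j$ and $\mathrm{gr}_k$ is the class of $[x*y]$ in $\mathrm{gr}_{j+k}$. Moreover $\overline Z$ restricts to a homomorphism of $\mathbb Q$-algebras $\overline Z_{\mathbb Q}:\overline{\mathrm{qMZ}_N}(\mathbb Q)\to\mathrm{MZ}_N(\mathbb Q)$. (ii) The homomorphism $\varphi:\overline{\mathrm{qMZ}_N}[X]\to\overline{\mathrm{MD}_N}$ induced by the inclusion $\mathrm{qMZ}_N\subset\mathrm{MD}_N$ and $X\mapsto t_N\in\mathrm{gr}_1$ is surjective. The maps $Z$ extend to $\mathbb Q_N$-linear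 maps $Z_k:\mathrm{Fil}_k\mathrm{MD}_N\to\mathrm{MZ}_N[T]$ with $Z_{k+r}(f\,t_N^r)=Z_k(f)T^r$ for $f\in\mathrm{Fil}_k\mathrm{qMZ}_N$, which satisfy $Z_{j+k}(fg)=Z_j(f)Z_k(g)$ and $Z_{k+1}|_{\mathrm{Fil}_k}=0$; hence they factor through a homomorphism of $\mathbb Q_N$-algebras $\overline Z:\overline{\mathrm{MD}_N}\to\mathrm{MZ}_N[T]$, and $\overline Z\circ\varphi$ is the coefficientwise extension $\overline{\mathrm{qMZ}_N}[X]\to\mathrm{MZ}_N[T]$, $X\mapsto T$, of the map $\overline Z$ of (i). For all indices with $s_1=1$, of weight $k$, $$Z_k([1,s_2,\dots,s_d;\alpha_1,\dots,\alpha_d])=\zeta^*_N(1,s_2,\dots,s_d;\alpha_1,\dots,\alpha_d).$$ Moreover $\overline Z$ restricts to a homomorphism of $\mathbb Q$-algebras from the $\mathbb Q$-subalgebra $\overline{\mathrm{qMZ}_N}(\mathbb Q)[t_N]$ of $\overline{\mathrm{MD}_N}$ generated by the image of $\overline{\mathrm{qMZ}_N}(\mathbb Q)$ and $t_N$ to $\mathrm{MZ}_N(\mathbb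 Q)[T]$. -/

import Mathlib

open scoped DirectSum Polynomial PowerSeries

noncomputable section

namespace LevelMZV

/-! ### Filtered algebras and their associated graded algebras -/

section Filtered

variable {K A : Type*} [Field K] [CommRing A] [Algebra K A]

/-- The subspace `V` of `A` is a unital subalgebra, and `F 0 ≤ F 1 ≤ ⋯` is an exhaustive
multiplicative filtration of it. -/
structure IsFilteredAlg (V : Submodule K A) (F : ℕ → Submodule K A) : Prop where
  one_mem : (1 : A) ∈ F 0
  mono : Monotone F
  mul_mem : ∀ {i j : ℕ} {f g : A}, f ∈ F i → g ∈ F j → f * g ∈ F (i + j)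
  exhaust : ⨆ k, F k = V

/-- The step below `F k`, with the convention that the step below `F 0` is zero. -/
def below (F : ℕ → Submodule K A) : ℕ → Submodule K A
  | 0 => ⊥
  | k + 1 => F k

/-- The graded piece `F k / F (k - 1)`. -/
def Gr (F : ℕ → Submodule K A) (k : ℕ) : Type _ :=
  F k ⧸ (below F k).submoduleOf (F k)

instance (F : ℕ → Submodule K A) (k : ℕ) : AddCommGroup (Gr F k) :=
  inferInstanceAs (AddCommGroup (F k ⧸ (below F k).submoduleOf (F k)))

instance (F : ℕ → Submodule K A) (k : ℕ) : Module K (Gr F k) :=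
  inferInstanceAs (Module K (F k ⧸ (below F k).submoduleOf (F k)))

variable {V : Submodule K A} {F : ℕ → Submodule K A}

theorem IsFilteredAlg.below_mul (h : IsFilteredAlg V F) {i j : ℕ} {f g : A}
    (hf : f ∈ below F i) (hg : g ∈ F j) : f * g ∈ below F (i + j) := by
  cases i with
  | zero =>
    have : f = 0 := by simpa [below] using hf
    simp [this]
  | succ i =>
    have := h.mul_mem (i := i) hf hg
    rw [Nat.succ_add]
    exact this

/-- Multiplication `F i × F j → F (i + j)`. -/
def filMul (h : IsFilteredAlg V F) (i j : ℕ) : F i →ₗ[K] F j →ₗ[K] F (i + j) :=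
  LinearMap.mk₂ K (fun f g => ⟨f.1 * g.1, h.mul_mem f.2 g.2⟩)
    (fun _ _ _ => Subtype.ext (add_mul _ _ _))
    (fun _ _ _ => Subtype.ext (smul_mul_assoc _ _ _))
    (fun _ _ _ => Subtype.ext (mul_add _ _ _))
    (fun _ _ _ => Subtype.ext (mul_smul_comm _ _ _))

/-- The class in `F k / F (k - 1)` of an element of `F k`. -/
def grMk (F : ℕ → Submodule K A) (k : ℕ) : F k →ₗ[K] Gr F k := Submodule.mkQ ((below F k).submoduleOf (F k))

theorem grMk_eq_zero {k : ℕ} {f : F k} (hf : (f : A) ∈ below F k) : grMk F k f = 0 :=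
  (Submodule.Quotient.mk_eq_zero _).2 hf

/-- The multiplication of the graded pieces that is inherited from `A`. -/
def grMul (h : IsFilteredAlg V F) (i j : ℕ) : Gr F i →ₗ[K] Gr F j →ₗ[K] Gr F (i + j) :=
  Submodule.liftQ ((below F i).submoduleOf (F i))
    (LinearMap.mk₂ K
      (fun (f : F i) (y : Gr F j) =>
        Submodule.liftQ ((below F j).submoduleOf (F j)) ((grMk F (i + j)).comp (filMul h i j f)) (by
          intro g hg
          have hg' : (g : A) ∈ below F j := hg
          have := h.below_mul hg' f.2
          rw [mul_comm, add_comm] at this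
          exact grMk_eq_zero this) y)
      (by rintro f f' ⟨g⟩; exact congrArg (grMk F _) (LinearMap.map_add₂ (filMul h i j) f f' g))
      (by rintro c f ⟨g⟩; exact congrArg (grMk F _) (LinearMap.map_smul₂ (filMul h i j) c f g))
      (by intro f y y'; exact map_add _ _ _)
      (by intro c f y; exact map_smul _ _ _))
    (by
      intro f hf
      rw [LinearMap.mem_ker]
      refine LinearMap.ext ?_
      rintro ⟨g⟩
      exact grMk_eq_zero (h.below_mul hf g.2))

theorem grMul_mk (h : IsFilteredAlg V F) (i j : ℕ) (f : F i) (g : F j) :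
    grMul h i j (grMk F i f) (grMk F j g) =
      grMk F (i + j) ⟨f.1 * g.1, h.mul_mem f.2 g.2⟩ := rfl

theorem grMk_surj (k : ℕ) (x : Gr F k) : ∃ f : F k, grMk F k f = x :=
  Submodule.mkQ_surjective _ x

theorem sigma_eq {i j : ℕ} (e : i = j) (f : F i) (g : F j) (hfg : (f : A) = g) :
    GradedMonoid.mk (A := Gr F) i (grMk F i f) = GradedMonoid.mk j (grMk F j g) := by
  subst e
  rw [Subtype.ext hfg]

/-- The associated graded object `⨁ k, F k / F (k - 1)` of a filtered algebra. -/
def AssocGr (_ : IsFilteredAlg V F) : Type _ := ⨁ k, Gr F k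

/-- The graded monoid structure on the pieces `F k / F (k - 1)`. -/
@[reducible]
def gMonoid (h : IsFilteredAlg V F) : GradedMonoid.GMonoid (Gr F) :=
  letI : GradedMonoid.GMul (Gr F) := ⟨fun x y => grMul h _ _ x y⟩
  letI : GradedMonoid.GOne (Gr F) := ⟨grMk F 0 ⟨1, h.one_mem⟩⟩
  { one_mul := by
      rintro ⟨i, x⟩
      obtain ⟨f, rfl⟩ := grMk_surj i x
      exact sigma_eq (zero_add i) _ _ (one_mul _)
    mul_one := by
      rintro ⟨i, x⟩
      obtain ⟨f, rfl⟩ := grMk_surj i x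
      exact sigma_eq (add_zero i) _ _ (mul_one _)
    mul_assoc := by
      rintro ⟨i, x⟩ ⟨j, y⟩ ⟨k, z⟩
      obtain ⟨f, rfl⟩ := grMk_surj i x
      obtain ⟨g, rfl⟩ := grMk_surj j y
      obtain ⟨p, rfl⟩ := grMk_surj k z
      exact sigma_eq (add_assoc i j k) _ _ (mul_assoc _ _ _) }

/-- The graded ring structure on the pieces `F k / F (k - 1)`. -/
@[reducible]
def gCommRing (h : IsFilteredAlg V F) : DirectSum.GCommRing (Gr F) :=
  { gMonoid h with
    mul_zero := fun x => map_zero (grMul h _ _ x)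
    zero_mul := fun y => LinearMap.map_zero₂ (grMul h _ _) y
    mul_add := fun x y z => map_add (grMul h _ _ x) y z
    add_mul := fun x y z => LinearMap.map_add₂ (grMul h _ _) x y z
    mul_comm := by
      rintro ⟨i, x⟩ ⟨j, y⟩
      obtain ⟨f, rfl⟩ := grMk_surj i x
      obtain ⟨g, rfl⟩ := grMk_surj j y
      exact sigma_eq (add_comm i j) _ _ (mul_comm _ _)
    natCast := fun n => n • grMk F 0 ⟨1, h.one_mem⟩
    natCast_zero := zero_smul _ _
    natCast_succ := fun n => by rw [add_smul, one_smul]; rfl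
    intCast := fun n => n • grMk F 0 ⟨1, h.one_mem⟩
    intCast_ofNat := fun n => natCast_zsmul _ _
    intCast_negSucc_ofNat := fun n => negSucc_zsmul _ _ }

instance (h : IsFilteredAlg V F) : CommRing (AssocGr h) :=
  letI := gCommRing h
  inferInstanceAs (CommRing (⨁ k, Gr F k))

/-- The scalars sit in degree `0`. -/
@[reducible]
def gAlgebra (h : IsFilteredAlg V F) :
    letI := gCommRing h
    DirectSum.GAlgebra K (Gr F) :=
  letI := gCommRing h
  { toFun := ((LinearMap.toSpanSingleton K _ (grMk F 0 ⟨1, h.one_mem⟩)).toAddMonoidHom)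
    map_one := one_smul K (grMk F 0 ⟨1, h.one_mem⟩)
    map_mul := by
      intro r s
      refine (sigma_eq (F := F) (i := 0) (j := 0 + 0) rfl ((r * s) • ⟨1, h.one_mem⟩)
        ⟨_, h.mul_mem (r • (⟨1, h.one_mem⟩ : F 0)).2 (s • (⟨1, h.one_mem⟩ : F 0)).2⟩ ?_)
      simp [mul_smul, smul_comm r s]
    commutes := by
      rintro r ⟨i, x⟩
      exact mul_comm _ _
    smul_def := by
      rintro r ⟨i, x⟩
      obtain ⟨f, rfl⟩ := grMk_surj i x
      refine (sigma_eq (F := F) (i := i) (j := 0 + i) (zero_add i).symm (r • f)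
        ⟨_, h.mul_mem (r • (⟨1, h.one_mem⟩ : F 0)).2 f.2⟩ ?_)
      simp }

instance (h : IsFilteredAlg V F) : Algebra K (AssocGr h) :=
  letI := gCommRing h
  letI := gAlgebra h
  inferInstanceAs (Algebra K (⨁ k, Gr F k))

instance [Algebra ℚ K] (h : IsFilteredAlg V F) : Algebra ℚ (AssocGr h) :=
  ((algebraMap K (AssocGr h)).comp (algebraMap ℚ K)).toAlgebra

/-- The class of `f ∈ F k` in degree `k` of the associated graded algebra. -/
def symb (h : IsFilteredAlg V F) (k : ℕ) : F k →ₗ[K] AssocGr h :=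
  (DirectSum.lof K ℕ (Gr F) k).comp (grMk F k)

end Filtered

/-! ### Words, multiple divisor functions and zeta values of level `N` -/

/-- The letter `(s, α)` stands for `z_{s;α}`. -/
abbrev Letter (N : ℕ) : Type := ℕ+ × ZMod N

/-- The word `[(s₁, α₁), …, (s_d, α_d)]` stands for the index `(s₁, …, s_d; α₁, …, α_d)`. -/
abbrev Word (N : ℕ) : Type := List (Letter N)

variable {N : ℕ}

/-- The weight `s₁ + ⋯ + s_d`. -/
def weight (w : Word N) : ℕ := (w.map fun a => (a.1 : ℕ)).sum

/-- Admissible words: the empty word and the words with `s₁ > 1`. -/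
def Adm (w : Word N) : Prop := ∀ a ∈ w.head?, 1 < a.1

/-- `η = exp(2πi/N)`. -/
def eta (N : ℕ) : ℂ := Complex.exp (2 * Real.pi * Complex.I / N)

/-- The cyclotomic field `ℚ(η)`. -/
abbrev QN (N : ℕ) : IntermediateField ℚ ℂ := IntermediateField.adjoin ℚ {eta N}

/-- The sum of `∏ η ^ (α_j v_j) v_j ^ (s_j - 1)` over all `M > u₁ > ⋯ > u_d > 0` and all
`v₁, …, v_d > 0` with `u₁ v₁ + ⋯ + u_d v_d = n`. -/
def divSum : Word N → ℕ → ℕ → ℂ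
  | [], _, n => if n = 0 then 1 else 0
  | a :: w, M, n =>
      ∑ u ∈ Finset.Ico 1 M, ∑ v ∈ (Finset.Icc 1 n).filter (fun v => u * v ≤ n),
        eta N ^ (a.2.val * v) * (v : ℂ) ^ ((a.1 : ℕ) - 1) * divSum w u (n - u * v)

/-- The multiple divisor function `[s₁, …, s_d; α₁, …, α_d]` as a power series in `q`. In the
coefficient of `q ^ n` the condition `u₁ ≤ n` is automatic. -/
def bracket (w : Word N) : ℂ⟦X⟧ :=
  PowerSeries.mk fun n =>
    (w.map fun a => (1 : ℂ) / (((a.1 : ℕ) - 1).factorial : ℂ)).prod * divSum w (n + 1) n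

/-- `g_β(s; α) = [1, s; 0, α] - [1, s; β, α]`. -/
def gser (β : ZMod N) (w : Word N) : ℂ⟦X⟧ := bracket ((1, 0) :: w) - bracket ((1, β) :: w)

/-- `t_N = ∑ α, [1; α]`. -/
def tN (N : ℕ) [NeZero N] : ℂ⟦X⟧ := ∑ α : ZMod N, bracket [(1, α)]

/-- The finite sum of `∏ 1 / n_j ^ s_j` over all `M > n₁ > ⋯ > n_d > 0` with `n_j ≡ α_j` mod `N`. -/
def hsum : Word N → ℕ → ℂ
  | [], _ => 1
  | a :: w, M =>
      ∑ n ∈ (Finset.range M).filter (fun n : ℕ => 0 < n ∧ (n : ZMod N) = a.2),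
        1 / (n : ℂ) ^ (a.1 : ℕ) * hsum w n

/-- The zeta value `ζ_N(s; α)`, the sum over `n₁ > ⋯ > n_d > 0` with `n_j ≡ α_j` mod `N`; it is
used for admissible words only. -/
def zeta : Word N → ℂ
  | [] => 1
  | a :: w =>
      ∑' n : ℕ, if 0 < n ∧ (n : ZMod N) = a.2 then 1 / (n : ℂ) ^ (a.1 : ℕ) * hsum w n else 0

/-- The values `Γ_β(s; α)`, with `β` and `α₁` represented in `{0, …, N - 1}`; in the sums over
`n = n₀ > n₁ > ⋯ > n_d > 0` the index `n₀` runs over multiples of `N`. -/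
def Gam (β : ZMod N) (w : Word N) : ℂ :=
  if β = 0 then 0 else
    match w with
    | [] => -(1 / (β.val : ℂ)) +
        ∑' n : ℕ, (1 / (((n : ℂ) + 1) * N) - 1 / ((β.val : ℂ) + ((n : ℂ) + 1) * N))
    | a :: w =>
        if β.val ≤ a.2.val then
          ∑' n : ℕ, if N ∣ n then
            (1 / (n : ℂ) - 1 / ((β.val : ℂ) + n)) * hsum (a :: w) n else 0
        else
          ∑' n : ℕ, if N ∣ n then
            (1 / (n : ℂ) - 1 / ((β.val : ℂ) - N + n)) * hsum (a :: w) n else 0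

/-! ### The spaces spanned by these objects, with their weight filtrations -/

/-- The weight filtration of the space of multiple divisor functions. -/
def MDFil (N k : ℕ) : Submodule (QN N) ℂ⟦X⟧ :=
  Submodule.span (QN N) {f | ∃ w : Word N, weight w ≤ k ∧ f = bracket w}

/-- The space of multiple divisor functions. -/
def MD (N : ℕ) : Submodule (QN N) ℂ⟦X⟧ :=
  Submodule.span (QN N) {f | ∃ w : Word N, f = bracket w}

/-- The generators of weight `k`: `[s; α]` with `s₁ > 1` (or `s = ∅`), and `g_β(s; α)`, which has
weight `|s| + 1`, with `β ≠ 0`. -/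
def qGen (N k : ℕ) : Set ℂ⟦X⟧ :=
  {f | ∃ w : Word N, Adm w ∧ weight w = k ∧ f = bracket w} ∪
    {f | ∃ (β : ZMod N) (w : Word N), β ≠ 0 ∧ weight w + 1 = k ∧ f = gser β w}

/-- The space spanned over `ℚ(η)` by all these generators. -/
def qMZ (N : ℕ) : Submodule (QN N) ℂ⟦X⟧ := Submodule.span (QN N) {f | ∃ k, f ∈ qGen N k}

/-- Its weight filtration. -/
def qMZFil (N k : ℕ) : Submodule (QN N) ℂ⟦X⟧ :=
  Submodule.span (QN N) {f | ∃ j ≤ k, f ∈ qGen N j}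

/-- The numbers of weight `k`: `ζ_N(s; α)` with `s₁ > 1` (or `s = ∅`), and `Γ_β(s; α)`. -/
def mGen (N k : ℕ) : Set ℂ :=
  {x | ∃ w : Word N, Adm w ∧ weight w = k ∧ x = zeta w} ∪
    {x | ∃ (β : ZMod N) (w : Word N), β ≠ 0 ∧ weight w + 1 = k ∧ x = Gam β w}

/-- The space of numbers spanned over `ℚ(η)` by these values. -/
def MZ (N : ℕ) : Submodule (QN N) ℂ := Submodule.span (QN N) {x | ∃ k, x ∈ mGen N k}

/-- Its weight filtration. -/
def MZFil (N k : ℕ) : Submodule (QN N) ℂ := Submodule.span (QN N) {x | ∃ j ≤ k, x ∈ mGen N j}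

/-- The space of numbers spanned over `ℚ` by the same values. -/
def MZQ (N : ℕ) : Submodule ℚ ℂ := Submodule.span ℚ {x | ∃ k, x ∈ mGen N k}

theorem qGen_mem {k : ℕ} {f : ℂ⟦X⟧} (hf : f ∈ qGen N k) : f ∈ qMZFil N k :=
  Submodule.subset_span ⟨k, le_rfl, hf⟩

theorem bracket_mem_qMZFil {w : Word N} (hw : Adm w) : bracket w ∈ qMZFil N (weight w) :=
  qGen_mem (Or.inl ⟨w, hw, rfl, rfl⟩)

theorem gser_mem_qMZFil (β : ZMod N) (w : Word N) : gser β w ∈ qMZFil N (weight w + 1) := by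
  by_cases hβ : β = 0
  · have : gser β w = 0 := by rw [hβ, gser, sub_self]
    rw [this]
    exact zero_mem _
  · exact qGen_mem (Or.inr ⟨β, w, hβ, rfl, rfl⟩)

theorem bracket_mem_MDFil (w : Word N) : bracket w ∈ MDFil N (weight w) :=
  Submodule.subset_span ⟨w, le_rfl, rfl⟩

theorem weight_cons (a : Letter N) (w : Word N) : weight (a :: w) = a.1 + weight w := by
  simp [weight]

theorem qMZFil_le_MDFil (k : ℕ) : qMZFil N k ≤ MDFil N k := by
  refine Submodule.span_le.2 ?_
  rintro f ⟨j, hj, ⟨w, -, hw, rfl⟩ | ⟨β, w, -, hw, rfl⟩⟩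
  · exact Submodule.subset_span ⟨w, hw.le.trans hj, rfl⟩
  · refine sub_mem (Submodule.subset_span ⟨_, ?_, rfl⟩) (Submodule.subset_span ⟨_, ?_, rfl⟩) <;>
    · rw [weight_cons, add_comm]
      exact hw.le.trans hj

theorem tN_mem_MDFil [NeZero N] : tN N ∈ MDFil N 1 :=
  Submodule.sum_mem _ fun α _ => bracket_mem_MDFil [(1, α)]

/-- The `ℚ`-form of the associated graded algebra: the `ℚ`-span of the classes, each in the degree
given by its weight, of the generators. -/
def qMZbarQ (h : IsFilteredAlg (qMZ N) (qMZFil N)) : Submodule ℚ (AssocGr h) :=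
  Submodule.span ℚ
    {x | ∃ (k : ℕ) (f : ℂ⟦X⟧) (hf : f ∈ qGen N k), x = symb h k ⟨f, qGen_mem hf⟩}

/-! ### The stuffle product -/

/-- The list, with multiplicities, of the words in the stuffle product of two words:
`z_{s;α} w * z_{t;β} v = z_{s;α} (w * z_{t;β} v) + z_{t;β} (z_{s;α} w * v)
+ δ_{α,β} z_{s+t;α} (w * v)`. -/
def stuffle : Word N → Word N → List (Word N)
  | [], v => [v]
  | a :: w, [] => [a :: w]
  | a :: w, b :: v =>
      (stuffle w (b :: v)).map (a :: ·) ++ (stuffle (a :: w) v).map (b :: ·) ++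
        if a.2 = b.2 then (stuffle w v).map ((a.1 + b.1, a.2) :: ·) else []
termination_by w v => w.length + v.length

/-- Formal linear combinations of words. -/
abbrev Formal (N : ℕ) : Type := Word N →₀ ℤ

/-- The bilinear extension of the stuffle product. -/
def stuffleMul (x y : Formal N) : Formal N :=
  x.sum fun w a => y.sum fun v b =>
    (a * b) • ((stuffle w v).map fun u => Finsupp.single u (1 : ℤ)).sum

/-- The linear extension of `w ↦ [w]`. -/
def bracketL : Formal N →ₗ[ℤ] ℂ⟦X⟧ := Finsupp.linearCombination ℤ bracket

/-- The formal counterpart of the generators of weight `k`: admissible words and the differences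
`z_{1;0} w - z_{1;β} w`. -/
def formalGen (N k : ℕ) : Set (Formal N) :=
  {x | ∃ w : Word N, Adm w ∧ weight w = k ∧ x = Finsupp.single w 1} ∪
    {x | ∃ (β : ZMod N) (w : Word N), weight w + 1 = k ∧
      x = Finsupp.single ((1, 0) :: w) 1 - Finsupp.single ((1, β) :: w) 1}

/-! ### The stuffle-regularized zeta values -/

/-- The number of leading letters with `s = 1`. -/
def lead (w : Word N) : ℕ := (w.takeWhile fun a => a.1 = 1).length

/-- The word `z_{1;β₁} ⋯ z_{1;β_m} s`. -/
def onesCons {m : ℕ} (β : Fin m → ZMod N) (s : Word N) : Word N :=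
  List.ofFn (fun i => ((1, β i) : Letter N)) ++ s

/-- `ζ*_N(1; β) = (T + ∑ γ, Γ_γ) / N - Γ_β`, where `T` is the polynomial variable. -/
def starOne [NeZero N] (β : ZMod N) : ℂ[X] :=
  Polynomial.C (1 / (N : ℂ)) * (Polynomial.X + Polynomial.C (∑ γ : ZMod N, Gam γ [])) -
    Polynomial.C (Gam β [])

/-- The matrix with `(M x)(β) = N x(β₀, …, β_m)
+ ∑_{1 ≤ ℓ ≤ m} ∑_γ x(β₁, …, β_ℓ, γ, β_{ℓ+1}, …, β_m)`. -/
def regMatrix (N : ℕ) [NeZero N] (m : ℕ) :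
    Matrix (Fin (m + 1) → ZMod N) (Fin (m + 1) → ZMod N) ℚ :=
  fun β β' => (if β = β' then (N : ℚ) else 0) +
    ∑ l ∈ (Finset.univ : Finset (Fin (m + 1))).filter (fun l => l ≠ 0), ∑ γ : ZMod N,
      if β' = l.insertNth γ (Fin.tail β) then 1 else 0

/-- The right-hand side `b(β₀, …, β_m)` of the linear system for the values
`ζ*_N({1}^{m+1}, s; β, α)`, where `prev` holds the values with at most `m` leading ones: with
`w' = z_{1;β₁} ⋯ z_{1;β_m} s` it is `T ζ*(w') + ∑_γ Γ_γ(w') - N Γ_{β₀}(w')` minus those terms of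
`∑_γ z_{1;γ} * w'` that have at most `m` leading ones. -/
def regRhs [NeZero N] (m : ℕ) (prev : Word N → ℂ[X]) (s : Word N) (β : Fin (m + 1) → ZMod N) :
    ℂ[X] :=
  let w' := onesCons (Fin.tail β) s
  Polynomial.X * prev w' + Polynomial.C (∑ γ : ZMod N, Gam γ w') -
    Polynomial.C ((N : ℂ) * Gam (β 0) w') -
    ∑ γ : ZMod N, (((stuffle [(1, γ)] w').filter fun u => lead u ≤ m).map prev).sum

/-- `starTab m w` is `ζ*_N(w)` for the words `w` with at most `m` leading ones. One leading one is
removed by the stuffle relation `ζ*(1; β) ζ(s; α) = ζ*(1, s; β, α) + ⋯`; the values with `m + 1 ≥ 2`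
leading ones are the solution of the linear system with matrix `regMatrix N m`. -/
def starTab [NeZero N] : ℕ → Word N → ℂ[X]
  | 0, w => Polynomial.C (zeta w)
  | m + 1, w =>
      let β : Fin (m + 1) → ZMod N := fun i => (w.getD i (1, 0)).2
      let s : Word N := w.drop (m + 1)
      if lead w ≤ m then starTab m w
      else if m = 0 then
        starOne (β 0) * Polynomial.C (zeta s) -
          (((stuffle [(1, β 0)] s).filter fun u => lead u = 0).map
            fun u => Polynomial.C (zeta u)).sum
      else
        ∑ β' : Fin (m + 1) → ZMod N,
          Polynomial.C (((regMatrix N m)⁻¹ β β' : ℚ) : ℂ) * regRhs m (starTab m) s β'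

/-- The `*`-regularized value `ζ*_N(s; α)`, a polynomial in `T`. -/
def zetaStar [NeZero N] (w : Word N) : ℂ[X] := starTab (lead w) w

end LevelMZV

end

open LevelMZV

noncomputable section

open scoped Topology

namespace LevelMZV

/-! ### Maps out of the associated graded algebra -/

section Graded

variable {K A C : Type*} [Field K] [CommRing A] [Algebra K A] [Semiring C] [Algebra K C]
variable {V : Submodule K A} {F : ℕ → Submodule K A}

/-! Evaluate a series of weight k at q = r η⁻¹ and let r tend to 1 from below. At the index u a
letter with residue α sees the root of unity η^(α-u), so after scaling by (1-r)^s the letter z_{s;α}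
tends to 1/u^s if u ≡ α mod N and to 0 otherwise. Hence (1-r)^k f(r η⁻¹) tends to ζ_N for admissible
words (`adm_rate`). The two halves of g_β diverge separately, but they can be compared term by term
once the outer index of one of them is shifted so that the residues match; the limit is Γ_β
(`gam_rate`). The scaled value `tval` of t_N diverges, more slowly than any negative power of 1-r
(`tendsto_norm_tval`, `moderate_tval`).

All maps Z are read off from asymptotic expansions. `HasExp N k f P` says that (1-r)^k f(r η⁻¹) =
P(tval) + O((1-r)^θ) for some θ > 0. Since |tval| → ∞, the polynomial P is determined by f and k
(`HasExp.unique`). Since the error saves a power of 1-r while polynomials in tval lose less than any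
power, expansions multiply (`HasExp.mul`), and a surplus factor 1-r kills everything of lower weight
(`HasExp.succ`). So f ↦ P is well defined, linear and multiplicative, whatever linear relations hold
among the series. That the numbers form algebras is then deduced from the algebras of series.

The algebra of the series rests on y_a = η^a x / (1 - η^a x). It satisfies x y' = y + y², so a
letter of weight s is a polynomial in y_a without constant term and with leading term y_a^s; for a ≠
b partial fractions write y_a y_b in terms of y_a and y_b. Therefore the product of two letters is
their stuffle term plus letters of lower weight (`fullLetter_mul_sub_mem`), and products of nested
sums follow the stuffle product up to lower weight (`stuffleErr_mem`). For qMZ the error must in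
addition avoid isolated leading letters z_{1;β}. To see this, each letter carries its value at x =
∞, which is -1 in weight one and 0 otherwise. A combination of letters that vanishes at infinity
only involves differences z_{1;0} - z_{1;β} and letters of weight at least two, and vanishing at
infinity is stable under products (`FiniteLetter.err_mem`).

For several leading ones, t_N [w'] is the sum of all insertions of a letter z_{1;γ} into w', up to
words with fewer leading ones and lower weight. With the series g_γ this becomes a linear system
over ℚ for the words with m+1 leading ones; its matrix is invertible (`isUnit_regMatrix`). Solved
among series, it shows that MD is generated by qMZ and t_N (`MDFil_le_tSpan`); solved among
expansions, it is the recursion defining ζ* (`hasExp_starTab`).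

The rational forms exist because the stuffle product has integer coefficients: irrational elements
of ℚ(η) enter only through the lower-weight errors, which vanish in the graded algebra and under Z.
-/

theorem symb_eq_zero (h : IsFilteredAlg V F) {k : ℕ} {f : F k} (hf : (f : A) ∈ below F k) :
    symb h k f = 0 :=
  (congrArg (DirectSum.lof K ℕ (Gr F) k) (grMk_eq_zero hf)).trans (map_zero _)

theorem symb_mul (h : IsFilteredAlg V F) (i j : ℕ) (f : F i) (g : F j) :
    symb h i f * symb h j g = symb h (i + j) ⟨f.1 * g.1, h.mul_mem f.2 g.2⟩ := by
  let := gCommRing h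
  exact DirectSum.of_mul_of (A := Gr F) (grMk F i f) (grMk F j g)

theorem symb_one (h : IsFilteredAlg V F) : symb h 0 ⟨1, h.one_mem⟩ = 1 := rfl

theorem symb_eq_symb (h : IsFilteredAlg V F) {k : ℕ} {f g : F k}
    (hf : (f : A) - g ∈ below F k) : symb h k f = symb h k g := by
  rw [← sub_eq_zero, ← map_sub]
  exact symb_eq_zero h hf

theorem symb_congr (h : IsFilteredAlg V F) {i j : ℕ} (e : i = j) {f : F i} {g : F j}
    (hfg : (f : A) = g) : symb h i f = symb h j g := by
  subst e
  rw [Subtype.ext hfg]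

theorem assocGr_induction (h : IsFilteredAlg V F) {p : AssocGr h → Prop} (h0 : p 0)
    (hs : ∀ k f, p (symb h k f)) (ha : ∀ x y, p x → p y → p (x + y)) (x : AssocGr h) : p x := by
  refine DirectSum.induction_on (β := Gr F) x h0 ?_ ha
  intro i y
  obtain ⟨f, rfl⟩ := grMk_surj i y
  exact hs i f

theorem assocGr_algHom_ext (h : IsFilteredAlg V F) {f g : AssocGr h →ₐ[K] C}
    (hfg : ∀ k x, f (symb h k x) = g (symb h k x)) : f = g := by
  refine AlgHom.ext fun x => ?_
  refine assocGr_induction h (p := fun x => f x = g x) ?_ hfg ?_ x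
  · simp
  · intro x y hx hy
    simp [hx, hy]

/-- A multiplicative family of linear maps on the steps of a filtration that kills the lower
steps factors through the associated graded algebra. -/
theorem exists_grLift (h : IsFilteredAlg V F) (Z : ∀ k, F k →ₗ[K] C)
    (h1 : Z 0 ⟨1, h.one_mem⟩ = 1)
    (hmul : ∀ (j k : ℕ) (f : F j) (g : F k),
      Z (j + k) ⟨f * g, h.mul_mem f.2 g.2⟩ = Z j f * Z k g)
    (hlow : ∀ (k : ℕ) (f : F k), Z (k + 1) ⟨f, h.mono (Nat.le_succ k) f.2⟩ = 0) :
    ∃ Φ : AssocGr h →ₐ[K] C, ∀ k f, Φ (symb h k f) = Z k f := by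
  let := gCommRing h
  let := gAlgebra h
  -- `C` is only a semiring, but a module over a field has negatives; they are needed to pass to the
  -- quotients.
  let : AddCommGroup C := Module.addCommMonoidToAddCommGroup K
  have hker : ∀ k, (below F k).submoduleOf (F k) ≤ LinearMap.ker (Z k) := by
    intro k f hf
    have hf' : (f : A) ∈ below F k := hf
    rw [LinearMap.mem_ker]
    cases k with
    | zero =>
      have : f = 0 := Subtype.ext (by simpa [below] using hf')
      rw [this, map_zero]
    | succ k => exact hlow k ⟨f, hf'⟩
  let z : ∀ k, Gr F k →ₗ[K] C := fun k => Submodule.liftQ _ (Z k) (hker k)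
  have hz : ∀ k f, z k (grMk F k f) = Z k f := fun k f => rfl
  let Φ : (⨁ k, Gr F k) →ₐ[K] C := DirectSum.toAlgebra K (Gr F) z
    (by exact h1)
    (by
      intro i j x y
      obtain ⟨f, rfl⟩ := grMk_surj i x
      obtain ⟨g, rfl⟩ := grMk_surj j y
      exact hmul i j f g)
  refine ⟨Φ, fun k f => ?_⟩
  exact DirectSum.toAddMonoid_of (β := Gr F) (fun k => (z k).toAddMonoidHom) k (grMk F k f)

end Graded

/-! ### The algebra of letters -/

section Letters

variable {N : ℕ}

theorem eta_pow_val [NeZero N] (u : ℕ) : eta N ^ ((u : ZMod N)).val = eta N ^ u := by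
  rw [ZMod.val_natCast, eta, ← pow_mod_orderOf _ u,
    ← (Complex.isPrimitiveRoot_exp N (NeZero.ne N)).eq_orderOf]

theorem isPrimitiveRoot_eta [NeZero N] : IsPrimitiveRoot (eta N) N :=
  Complex.isPrimitiveRoot_exp N (NeZero.ne N)

theorem eta_pow_val_injective [NeZero N] :
    Function.Injective fun a : ZMod N => eta N ^ a.val := by
  intro a b hab
  exact ZMod.val_injective N (isPrimitiveRoot_eta.pow_inj (ZMod.val_lt a) (ZMod.val_lt b) hab)

/-- The root of unity `η ^ a` as an element of `ℚ(η)`. -/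
def root (a : ZMod N) : QN N :=
  ⟨eta N, IntermediateField.subset_adjoin ℚ _ rfl⟩ ^ a.val

theorem coe_root (a : ZMod N) : (root a : ℂ) = eta N ^ a.val := by
  simp [root]

theorem root_injective [NeZero N] : Function.Injective (root : ZMod N → QN N) := by
  intro a b hab
  refine eta_pow_val_injective ?_
  simp only [← coe_root, hab]

/-- The series `∑ η ^ (a m) m ^ n / n! X ^ m` over `m > 0`. -/
def letterSeries (n : ℕ) (a : ZMod N) : ℂ⟦X⟧ :=
  PowerSeries.mk fun m =>
    if m = 0 then 0 else eta N ^ (a.val * m) * (m : ℂ) ^ n * (1 / (n.factorial : ℂ))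

theorem smul_eq_C_mul' (c : QN N) (f : ℂ⟦X⟧) : c • f = PowerSeries.C (c : ℂ) * f := by
  rw [← PowerSeries.smul_eq_C_mul]
  rfl

/-- The geometric series y = cX/(1 - cX) with c = η^a, written without a denominator. All relations
among letters are consequences of this equation. -/
theorem letterSeries_zero_eq (a : ZMod N) :
    letterSeries 0 a = PowerSeries.C (root a : ℂ) * PowerSeries.X * (1 + letterSeries 0 a) := by
  ext m
  cases m with
  | zero => simp [letterSeries]
  | succ m =>
    rw [mul_assoc, PowerSeries.coeff_C_mul, mul_comm PowerSeries.X, PowerSeries.coeff_succ_mul_X]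
    cases m with
    | zero => simp [letterSeries, coe_root]
    | succ m =>
      simp [letterSeries, coe_root, PowerSeries.coeff_one]
      ring

/-- The operator `X d/dX`, acting by zero on the second factor. -/
def eulerOp (N : ℕ) : ℂ⟦X⟧ × QN N →ₗ[QN N] ℂ⟦X⟧ × QN N where
  toFun f := (PowerSeries.X * PowerSeries.derivative ℂ f.1, 0)
  map_add' f g := by simp [mul_add]
  map_smul' c f := by
    ext1
    · simp [smul_eq_C_mul']
      ring
    · simp

/-- A letter together with its value at infinity. -/
def fullLetter (n : ℕ) (a : ZMod N) : ℂ⟦X⟧ × QN N := (letterSeries n a, if n = 0 then -1 else 0)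

/-- X d/dX multiplies the m-th coefficient by m, and the factor n + 1 compensates the normalization
1/n!. The operator thus raises the weight of a letter by one, and what it produces vanishes at
infinity. -/
theorem eulerOp_fullLetter (n : ℕ) (a : ZMod N) :
    eulerOp N (fullLetter n a) = ((n : QN N) + 1) • fullLetter (n + 1) a := by
  ext1
  · ext m
    cases m with
    | zero => simp [eulerOp, fullLetter, letterSeries, smul_eq_C_mul']
    | succ m =>
      simp only [eulerOp, fullLetter, letterSeries, LinearMap.coe_mk, AddHom.coe_mk,
        Prod.smul_mk, smul_eq_C_mul', PowerSeries.coeff_C_mul,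
        PowerSeries.coeff_succ_X_mul, PowerSeries.coeff_derivative, PowerSeries.coeff_mk]
      have : ((n : ℂ) + 1) ≠ 0 := by exact_mod_cast Nat.succ_ne_zero n
      have h2 : (n.factorial : ℂ) ≠ 0 := by exact_mod_cast n.factorial_ne_zero
      rw [Nat.factorial_succ]
      push_cast
      field_simp
      ring
  · simp [eulerOp, fullLetter]

/-- Partial fractions for two simple poles at different points. Dividing by η^a - η^b is what forces
coefficients in ℚ(η) instead of ℚ. The identity also holds at infinity, where it reads 1 = 1. -/
theorem fullLetter_mul_of_ne [NeZero N] {a b : ZMod N} (hab : a ≠ b) :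
    fullLetter 0 a * fullLetter 0 b =
      (root b / (root a - root b)) • fullLetter 0 a -
        (root a / (root a - root b)) • fullLetter 0 b := by
  have hne : root a - root b ≠ 0 := sub_ne_zero.2 fun h => hab (root_injective h)
  have key : (root a - root b) • (fullLetter 0 a * fullLetter 0 b) =
      root b • fullLetter 0 a - root a • fullLetter 0 b := by
    ext1
    · simp only [fullLetter, Prod.smul_mk, Prod.mk_mul_mk, smul_eq_C_mul', Prod.mk_sub_mk]
      have ha := letterSeries_zero_eq a
      have hb := letterSeries_zero_eq b
      push_cast
      rw [map_sub]
      set A := letterSeries 0 a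
      set B := letterSeries 0 b
      -- The multipliers are chosen so that the two terms with X (1 + A)(1 + B) cancel.
      linear_combination (-(PowerSeries.C (root b : ℂ)) * (1 + B)) * ha +
        (PowerSeries.C (root a : ℂ)) * (1 + A) * hb
    · simp [fullLetter]
      ring
  rw [div_eq_inv_mul, div_eq_inv_mul, mul_smul, mul_smul, ← smul_sub, ← key, smul_smul,
    inv_mul_cancel₀ hne, one_smul]

/-- The Riccati equation of y = cX/(1 - cX), obtained by differentiating its functional equation; at
infinity -1 + (-1)² = 0. -/
theorem eulerOp_fullLetter_zero (a : ZMod N) :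
    eulerOp N (fullLetter 0 a) = fullLetter 0 a + fullLetter 0 a ^ 2 := by
  ext1
  · have ha := letterSeries_zero_eq a
    have hd := congrArg (PowerSeries.derivative ℂ) ha
    simp only [Derivation.leibniz, smul_eq_mul, PowerSeries.derivative_C, map_add,
      PowerSeries.derivative_X, Derivation.map_one_eq_zero] at hd
    simp only [eulerOp, fullLetter, LinearMap.coe_mk, AddHom.coe_mk, 
      Prod.fst_add, Prod.fst_mul, pow_two]
    set A := letterSeries 0 a
    set D := PowerSeries.derivative ℂ A
    set c := PowerSeries.C (root a : ℂ)
    linear_combination (PowerSeries.X * (1 + A)) * hd - (1 + A + PowerSeries.X * D) * ha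
  · simp [eulerOp, fullLetter]

theorem eulerOp_pow (f : ℂ⟦X⟧ × QN N) (hf : (eulerOp N f).1 = f.1 + f.1 ^ 2) (hf' : f.2 = -1)
    (n : ℕ) : eulerOp N (f ^ (n + 1)) = ((n : QN N) + 1) • (f ^ (n + 1) + f ^ (n + 2)) := by
  ext1
  · simp only [eulerOp, LinearMap.coe_mk, AddHom.coe_mk, Prod.pow_fst, Prod.smul_fst, Prod.fst_add,
      PowerSeries.derivative_pow, smul_eq_C_mul'] at hf ⊢
    push_cast
    simp only [map_add, map_natCast, map_one]
    linear_combination ((n : ℂ⟦X⟧) + 1) * f.1 ^ n * hf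
  · simp only [eulerOp, LinearMap.coe_mk, AddHom.coe_mk, Prod.pow_snd, Prod.smul_snd, Prod.snd_add,
      hf', smul_eq_mul]
    ring

/-- The span of the powers `y_a ^ i` with `1 ≤ i ≤ k`. -/
def powSpan (N k : ℕ) : Submodule (QN N) (ℂ⟦X⟧ × QN N) :=
  Submodule.span (QN N) {f | ∃ (i : ℕ) (a : ZMod N), i < k ∧ f = fullLetter 0 a ^ (i + 1)}

/-- The span of the letters of weight at most `k`. -/
def letterSpan (N k : ℕ) : Submodule (QN N) (ℂ⟦X⟧ × QN N) :=
  Submodule.span (QN N) {f | ∃ (n : ℕ) (a : ZMod N), n < k ∧ f = fullLetter n a}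

theorem powSpan_mono {k l : ℕ} (h : k ≤ l) : powSpan N k ≤ powSpan N l :=
  Submodule.span_mono fun _ ⟨i, a, hi, e⟩ => ⟨i, a, hi.trans_le h, e⟩

theorem letterSpan_mono {k l : ℕ} (h : k ≤ l) : letterSpan N k ≤ letterSpan N l :=
  Submodule.span_mono fun _ ⟨i, a, hi, e⟩ => ⟨i, a, hi.trans_le h, e⟩

theorem pow_mem_powSpan {i k : ℕ} (a : ZMod N) (h : i < k) :
    fullLetter 0 a ^ (i + 1) ∈ powSpan N k :=
  Submodule.subset_span ⟨i, a, h, rfl⟩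

theorem fullLetter_mem_letterSpan {n k : ℕ} (a : ZMod N) (h : n < k) :
    fullLetter n a ∈ letterSpan N k :=
  Submodule.subset_span ⟨n, a, h, rfl⟩

theorem eulerOp_mem_powSpan {k : ℕ} {f : ℂ⟦X⟧ × QN N} (hf : f ∈ powSpan N k) :
    eulerOp N f ∈ powSpan N (k + 1) := by
  suffices powSpan N k ≤ (powSpan N (k + 1)).comap (eulerOp N) from this hf
  refine Submodule.span_le.2 ?_
  rintro _ ⟨i, a, hi, rfl⟩
  change eulerOp N _ ∈ powSpan N (k + 1)
  rw [eulerOp_pow _ (by rw [eulerOp_fullLetter_zero]; rfl) (by simp [fullLetter])]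
  exact Submodule.smul_mem _ _ (add_mem (pow_mem_powSpan a (by omega))
    (pow_mem_powSpan a (by omega)))

/-- Repeated use of the Euler operator on y turns the Riccati equation into a triangular change of
basis: the letter of weight n + 1 is y^(n+1) plus smaller positive powers of y. The induction
divides by n + 1. -/
theorem fullLetter_sub_pow_mem (n : ℕ) (a : ZMod N) :
    fullLetter n a - fullLetter 0 a ^ (n + 1) ∈ powSpan N n := by
  induction n with
  | zero => simp
  | succ n ih =>
    have hn : (n : QN N) + 1 ≠ 0 := by exact_mod_cast Nat.succ_ne_zero n
    have h1 := eulerOp_mem_powSpan ih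
    rw [map_sub, eulerOp_fullLetter, eulerOp_pow _ (by rw [eulerOp_fullLetter_zero]; rfl)
      (by simp [fullLetter]), ← smul_sub] at h1
    have h2 := (Submodule.smul_mem_iff _ hn).1 h1
    -- The power y^(n+1) produced by the Riccati equation next to y^(n+2) is of lower order and is
    -- absorbed in the span.
    have h3 := add_mem h2 (pow_mem_powSpan (k := n + 1) a (Nat.lt_succ_self n))
    convert h3 using 1
    ring

theorem fullLetter_mem_powSpan {n k : ℕ} (a : ZMod N) (h : n < k) :
    fullLetter n a ∈ powSpan N k := by
  have := add_mem (powSpan_mono h.le (fullLetter_sub_pow_mem n a)) (pow_mem_powSpan a h)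
  simpa using this

theorem powSpan_le_letterSpan (k : ℕ) : powSpan N k ≤ letterSpan N k := by
  induction k with
  | zero =>
    refine Submodule.span_le.2 ?_
    rintro _ ⟨i, a, hi, rfl⟩
    omega
  | succ k ih =>
    refine Submodule.span_le.2 ?_
    rintro _ ⟨i, a, hi, rfl⟩
    have h1 := letterSpan_mono (by omega : k ≤ k + 1)
      (ih (powSpan_mono (by omega : i ≤ k) (fullLetter_sub_pow_mem i a)))
    have := sub_mem (fullLetter_mem_letterSpan a hi) h1
    simpa using this

/-- Every application of the partial fraction identity lowers the total exponent by one, and the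
process ends with pure powers. The total exponent is i + j + 2, so at least one order is lost
compared with a ≠ b replaced by a = b. -/
theorem pow_mul_pow_mem_of_ne [NeZero N] {a b : ZMod N} (hab : a ≠ b) (i j : ℕ) :
    fullLetter 0 a ^ (i + 1) * fullLetter 0 b ^ (j + 1) ∈ powSpan N (i + j + 1) := by
  have hk : ∀ i j : ℕ, fullLetter 0 a ^ (i + 1) * fullLetter 0 b ^ (j + 1) =
      (root b / (root a - root b)) • (fullLetter 0 a ^ (i + 1) * fullLetter 0 b ^ j) -
        (root a / (root a - root b)) • (fullLetter 0 a ^ i * fullLetter 0 b ^ (j + 1)) := by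
    intro i j
    calc _ = fullLetter 0 a ^ i * fullLetter 0 b ^ j * (fullLetter 0 a * fullLetter 0 b) := by
            ring
      _ = _ := by
        rw [fullLetter_mul_of_ne hab, mul_sub, mul_smul_comm, mul_smul_comm]
        ring_nf
  induction i generalizing j with
  | zero =>
    induction j with
    | zero =>
      rw [hk]
      simpa using sub_mem (Submodule.smul_mem _ _ (pow_mem_powSpan a (i := 0) one_pos))
        (Submodule.smul_mem _ _ (pow_mem_powSpan b (i := 0) one_pos))
    | succ j ih =>
      rw [hk]
      refine sub_mem (Submodule.smul_mem _ _ (powSpan_mono (by omega) ih))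
        (Submodule.smul_mem _ _ ?_)
      simpa using pow_mem_powSpan b (by omega : j + 1 < 0 + (j + 1) + 1)
  | succ i ihi =>
    induction j with
    | zero =>
      rw [hk]
      refine sub_mem (Submodule.smul_mem _ _ ?_)
        (Submodule.smul_mem _ _ (powSpan_mono (by omega) (ihi 0)))
      simpa using pow_mem_powSpan a (by omega : i + 1 < i + 1 + 0 + 1)
    | succ j ih =>
      rw [hk]
      exact sub_mem (Submodule.smul_mem _ _ (powSpan_mono (by omega) ih))
        (Submodule.smul_mem _ _ (powSpan_mono (by omega) (ihi (j + 1))))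

theorem powSpan_mul_mem [NeZero N] {i j : ℕ} {f g : ℂ⟦X⟧ × QN N} (hf : f ∈ powSpan N i)
    (hg : g ∈ powSpan N j) : f * g ∈ powSpan N (i + j) := by
  refine Submodule.span_induction₂ (p := fun f g _ _ => f * g ∈ powSpan N (i + j))
    ?_ ?_ ?_ ?_ ?_ ?_ ?_ hf hg
  · rintro _ _ ⟨k, a, hk, rfl⟩ ⟨l, b, hl, rfl⟩
    by_cases hab : a = b
    · subst hab
      rw [← pow_add, show k + 1 + (l + 1) = k + l + 1 + 1 by omega]
      exact pow_mem_powSpan a (by omega)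
    · exact powSpan_mono (by omega) (pow_mul_pow_mem_of_ne hab k l)
  · intro g _; simp
  · intro f _; simp
  · intro f g h _ _ _ h1 h2; rw [add_mul]; exact add_mem h1 h2
  · intro f g h _ _ _ h1 h2; rw [mul_add]; exact add_mem h1 h2
  · intro c f g _ _ h; rw [smul_mul_assoc]; exact Submodule.smul_mem _ _ h
  · intro c f g _ _ h; rw [mul_smul_comm]; exact Submodule.smul_mem _ _ h

/-- The stuffle rule for single letters. Replacing both letters by their leading powers costs lower
powers; equal residues then give y^(n+m+2), the leading power of the merged letter, while distinct
residues give nothing of top weight. -/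
theorem fullLetter_mul_sub_mem [NeZero N] (n m : ℕ) (a b : ZMod N) :
    fullLetter n a * fullLetter m b - (if a = b then fullLetter (n + m + 1) a else 0) ∈
      letterSpan N (n + m + 1) := by
  refine powSpan_le_letterSpan _ ?_
  have h1 : fullLetter n a * fullLetter m b - fullLetter 0 a ^ (n + 1) * fullLetter 0 b ^ (m + 1) ∈
      powSpan N (n + m + 1) := by
    have e : fullLetter n a * fullLetter m b -
        fullLetter 0 a ^ (n + 1) * fullLetter 0 b ^ (m + 1) =
        (fullLetter n a - fullLetter 0 a ^ (n + 1)) * fullLetter m b +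
          fullLetter 0 a ^ (n + 1) * (fullLetter m b - fullLetter 0 b ^ (m + 1)) := by ring
    rw [e]
    refine add_mem ?_ ?_
    · exact powSpan_mono (by omega) (powSpan_mul_mem (fullLetter_sub_pow_mem n a)
        (fullLetter_mem_powSpan b (Nat.lt_succ_self m)))
    · exact powSpan_mono (by omega) (powSpan_mul_mem (pow_mem_powSpan a (Nat.lt_succ_self n))
        (fullLetter_sub_pow_mem m b))
  split_ifs with hab
  · subst hab
    have := sub_mem h1 (fullLetter_sub_pow_mem (n + m + 1) a)
    convert this using 1
    ring
  · have := add_mem h1 (pow_mul_pow_mem_of_ne hab n m)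
    simpa using this

end Letters

/-! ### Truncated sums and the quasi-shuffle product -/

section Truncated

variable {N : ℕ}

/-- The substitution `f(q) ↦ f(q ^ u)`, replaced by zero if `u = 0`. -/
def dil (u : ℕ) : ℂ⟦X⟧ →ₗ[ℂ] ℂ⟦X⟧ :=
  if h : u = 0 then 0 else (PowerSeries.expand u h).toLinearMap

theorem dil_zero : dil 0 = 0 := by simp [dil]

theorem dil_of_ne {u : ℕ} (h : u ≠ 0) (f : ℂ⟦X⟧) : dil u f = PowerSeries.expand u h f := by
  simp [dil, h]

theorem dil_mul (u : ℕ) (f g : ℂ⟦X⟧) : dil u (f * g) = dil u f * dil u g := by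
  by_cases h : u = 0
  · simp [h, dil_zero]
  · simp [dil_of_ne h]

theorem coeff_dil_mul {u : ℕ} (hu : u ≠ 0) {f : ℂ⟦X⟧} (hf : PowerSeries.coeff 0 f = 0)
    (g : ℂ⟦X⟧) (n : ℕ) :
    PowerSeries.coeff n (dil u f * g) =
      ∑ v ∈ (Finset.Icc 1 n).filter (fun v => u * v ≤ n),
        PowerSeries.coeff v f * PowerSeries.coeff (n - u * v) g := by
  rw [PowerSeries.coeff_mul]
  symm
  refine Finset.sum_of_injOn (fun v => (u * v, n - u * v)) ?_ ?_ ?_ ?_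
  · intro v _ w _ h
    exact Nat.eq_of_mul_eq_mul_left (Nat.pos_of_ne_zero hu) (Prod.ext_iff.1 h).1
  · intro v hv
    have := (Finset.mem_filter.1 hv).2
    rw [Finset.mem_coe, Finset.HasAntidiagonal.mem_antidiagonal]
    simp only
    omega
  · rintro ⟨i, j⟩ hij hn
    rw [Finset.HasAntidiagonal.mem_antidiagonal] at hij
    simp only at hij
    rw [dil_of_ne hu, PowerSeries.coeff_expand]
    split_ifs with hd
    · obtain ⟨v, rfl⟩ := hd
      rw [Nat.mul_div_cancel_left _ (Nat.pos_of_ne_zero hu)]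
      rcases Nat.eq_zero_or_pos v with rfl | hv
      · simp only [hf, zero_mul]
      · refine absurd ⟨v, ?_, ?_⟩ hn
        · have h1 : v ≤ u * v := Nat.le_mul_of_pos_left v (Nat.pos_of_ne_zero hu)
          simp only [Finset.coe_filter, Finset.mem_Icc, Set.mem_ofPred_eq]
          omega
        · simp only [Prod.mk.injEq, true_and]
          omega
    · simp only [zero_mul]
  · intro v _
    simp only
    rw [dil_of_ne hu, PowerSeries.coeff_expand_mul]

/-- The summation operator `(a, G) ↦ (M ↦ ∑ a(q ^ u) G(u))`, with the sum over `0 < u < M`. -/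
def sumOp (N : ℕ) : ℂ⟦X⟧ →ₗ[QN N] (ℕ → ℂ⟦X⟧) →ₗ[QN N] (ℕ → ℂ⟦X⟧) :=
  LinearMap.mk₂ (QN N) (fun a G M => ∑ u ∈ Finset.range M, dil u a * G u)
    (fun a b G => by
      ext1 M
      simp [add_mul, Finset.sum_add_distrib])
    (fun c a G => by
      ext1 M
      simp [LinearMap.map_smul_of_tower, Finset.smul_sum])
    (fun a G H => by
      ext1 M
      simp [mul_add, Finset.sum_add_distrib])
    (fun c a G => by
      ext1 M
      simp [Finset.smul_sum])

theorem sumOp_apply (a : ℂ⟦X⟧) (G : ℕ → ℂ⟦X⟧) (M : ℕ) :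
    sumOp N a G M = ∑ u ∈ Finset.range M, dil u a * G u := rfl

theorem sum_range_mul_sum_range {R : Type*} [CommRing R] (f g : ℕ → R) (M : ℕ) :
    (∑ u ∈ Finset.range M, f u) * (∑ u ∈ Finset.range M, g u) =
      ∑ u ∈ Finset.range M, f u * (∑ v ∈ Finset.range u, g v) +
      ∑ u ∈ Finset.range M, g u * (∑ v ∈ Finset.range u, f v) +
      ∑ u ∈ Finset.range M, f u * g u := by
  induction M with
  | zero => simp
  | succ M ih =>
    simp only [Finset.sum_range_succ]
    linear_combination ih

/-- The double sum over u and u' is split according to u > u', u < u' and u = u'. On the diagonal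
the substitution q ↦ q^u is multiplicative, so the letters themselves get multiplied. This is the
quasi-shuffle rule for nested sums with a common upper bound. -/
theorem sumOp_mul_sumOp (a b : ℂ⟦X⟧) (G H : ℕ → ℂ⟦X⟧) :
    sumOp N a G * sumOp N b H =
      sumOp N a (G * sumOp N b H) + sumOp N b (sumOp N a G * H) + sumOp N (a * b) (G * H) := by
  ext1 M
  simp only [Pi.mul_apply, Pi.add_apply, sumOp_apply]
  rw [sum_range_mul_sum_range]
  refine congrArg₂ _ (congrArg₂ _ ?_ ?_) ?_ <;> refine Finset.sum_congr rfl fun u _ => ?_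
  · ring
  · ring
  · rw [dil_mul]
    ring

/-- The series of the letter `z_{s;α}`. -/
def letter (a : Letter N) : ℂ⟦X⟧ := letterSeries ((a.1 : ℕ) - 1) a.2

/-- The truncations of the series `[w]`. -/
def trunc : Word N → ℕ → ℂ⟦X⟧
  | [] => 1
  | a :: w => sumOp N (letter a) (trunc w)

theorem trunc_cons (a : Letter N) (w : Word N) :
    trunc (a :: w) = sumOp N (letter a) (trunc w) := rfl

theorem coeff_zero_letterSeries (n : ℕ) (a : ZMod N) :
    PowerSeries.coeff 0 (letterSeries n a) = 0 := by
  simp [letterSeries]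

theorem coeff_zero_letter (a : Letter N) : PowerSeries.coeff 0 (letter a) = 0 :=
  coeff_zero_letterSeries _ _

theorem coeff_trunc (w : Word N) (M n : ℕ) :
    PowerSeries.coeff n (trunc w M) =
      (w.map fun a => (1 : ℂ) / (((a.1 : ℕ) - 1).factorial : ℂ)).prod * divSum w M n := by
  induction w generalizing M n with
  | nil => simp [trunc, divSum, PowerSeries.coeff_one]
  | cons a w ih =>
    rw [trunc_cons, sumOp_apply, map_sum, divSum, List.map_cons, List.prod_cons, Finset.mul_sum]
    have hs : Finset.Ico 1 M ⊆ Finset.range M := by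
      intro u hu
      simp only [Finset.mem_Ico, Finset.mem_range] at hu ⊢
      exact hu.2
    rw [← Finset.sum_subset hs]
    · refine Finset.sum_congr rfl fun u hu => ?_
      have hu0 : u ≠ 0 := by
        have := (Finset.mem_Ico.1 hu).1
        omega
      rw [coeff_dil_mul hu0 (coeff_zero_letter a), Finset.mul_sum]
      refine Finset.sum_congr rfl fun v hv => ?_
      have hv0 : v ≠ 0 := by
        have := (Finset.mem_Icc.1 (Finset.mem_filter.1 hv).1).1
        omega
      rw [ih]
      simp only [letter, letterSeries, PowerSeries.coeff_mk, if_neg hv0]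
      ring
    · intro u hu hu'
      have : u = 0 := by
        simp only [Finset.mem_Ico, Finset.mem_range] at hu hu'
        omega
      simp [this, dil_zero]

/-- The series whose `n`-th coefficient is that of the `(n + 1)`-st term of the sequence. -/
def diag (N : ℕ) : (ℕ → ℂ⟦X⟧) →ₗ[QN N] ℂ⟦X⟧ where
  toFun G := PowerSeries.mk fun n => PowerSeries.coeff n (G (n + 1))
  map_add' G H := by
    ext n
    simp
  map_smul' c G := by
    ext n
    simp [smul_eq_C_mul']

theorem diag_trunc (w : Word N) : diag N (trunc w) = bracket w := by
  ext n
  simp [diag, bracket, coeff_trunc]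

/-- An outer index u > n cannot contribute to the coefficient of q^n, so coefficients stabilize
along the truncations. -/
theorem coeff_trunc_of_lt (w : Word N) {M n : ℕ} (h : n < M) :
    PowerSeries.coeff n (trunc w M) = PowerSeries.coeff n (bracket w) := by
  rw [← diag_trunc]
  simp only [diag, LinearMap.coe_mk, AddHom.coe_mk, PowerSeries.coeff_mk]
  cases w with
  | nil => rfl
  | cons a w =>
    rw [trunc_cons, sumOp_apply, sumOp_apply, map_sum, map_sum]
    symm
    refine Finset.sum_subset (Finset.range_subset_range.2 h) fun u _ hu => ?_
    have hu' : n < u := by simpa using hu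
    rw [coeff_dil_mul (by omega) (coeff_zero_letter a), Finset.filter_false_of_mem]
    · simp
    · intro v hv
      have := (Finset.mem_Icc.1 hv).1
      nlinarith

/-- Taking diagonal coefficients is not multiplicative for arbitrary sequences; here it is, because
the coefficients up to n are already stable at the bound n + 1. -/
theorem diag_trunc_mul (w v : Word N) :
    diag N (trunc w * trunc v) = bracket w * bracket v := by
  ext n
  simp only [diag, LinearMap.coe_mk, AddHom.coe_mk, PowerSeries.coeff_mk, Pi.mul_apply]
  rw [PowerSeries.coeff_mul, PowerSeries.coeff_mul]
  refine Finset.sum_congr rfl fun p hp => ?_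
  have := Finset.HasAntidiagonal.mem_antidiagonal.1 hp
  rw [coeff_trunc_of_lt w (by omega), coeff_trunc_of_lt v (by omega)]

/-- The span of the truncated sums of weight less than `k`. -/
def truncSpan (N k : ℕ) : Submodule (QN N) (ℕ → ℂ⟦X⟧) :=
  Submodule.span (QN N) {G | ∃ w : Word N, weight w < k ∧ G = trunc w}

/-- The linear extension of `w ↦ trunc w`. -/
def truncL : Formal N →ₗ[ℤ] (ℕ → ℂ⟦X⟧) := Finsupp.linearCombination ℤ trunc

/-- The span of the truncated sums of the formal generators of weight less than `k`. -/
def genSpan (N k : ℕ) : Submodule (QN N) (ℕ → ℂ⟦X⟧) :=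
  Submodule.span (QN N) {G | ∃ i < k, ∃ x ∈ formalGen N i, G = truncL x}

theorem truncSpan_mono {k l : ℕ} (h : k ≤ l) : truncSpan N k ≤ truncSpan N l :=
  Submodule.span_mono fun _ ⟨w, hw, e⟩ => ⟨w, hw.trans_le h, e⟩

theorem genSpan_mono {k l : ℕ} (h : k ≤ l) : genSpan N k ≤ genSpan N l :=
  Submodule.span_mono fun _ ⟨i, hi, e⟩ => ⟨i, hi.trans_le h, e⟩

theorem trunc_mem_truncSpan {w : Word N} {k : ℕ} (h : weight w < k) : trunc w ∈ truncSpan N k :=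
  Submodule.subset_span ⟨w, h, rfl⟩

theorem sumOp_letterSeries_trunc (n : ℕ) (a : ZMod N) (w : Word N) :
    sumOp N (letterSeries n a) (trunc w) = trunc ((n.succPNat, a) :: w) := rfl

theorem bilin_mem_of_mem_span {K P Q R : Type*} [Field K] [AddCommGroup P] [AddCommGroup Q]
    [AddCommGroup R] [Module K P] [Module K Q] [Module K R] (b : P →ₗ[K] Q →ₗ[K] R) {s : Set P}
    {t : Set Q} {T : Submodule K R} (h : ∀ x ∈ s, ∀ y ∈ t, b x y ∈ T) {x : P} {y : Q}
    (hx : x ∈ Submodule.span K s) (hy : y ∈ Submodule.span K t) : b x y ∈ T := by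
  have h1 : Submodule.map₂ b (Submodule.span K s) (Submodule.span K t) ≤ T := by
    rw [Submodule.map₂_span_span, Submodule.span_le]
    rintro _ ⟨x, hx, y, hy, rfl⟩
    exact h x hx y hy
  exact h1 (Submodule.apply_mem_map₂ b hx hy)

theorem sumOp_mem_truncSpan {i j : ℕ} {f : ℂ⟦X⟧ × QN N} {G : ℕ → ℂ⟦X⟧}
    (hf : f ∈ letterSpan N i) (hG : G ∈ truncSpan N j) :
    sumOp N f.1 G ∈ truncSpan N (i + j) := by
  refine bilin_mem_of_mem_span ((sumOp N).comp (LinearMap.fst (QN N) ℂ⟦X⟧ (QN N))) ?_ hf hG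
  rintro _ ⟨n, a, hn, rfl⟩ _ ⟨w, hw, rfl⟩
  refine Submodule.subset_span ⟨_, ?_, sumOp_letterSeries_trunc n a w⟩
  rw [weight_cons, Nat.succPNat_coe]
  omega

/-- The projection to the letters that vanish at infinity. -/
def finitePart (N : ℕ) : ℂ⟦X⟧ × QN N →ₗ[QN N] ℂ⟦X⟧ :=
  LinearMap.fst (QN N) ℂ⟦X⟧ (QN N) +
    (LinearMap.toSpanSingleton (QN N) ℂ⟦X⟧ (letterSeries 0 (0 : ZMod N))).comp
      (LinearMap.snd (QN N) ℂ⟦X⟧ (QN N))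

/-- The projection replaces y_a by y_a - y_0 and fixes letters of higher weight, so prepending a
projected letter to any truncated sum yields, up to sign, a generator of qMZ. -/
theorem sumOp_finitePart_mem_genSpan {i j : ℕ} {f : ℂ⟦X⟧ × QN N} {G : ℕ → ℂ⟦X⟧}
    (hf : f ∈ letterSpan N i) (hG : G ∈ truncSpan N j) :
    sumOp N (finitePart N f) G ∈ genSpan N (i + j) := by
  refine bilin_mem_of_mem_span ((sumOp N).comp (finitePart N)) ?_ hf hG
  rintro _ ⟨n, a, hn, rfl⟩ _ ⟨w, hw, rfl⟩
  rw [LinearMap.comp_apply]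
  cases n with
  | zero =>
    have h : sumOp N (finitePart N (fullLetter 0 a)) (trunc w) =
        - truncL (Finsupp.single ((1, 0) :: w) 1 - Finsupp.single ((1, a) :: w) 1) := by
      rw [map_sub, truncL, Finsupp.linearCombination_single, Finsupp.linearCombination_single,
        one_smul, one_smul, neg_sub]
      have e : finitePart N (fullLetter 0 a) =
          letterSeries 0 a - letterSeries 0 (0 : ZMod N) := by
        simp [finitePart, fullLetter, sub_eq_add_neg]
      rw [e, map_sub, LinearMap.sub_apply]
      rfl
    rw [h]
    exact neg_mem (Submodule.subset_span
      ⟨weight w + 1, by omega, _, Or.inr ⟨a, w, rfl, rfl⟩, rfl⟩)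
  | succ n =>
    have h : sumOp N (finitePart N (fullLetter (n + 1) a)) (trunc w) =
        truncL (Finsupp.single (((n + 1).succPNat, a) :: w) 1) := by
      rw [truncL, Finsupp.linearCombination_single, one_smul]
      have e : finitePart N (fullLetter (n + 1) a) = letterSeries (n + 1) a := by
        simp [finitePart, fullLetter]
      rw [e]
      rfl
    rw [h]
    refine Submodule.subset_span ⟨n + 2 + weight w, by omega, _, Or.inl ⟨_, ?_, ?_, rfl⟩, rfl⟩
    · intro b hb
      simp only [List.head?_cons, Option.mem_def, Option.some.injEq] at hb
      rw [← hb, ← PNat.coe_lt_coe]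
      simp
    · rw [weight_cons, Nat.succPNat_coe]

theorem sumOp_mem_genSpan {i j : ℕ} {f : ℂ⟦X⟧ × QN N} {G : ℕ → ℂ⟦X⟧}
    (hf : f ∈ letterSpan N i) (h0 : f.2 = 0) (hG : G ∈ truncSpan N j) :
    sumOp N f.1 G ∈ genSpan N (i + j) := by
  have e : finitePart N f = f.1 := by simp [finitePart, h0]
  rw [← e]
  exact sumOp_finitePart_mem_genSpan hf hG

end Truncated

/-! ### The stuffle product up to lower weight -/

section Stuffle

variable {N : ℕ}

theorem weight_of_mem_stuffle {w v u : Word N} (hu : u ∈ stuffle w v) :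
    weight u = weight w + weight v := by
  induction w, v using stuffle.induct generalizing u with
  | case1 v =>
    rw [stuffle, List.mem_singleton] at hu
    simp [hu, weight]
  | case2 a w =>
    rw [stuffle, List.mem_singleton] at hu
    simp [hu, weight]
  | case3 a w b v ih1 ih2 ih3 =>
    rw [stuffle, List.mem_append, List.mem_append] at hu
    rcases hu with (hu | hu) | hu
    · obtain ⟨u', hu', rfl⟩ := List.mem_map.1 hu
      rw [weight_cons, ih1 hu', weight_cons a w, add_assoc]
    · obtain ⟨u', hu', rfl⟩ := List.mem_map.1 hu
      rw [weight_cons, ih2 hu', weight_cons b v]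
      omega
    · split_ifs at hu with hab
      · obtain ⟨u', hu', rfl⟩ := List.mem_map.1 hu
        rw [weight_cons, ih3 hu', weight_cons a w, weight_cons b v]
        push_cast
        omega
      · simp at hu

/-- The stuffle product of two words as a formal linear combination. -/
def stuffleWord (w v : Word N) : Formal N :=
  ((stuffle w v).map fun u => Finsupp.single u (1 : ℤ)).sum

/-- Prepending a letter. -/
def consL (a : Letter N) : Formal N →ₗ[ℤ] Formal N := Finsupp.lmapDomain ℤ ℤ (a :: ·)

theorem consL_single (a : Letter N) (w : Word N) (c : ℤ) :
    consL a (Finsupp.single w c) = Finsupp.single (a :: w) c := by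
  simp [consL]

theorem consL_sum_map (a : Letter N) (l : List (Word N)) :
    consL a (l.map fun u => Finsupp.single u (1 : ℤ)).sum =
      ((l.map (a :: ·)).map fun u => Finsupp.single u (1 : ℤ)).sum := by
  rw [map_list_sum, List.map_map, List.map_map]
  congr 1
  refine List.map_congr_left fun u _ => ?_
  simp [consL_single]

theorem stuffleWord_nil_left (v : Word N) : stuffleWord [] v = Finsupp.single v 1 := by
  rw [stuffleWord, stuffle]
  simp

theorem stuffleWord_nil_right (w : Word N) : stuffleWord w [] = Finsupp.single w 1 := by
  cases w with
  | nil => exact stuffleWord_nil_left []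
  | cons a w =>
    rw [stuffleWord, stuffle]
    simp

/-- The formal product of two letters. -/
def mergeL (a b : Letter N) : Formal N →ₗ[ℤ] Formal N :=
  if a.2 = b.2 then consL (a.1 + b.1, a.2) else 0

theorem stuffleWord_cons_cons (a b : Letter N) (w v : Word N) :
    stuffleWord (a :: w) (b :: v) =
      consL a (stuffleWord w (b :: v)) + consL b (stuffleWord (a :: w) v) +
        mergeL a b (stuffleWord w v) := by
  simp only [stuffleWord, consL_sum_map]
  rw [stuffle, List.map_append, List.map_append, List.sum_append, List.sum_append]
  congr 1
  rw [mergeL]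
  split_ifs
  · rw [consL_sum_map]
  · simp

/-- The bilinear extension of `stuffleWord`. -/
def stuffleL (N : ℕ) : Formal N →ₗ[ℤ] Formal N →ₗ[ℤ] Formal N :=
  Finsupp.linearCombination ℤ fun w => Finsupp.linearCombination ℤ (stuffleWord w)

theorem stuffleMul_eq (x y : Formal N) : stuffleMul x y = stuffleL N x y := by
  rw [stuffleMul, stuffleL, Finsupp.linearCombination_apply, Finsupp.sum, Finsupp.sum,
    LinearMap.sum_apply]
  refine Finset.sum_congr rfl fun w _ => ?_
  rw [LinearMap.smul_apply, Finsupp.linearCombination_apply, Finsupp.sum, Finsupp.sum,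
    Finset.smul_sum]
  refine Finset.sum_congr rfl fun v _ => ?_
  rw [mul_smul]
  rfl

theorem stuffleL_single (w v : Word N) :
    stuffleL N (Finsupp.single w 1) (Finsupp.single v 1) = stuffleWord w v := by
  simp [stuffleL]

/-- The formal combinations of words of weight `k`. -/
def homog (N k : ℕ) : AddSubgroup (Formal N) :=
  AddSubgroup.closure {x | ∃ w : Word N, weight w = k ∧ x = Finsupp.single w 1}

theorem stuffleWord_mem_homog (w v : Word N) :
    stuffleWord w v ∈ homog N (weight w + weight v) := by
  refine AddSubgroup.list_sum_mem _ ?_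
  intro x hx
  obtain ⟨u, hu, rfl⟩ := List.mem_map.1 hx
  exact AddSubgroup.subset_closure ⟨u, weight_of_mem_stuffle hu, rfl⟩

theorem truncL_single (w : Word N) : truncL (Finsupp.single w 1) = trunc w := by
  simp [truncL]

theorem bracketL_single (w : Word N) : bracketL (Finsupp.single w 1) = bracket w := by
  simp [bracketL]

theorem diag_truncL (x : Formal N) : diag N (truncL x) = bracketL x := by
  induction x using Finsupp.induction_linear with
  | zero => simp
  | add x y hx hy => simp [hx, hy]
  | single w c =>
    rw [truncL, bracketL, Finsupp.linearCombination_single, Finsupp.linearCombination_single,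
      map_zsmul, diag_trunc]

theorem truncL_consL (a : Letter N) (x : Formal N) :
    truncL (consL a x) = sumOp N (letter a) (truncL x) := by
  induction x using Finsupp.induction_linear with
  | zero => simp
  | add x y hx hy => simp [hx, hy]
  | single w c =>
    rw [consL_single, truncL, Finsupp.linearCombination_single, Finsupp.linearCombination_single,
      map_zsmul, trunc_cons]

/-- The letter with its value at infinity. -/
def full (a : Letter N) : ℂ⟦X⟧ × QN N := fullLetter ((a.1 : ℕ) - 1) a.2

theorem full_fst (a : Letter N) : (full a).1 = letter a := rfl

/-- The main part of the product of two letters. -/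
def merge (a b : Letter N) : ℂ⟦X⟧ × QN N := if a.2 = b.2 then full (a.1 + b.1, a.2) else 0

theorem merge_snd (a b : Letter N) : (merge a b).2 = 0 := by
  have h1 := a.1.pos
  have h2 := b.1.pos
  rw [merge]
  split_ifs
  · have h : ((a.1 + b.1 : ℕ+) : ℕ) - 1 ≠ 0 := by
      rw [PNat.add_coe]
      omega
    exact if_neg h
  · rfl

theorem full_mem (a : Letter N) : full a ∈ letterSpan N a.1 :=
  fullLetter_mem_letterSpan _ (Nat.sub_lt a.1.pos one_pos)

theorem merge_mem (a b : Letter N) : merge a b ∈ letterSpan N (a.1 + b.1) := by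
  rw [merge]
  split_ifs
  · exact full_mem (a.1 + b.1, a.2)
  · exact zero_mem _

theorem full_mul_sub_merge_mem [NeZero N] (a b : Letter N) :
    full a * full b - merge a b ∈ letterSpan N (a.1 + b.1 - 1) := by
  have h1 := a.1.pos
  have h2 := b.1.pos
  have h := fullLetter_mul_sub_mem ((a.1 : ℕ) - 1) ((b.1 : ℕ) - 1) a.2 b.2
  have e : (a.1 : ℕ) - 1 + ((b.1 : ℕ) - 1) + 1 = a.1 + b.1 - 1 := by omega
  rw [e] at h
  exact h

theorem truncL_mergeL (a b : Letter N) (x : Formal N) :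
    truncL (mergeL a b x) = sumOp N (merge a b).1 (truncL x) := by
  rw [mergeL, merge]
  split_ifs
  · rw [truncL_consL, full_fst]
  · simp

/-- The deviation of the truncated sums from the stuffle product. -/
def stuffleErr (w v : Word N) : ℕ → ℂ⟦X⟧ := trunc w * trunc v - truncL (stuffleWord w v)

/-- The quasi-shuffle rule for truncated sums minus the recursion of the formal stuffle product. The
only new error comes from the product of the two leading letters; everything else is an earlier
error with a letter in front. -/
theorem stuffleErr_cons_cons (a b : Letter N) (w v : Word N) :
    stuffleErr (a :: w) (b :: v) =
      sumOp N (full a).1 (stuffleErr w (b :: v)) + sumOp N (full b).1 (stuffleErr (a :: w) v) +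
      sumOp N (full a * full b - merge a b).1 (trunc w * trunc v) +
      sumOp N (merge a b).1 (stuffleErr w v) := by
  simp only [stuffleErr]
  rw [stuffleWord_cons_cons, map_add, map_add, truncL_consL, truncL_consL, truncL_mergeL,
    trunc_cons, trunc_cons, sumOp_mul_sumOp]
  simp only [map_sub, full_fst, Prod.fst_sub, Prod.fst_mul, LinearMap.sub_apply]
  abel

theorem stuffleErr_nil_left (v : Word N) : stuffleErr [] v = 0 := by
  rw [stuffleErr, stuffleWord_nil_left, truncL_single, trunc, one_mul, sub_self]

theorem stuffleErr_nil_right (w : Word N) : stuffleErr w [] = 0 := by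
  rw [stuffleErr, stuffleWord_nil_right, truncL_single, trunc, mul_one, sub_self]

theorem truncL_mem_of_homog {k : ℕ} {x : Formal N} (hx : x ∈ homog N k) :
    truncL x ∈ truncSpan N (k + 1) := by
  induction hx using AddSubgroup.closure_induction with
  | mem x hx =>
    obtain ⟨w, hw, rfl⟩ := hx
    rw [truncL_single]
    exact trunc_mem_truncSpan (by omega)
  | zero => simp
  | add x y _ _ hx hy => rw [map_add]; exact add_mem hx hy
  | neg x _ hx => rw [map_neg]; exact neg_mem hx

/-- By induction: prepending a letter adds its weight to an error that was already too light, and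
the new error has leading letters of weight at most one less than the sum of the two weights. -/
theorem stuffleErr_mem [NeZero N] (w v : Word N) :
    stuffleErr w v ∈ truncSpan N (weight w + weight v) := by
  induction w, v using stuffle.induct with
  | case1 v => rw [stuffleErr_nil_left]; exact zero_mem _
  | case2 a w => rw [stuffleErr_nil_right]; exact zero_mem _
  | case3 a w b v ih1 ih2 ih3 =>
    have h1 := a.1.pos
    have h2 := b.1.pos
    have ht : trunc w * trunc v ∈ truncSpan N (weight w + weight v + 1) := by
      have e : trunc w * trunc v = stuffleErr w v + truncL (stuffleWord w v) := by
        simp [stuffleErr]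
      rw [e]
      exact add_mem (truncSpan_mono (by omega) ih3)
        (truncL_mem_of_homog (stuffleWord_mem_homog w v))
    simp only [weight_cons] at ih1 ih2 ⊢
    rw [stuffleErr_cons_cons]
    refine add_mem (add_mem (add_mem ?_ ?_) ?_) ?_
    · exact truncSpan_mono (by omega) (sumOp_mem_truncSpan (full_mem a) ih1)
    · exact truncSpan_mono (by omega) (sumOp_mem_truncSpan (full_mem b) ih2)
    · exact truncSpan_mono (by omega) (sumOp_mem_truncSpan (full_mul_sub_merge_mem a b) ht)
    · exact truncSpan_mono (by omega) (sumOp_mem_truncSpan (merge_mem a b) ih3)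

theorem trunc_mul_trunc_mem [NeZero N] (w v : Word N) :
    trunc w * trunc v ∈ truncSpan N (weight w + weight v + 1) := by
  have e : trunc w * trunc v = stuffleErr w v + truncL (stuffleWord w v) := by
    simp [stuffleErr]
  rw [e]
  exact add_mem (truncSpan_mono (by omega) (stuffleErr_mem w v))
    (truncL_mem_of_homog (stuffleWord_mem_homog w v))

/-- The formal combinations of generators of weight `k`. -/
def genGroup (N k : ℕ) : AddSubgroup (Formal N) := AddSubgroup.closure (formalGen N k)

theorem single_mem_genGroup {w : Word N} (hw : Adm w) :
    Finsupp.single w 1 ∈ genGroup N (weight w) :=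
  AddSubgroup.subset_closure (Or.inl ⟨w, hw, rfl, rfl⟩)

theorem adm_cons {a : Letter N} (ha : 1 < a.1) (w : Word N) : Adm (a :: w) := by
  intro b hb
  simp only [List.head?_cons, Option.mem_def, Option.some.injEq] at hb
  rwa [← hb]

theorem map_homog_mem {j k : ℕ} (P : Formal N →ₗ[ℤ] Formal N)
    (hP : ∀ u : Word N, weight u = j → P (Finsupp.single u 1) ∈ genGroup N k) {x : Formal N}
    (hx : x ∈ homog N j) : P x ∈ genGroup N k := by
  induction hx using AddSubgroup.closure_induction with
  | mem x hx =>
    obtain ⟨w, hw, rfl⟩ := hx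
    exact hP w hw
  | zero => simp
  | add x y _ _ hx hy => rw [map_add]; exact add_mem hx hy
  | neg x _ hx => rw [map_neg]; exact neg_mem hx

/-- A combination `z_a - c z_{a'}` of two letters of the same weight that vanishes at infinity. -/
structure FiniteLetter (a a' : Letter N) (c : ℤ) : Prop where
  fst_eq : a'.1 = a.1
  snd_eq : (full a).2 = c • (full a').2
  mem : ∀ u : Word N, Finsupp.single (a :: u) 1 - c • Finsupp.single (a' :: u) 1 ∈
    genGroup N (a.1 + weight u)

/-- Both kinds of generators are put in one form z_a - c z_{a'}: c = 0 with a dummy a' for a letter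
of weight at least two, c = 1 for a difference of letters of weight one. -/
theorem formalGen_cases {k : ℕ} {x : Formal N} (hx : x ∈ formalGen N k) :
    (k = 0 ∧ x = Finsupp.single [] 1) ∨
      ∃ (a a' : Letter N) (c : ℤ) (w : Word N), FiniteLetter a a' c ∧ a.1 + weight w = k ∧
        x = Finsupp.single (a :: w) 1 - c • Finsupp.single (a' :: w) 1 := by
  rcases hx with ⟨w, hw, hk, rfl⟩ | ⟨β, w, hk, rfl⟩
  · cases w with
    | nil => exact Or.inl ⟨by simpa [weight] using hk.symm, rfl⟩
    | cons a w =>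
      have ha : 1 < a.1 := hw a (by simp)
      have ha' : 1 < (a.1 : ℕ) := by exact_mod_cast ha
      refine Or.inr ⟨a, a, 0, w, ⟨rfl, ?_, ?_⟩, by rw [← hk, weight_cons], by simp⟩
      · rw [full, fullLetter, zero_smul]
        simp only
        rw [if_neg (by omega)]
      · intro u
        rw [zero_smul, sub_zero, ← weight_cons]
        exact single_mem_genGroup (adm_cons ha u)
  · refine Or.inr ⟨(1, 0), (1, β), 1, w, ⟨rfl, by simp [full, fullLetter], ?_⟩, ?_, by simp⟩
    · intro u
      refine AddSubgroup.subset_closure (Or.inr ⟨β, u, ?_, by simp⟩)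
      simp [add_comm]
    · rw [← hk]
      simp [add_comm]

theorem FiniteLetter.map_mem {a a' : Letter N} {c : ℤ} (h : FiniteLetter a a' c) {k : ℕ}
    {x : Formal N} (hx : x ∈ homog N k) :
    consL a x - c • consL a' x ∈ genGroup N (a.1 + k) := by
  refine map_homog_mem (consL a - c • consL a') ?_ hx
  rintro u rfl
  simp only [LinearMap.sub_apply, LinearMap.smul_apply, consL_single]
  exact h.mem u

theorem mergeL_mem (a b : Letter N) {k : ℕ} {x : Formal N} (hx : x ∈ homog N k) :
    mergeL a b x ∈ genGroup N (a.1 + b.1 + k) := by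
  refine map_homog_mem (mergeL a b) ?_ hx
  rintro u rfl
  rw [mergeL]
  split_ifs
  · rw [consL_single]
    have h := single_mem_genGroup (adm_cons (a := (a.1 + b.1, a.2)) (by
      have h1 := a.1.pos
      have h2 := b.1.pos
      rw [← PNat.coe_lt_coe, PNat.add_coe, PNat.one_coe]
      omega) u)
    rw [weight_cons] at h
    exact h
  · simp

/-- Expanding bilinearly, the recursion regroups so that each word starts with z_a - c z_{a'}, with
z_b - d z_{b'}, or with a merged letter, whose weight is at least two. -/
theorem FiniteLetter.stuffle_mem {a a' b b' : Letter N} {c d : ℤ} (ha : FiniteLetter a a' c)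
    (hb : FiniteLetter b b' d) (w v : Word N) :
    stuffleL N (Finsupp.single (a :: w) 1 - c • Finsupp.single (a' :: w) 1)
      (Finsupp.single (b :: v) 1 - d • Finsupp.single (b' :: v) 1) ∈
      genGroup N (a.1 + weight w + (b.1 + weight v)) := by
  have e : stuffleL N (Finsupp.single (a :: w) 1 - c • Finsupp.single (a' :: w) 1)
      (Finsupp.single (b :: v) 1 - d • Finsupp.single (b' :: v) 1) =
      ((consL a (stuffleWord w (b :: v) - d • stuffleWord w (b' :: v)) -
        c • consL a' (stuffleWord w (b :: v) - d • stuffleWord w (b' :: v))) +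
      (consL b (stuffleWord (a :: w) v - c • stuffleWord (a' :: w) v) -
        d • consL b' (stuffleWord (a :: w) v - c • stuffleWord (a' :: w) v))) +
      (mergeL a b (stuffleWord w v) - d • mergeL a b' (stuffleWord w v) -
        c • mergeL a' b (stuffleWord w v) + (c * d) • mergeL a' b' (stuffleWord w v)) := by
    simp only [map_sub, map_zsmul, LinearMap.sub_apply, LinearMap.smul_apply, stuffleL_single,
      stuffleWord_cons_cons]
    module
  have ha1 := ha.fst_eq
  have hb1 := hb.fst_eq
  have m1 := stuffleWord_mem_homog w (b :: v)
  have m2 := stuffleWord_mem_homog w (b' :: v)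
  have m3 := stuffleWord_mem_homog (a :: w) v
  have m4 := stuffleWord_mem_homog (a' :: w) v
  have m5 := stuffleWord_mem_homog w v
  simp only [weight_cons, ha1, hb1] at m1 m2 m3 m4
  rw [e]
  refine add_mem (add_mem ?_ ?_) ?_
  · have := ha.map_mem (sub_mem m1 (zsmul_mem m2 d))
    rwa [← add_assoc] at this
  · have := hb.map_mem (sub_mem m3 (zsmul_mem m4 c))
    convert this using 2
    omega
  · have q : ∀ a₁ b₁ : Letter N, a₁.1 = a.1 → b₁.1 = b.1 →
        mergeL a₁ b₁ (stuffleWord w v) ∈ genGroup N (a.1 + weight w + (b.1 + weight v)) := by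
      intro a₁ b₁ h1 h2
      have := mergeL_mem a₁ b₁ m5
      rw [h1, h2] at this
      convert this using 2
      omega
    exact add_mem (sub_mem (sub_mem (q a b rfl rfl) (zsmul_mem (q a b' rfl hb1) d))
      (zsmul_mem (q a' b ha1 rfl) c)) (zsmul_mem (q a' b' ha1 hb1) (c * d))

/-- The errors regroup in the same way, and every leading factor vanishes at infinity. This is the
point where the error is seen to lie in qMZ and not just in MD. -/
theorem FiniteLetter.err_mem [NeZero N] {a a' b b' : Letter N} {c d : ℤ}
    (ha : FiniteLetter a a' c) (hb : FiniteLetter b b' d) (w v : Word N) :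
    stuffleErr (a :: w) (b :: v) - d • stuffleErr (a :: w) (b' :: v) -
      c • stuffleErr (a' :: w) (b :: v) + (c * d) • stuffleErr (a' :: w) (b' :: v) ∈
      genSpan N (a.1 + weight w + (b.1 + weight v)) := by
  have e : stuffleErr (a :: w) (b :: v) - d • stuffleErr (a :: w) (b' :: v) -
      c • stuffleErr (a' :: w) (b :: v) + (c * d) • stuffleErr (a' :: w) (b' :: v) =
      sumOp N (full a - c • full a').1 (stuffleErr w (b :: v) - d • stuffleErr w (b' :: v)) +
      sumOp N (full b - d • full b').1 (stuffleErr (a :: w) v - c • stuffleErr (a' :: w) v) +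
      sumOp N ((full a * full b - merge a b) - d • (full a * full b' - merge a b') -
        c • (full a' * full b - merge a' b) + (c * d) • (full a' * full b' - merge a' b')).1
        (trunc w * trunc v) +
      (sumOp N (merge a b).1 (stuffleErr w v) - d • sumOp N (merge a b').1 (stuffleErr w v) -
        c • sumOp N (merge a' b).1 (stuffleErr w v) +
        (c * d) • sumOp N (merge a' b').1 (stuffleErr w v)) := by
    simp only [stuffleErr_cons_cons, Prod.fst_sub, Prod.fst_add, Prod.smul_fst, map_sub, map_add,
      map_zsmul, LinearMap.sub_apply, LinearMap.add_apply, LinearMap.smul_apply]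
    module
  have ha1 := ha.fst_eq
  have hb1 := hb.fst_eq
  have h1 := a.1.pos
  have h2 := b.1.pos
  have m1 := stuffleErr_mem w (b :: v)
  have m2 := stuffleErr_mem w (b' :: v)
  have m3 := stuffleErr_mem (a :: w) v
  have m4 := stuffleErr_mem (a' :: w) v
  have m5 := stuffleErr_mem w v
  have ma := full_mem a
  have ma' := full_mem a'
  have mb := full_mem b
  have mb' := full_mem b'
  simp only [weight_cons, ha1, hb1] at m1 m2 m3 m4 ma' mb'
  rw [e]
  refine add_mem (add_mem (add_mem ?_ ?_) ?_) ?_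
  · refine genSpan_mono (by omega) (sumOp_mem_genSpan (sub_mem ma (zsmul_mem ma' c)) ?_
      (sub_mem m1 (zsmul_mem m2 d)))
    rw [Prod.snd_sub, Prod.smul_snd, ha.snd_eq, sub_self]
  · refine genSpan_mono (by omega) (sumOp_mem_genSpan (sub_mem mb (zsmul_mem mb' d)) ?_
      (sub_mem m3 (zsmul_mem m4 c)))
    rw [Prod.snd_sub, Prod.smul_snd, hb.snd_eq, sub_self]
  · have q : ∀ a₁ b₁ : Letter N, a₁.1 = a.1 → b₁.1 = b.1 →
        full a₁ * full b₁ - merge a₁ b₁ ∈ letterSpan N (a.1 + b.1 - 1) := by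
      intro a₁ b₁ h1 h2
      have := full_mul_sub_merge_mem a₁ b₁
      rwa [h1, h2] at this
    refine genSpan_mono ?_ (sumOp_mem_genSpan
      (add_mem (sub_mem (sub_mem (q a b rfl rfl) (zsmul_mem (q a b' rfl hb1) d))
      (zsmul_mem (q a' b ha1 rfl) c)) (zsmul_mem (q a' b' ha1 hb1) (c * d))) ?_
      (trunc_mul_trunc_mem w v))
    · omega
    -- Up to merged letters, which vanish at infinity, the factor is the product of the two finite
    -- letters; the value at infinity is multiplicative, so it is 0.
    · simp only [Prod.snd_sub, Prod.snd_add, Prod.smul_snd, Prod.snd_mul, merge_snd, ha.snd_eq,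
        hb.snd_eq]
      simp only [zsmul_eq_mul]
      push_cast
      ring
  · have q : ∀ a₁ b₁ : Letter N, a₁.1 = a.1 → b₁.1 = b.1 →
        sumOp N (merge a₁ b₁).1 (stuffleErr w v) ∈
          genSpan N (a.1 + weight w + (b.1 + weight v)) := by
      intro a₁ b₁ h1 h2
      have := merge_mem a₁ b₁
      rw [h1, h2] at this
      exact genSpan_mono (by omega) (sumOp_mem_genSpan this (merge_snd _ _) m5)
    exact add_mem (sub_mem (sub_mem (q a b rfl rfl) (zsmul_mem (q a b' rfl hb1) d))
      (zsmul_mem (q a' b ha1 rfl) c)) (zsmul_mem (q a' b' ha1 hb1) (c * d))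

end Stuffle

/-! ### The filtered algebras of multiple divisor functions -/

section Spaces

variable {N : ℕ}

theorem below_mono {K A : Type*} [Field K] [CommRing A] [Algebra K A] {F : ℕ → Submodule K A}
    (hF : Monotone F) {i k : ℕ} (h : i < k) : F i ≤ below F k := by
  cases k with
  | zero => omega
  | succ k => exact hF (Nat.lt_succ_iff.1 h)

theorem below_le {K A : Type*} [Field K] [CommRing A] [Algebra K A] {F : ℕ → Submodule K A}
    (hF : Monotone F) (k : ℕ) : below F k ≤ F k := by
  cases k with
  | zero => exact bot_le
  | succ k => exact hF (Nat.le_succ k)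

theorem qMZFil_mono : Monotone (qMZFil N) := fun _ _ h =>
  Submodule.span_mono fun _ ⟨j, hj, hf⟩ => ⟨j, hj.trans h, hf⟩

theorem MDFil_mono : Monotone (MDFil N) := fun _ _ h =>
  Submodule.span_mono fun _ ⟨w, hw, hf⟩ => ⟨w, hw.trans h, hf⟩

theorem exists_formalGen {k : ℕ} {f : ℂ⟦X⟧} (hf : f ∈ qGen N k) :
    ∃ x ∈ formalGen N k, f = bracketL x := by
  rcases hf with ⟨w, hw, hk, rfl⟩ | ⟨β, w, -, hk, rfl⟩
  · exact ⟨_, Or.inl ⟨w, hw, hk, rfl⟩, (bracketL_single w).symm⟩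
  · refine ⟨_, Or.inr ⟨β, w, hk, rfl⟩, ?_⟩
    rw [map_sub, bracketL_single, bracketL_single, gser]

/-- Formal generators allow β = 0, for which the difference is zero, whereas the generators of qMZ
exclude it. -/
theorem bracketL_eq_zero_or_mem_qGen {k : ℕ} {x : Formal N} (hx : x ∈ formalGen N k) :
    bracketL x = 0 ∨ bracketL x ∈ qGen N k := by
  rcases hx with ⟨w, hw, hk, rfl⟩ | ⟨β, w, hk, rfl⟩
  · exact Or.inr (Or.inl ⟨w, hw, hk, bracketL_single w⟩)
  · by_cases hβ : β = 0
    · simp [hβ]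
    · refine Or.inr (Or.inr ⟨β, w, hβ, hk, ?_⟩)
      rw [map_sub, bracketL_single, bracketL_single, gser]

theorem bracketL_mem_qMZFil {k : ℕ} {x : Formal N} (hx : x ∈ formalGen N k) :
    bracketL x ∈ qMZFil N k := by
  rcases bracketL_eq_zero_or_mem_qGen hx with h | h
  · rw [h]
    exact zero_mem _
  · exact qGen_mem h

theorem bracketL_mem_of_genGroup {k : ℕ} {x : Formal N} (hx : x ∈ genGroup N k) :
    bracketL x ∈ qMZFil N k := by
  induction hx using AddSubgroup.closure_induction with
  | mem x hx => exact bracketL_mem_qMZFil hx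
  | zero => simp
  | add x y _ _ hx hy => rw [map_add]; exact add_mem hx hy
  | neg x _ hx => rw [map_neg]; exact neg_mem hx

theorem diag_mem_of_genSpan {k : ℕ} {G : ℕ → ℂ⟦X⟧} (hG : G ∈ genSpan N k) :
    diag N G ∈ below (qMZFil N) k := by
  suffices genSpan N k ≤ (below (qMZFil N) k).comap (diag N) from this hG
  refine Submodule.span_le.2 ?_
  rintro _ ⟨i, hi, x, hx, rfl⟩
  rw [SetLike.mem_coe, Submodule.mem_comap, diag_truncL]
  exact below_mono qMZFil_mono hi (bracketL_mem_qMZFil hx)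

theorem diag_mem_of_truncSpan {k : ℕ} {G : ℕ → ℂ⟦X⟧} (hG : G ∈ truncSpan N k) :
    diag N G ∈ below (MDFil N) k := by
  suffices truncSpan N k ≤ (below (MDFil N) k).comap (diag N) from this hG
  refine Submodule.span_le.2 ?_
  rintro _ ⟨w, hw, rfl⟩
  rw [SetLike.mem_coe, Submodule.mem_comap, diag_trunc]
  exact below_mono MDFil_mono hw (bracket_mem_MDFil w)

theorem diag_stuffleErr (w v : Word N) :
    diag N (stuffleErr w v) = bracket w * bracket v - bracketL (stuffleWord w v) := by
  rw [stuffleErr, map_sub, diag_trunc_mul, diag_truncL]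

theorem bracket_mul_sub_mem [NeZero N] (w v : Word N) :
    bracket w * bracket v - bracketL (stuffleWord w v) ∈
      below (MDFil N) (weight w + weight v) := by
  rw [← diag_stuffleErr]
  exact diag_mem_of_truncSpan (stuffleErr_mem w v)

theorem bracket_nil : bracket ([] : Word N) = 1 := by
  rw [← diag_trunc]
  ext n
  simp [diag, trunc]

theorem stuffleL_nil_left (x : Formal N) : stuffleL N (Finsupp.single [] 1) x = x := by
  induction x using Finsupp.induction_linear with
  | zero => simp
  | add x y hx hy => simp only [map_add, hx, hy]
  | single w c => simp [stuffleL, stuffleWord_nil_left]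

theorem stuffleL_nil_right (x : Formal N) : stuffleL N x (Finsupp.single [] 1) = x := by
  induction x using Finsupp.induction_linear with
  | zero => simp
  | add x y hx hy => simp only [map_add, LinearMap.add_apply, hx, hy]
  | single w c => simp [stuffleL, stuffleWord_nil_right]

theorem stuffleMul_mem_genGroup {j k : ℕ} {x y : Formal N} (hx : x ∈ formalGen N j)
    (hy : y ∈ formalGen N k) : stuffleMul x y ∈ genGroup N (j + k) := by
  rw [stuffleMul_eq]
  rcases formalGen_cases hx with ⟨rfl, rfl⟩ | ⟨a, a', c, w, ha, rfl, rfl⟩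
  · rw [stuffleL_nil_left, zero_add]
    exact AddSubgroup.subset_closure hy
  · rcases formalGen_cases hy with ⟨rfl, rfl⟩ | ⟨b, b', d, v, hb, rfl, rfl⟩
    · rw [stuffleL_nil_right]
      exact AddSubgroup.subset_closure hx
    · exact ha.stuffle_mem hb w v

/-- The stuffle relation modulo lower weight inside qMZ. It gives the closure of qMZ under products,
the stuffle relations of the graded algebra and the rational form. -/
theorem bracketL_mul_sub_mem [NeZero N] {j k : ℕ} {x y : Formal N} (hx : x ∈ formalGen N j)
    (hy : y ∈ formalGen N k) :
    bracketL x * bracketL y - bracketL (stuffleMul x y) ∈ below (qMZFil N) (j + k) := by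
  rw [stuffleMul_eq]
  rcases formalGen_cases hx with ⟨rfl, rfl⟩ | ⟨a, a', c, w, ha, rfl, rfl⟩
  · rw [stuffleL_nil_left, bracketL_single, bracket_nil, one_mul, sub_self]
    exact zero_mem _
  · rcases formalGen_cases hy with ⟨rfl, rfl⟩ | ⟨b, b', d, v, hb, rfl, rfl⟩
    · rw [stuffleL_nil_right, bracketL_single, bracket_nil, mul_one, sub_self]
      exact zero_mem _
    · have h := diag_mem_of_genSpan (ha.err_mem hb w v)
      convert h using 1
      simp only [map_sub, map_add, map_zsmul, diag_stuffleErr, LinearMap.sub_apply,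
        LinearMap.smul_apply, stuffleL_single, bracketL_single]
      simp only [zsmul_eq_mul]
      push_cast
      ring

theorem isFilteredAlg_of_span {K A : Type*} [Field K] [CommRing A] [Algebra K A] {V : Submodule K A}
    {F : ℕ → Submodule K A} {s : ℕ → Set A} (hF : ∀ k, F k = Submodule.span K {f | ∃ j ≤ k, f ∈ s j})
    (hV : V = Submodule.span K {f | ∃ j, f ∈ s j}) (h1 : (1 : A) ∈ F 0)
    (hmul : ∀ i j, ∀ f ∈ s i, ∀ g ∈ s j, f * g ∈ F (i + j)) : IsFilteredAlg V F := by
  have hmono : Monotone F := by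
    intro i j h
    rw [hF, hF]
    exact Submodule.span_mono fun f ⟨k, hk, hf⟩ => ⟨k, hk.trans h, hf⟩
  refine ⟨h1, hmono, ?_, ?_⟩
  · intro i j f g hf hg
    rw [hF] at hf hg
    refine bilin_mem_of_mem_span (LinearMap.mul K A) ?_ hf hg
    rintro f ⟨i', hi, hf⟩ g ⟨j', hj, hg⟩
    exact hmono (add_le_add hi hj) (hmul i' j' f hf g hg)
  · rw [hV]
    refine le_antisymm (iSup_le fun k => ?_) (Submodule.span_le.2 ?_)
    · rw [hF]
      exact Submodule.span_mono fun f ⟨j, _, hf⟩ => ⟨j, hf⟩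
    · rintro f ⟨j, hf⟩
      refine Submodule.mem_iSup_of_mem j ?_
      rw [hF]
      exact Submodule.subset_span ⟨j, le_rfl, hf⟩

theorem isFilteredAlg_qMZ [NeZero N] : IsFilteredAlg (qMZ N) (qMZFil N) := by
  refine isFilteredAlg_of_span (s := qGen N) (fun _ => rfl) rfl ?_ ?_
  · have := bracketL_mem_qMZFil (N := N) (k := 0) (Or.inl ⟨[], by simp [Adm], rfl, rfl⟩)
    rwa [bracketL_single, bracket_nil] at this
  · intro i j f hf g hg
    obtain ⟨x, hx, rfl⟩ := exists_formalGen hf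
    obtain ⟨y, hy, rfl⟩ := exists_formalGen hg
    have := add_mem (below_le qMZFil_mono _ (bracketL_mul_sub_mem hx hy))
      (bracketL_mem_of_genGroup (stuffleMul_mem_genGroup hx hy))
    simpa using this

theorem isFilteredAlg_MD [NeZero N] : IsFilteredAlg (MD N) (MDFil N) := by
  refine isFilteredAlg_of_span (s := fun k => {f | ∃ w : Word N, weight w = k ∧ f = bracket w})
    ?_ ?_ ?_ ?_
  · intro k
    refine congrArg _ (Set.ext fun f => ⟨?_, ?_⟩)
    · rintro ⟨w, hw, rfl⟩
      exact ⟨_, hw, w, rfl, rfl⟩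
    · rintro ⟨_, hj, w, rfl, rfl⟩
      exact ⟨w, hj, rfl⟩
  · refine congrArg _ (Set.ext fun f => ⟨?_, ?_⟩)
    · rintro ⟨w, rfl⟩
      exact ⟨_, w, rfl, rfl⟩
    · rintro ⟨_, w, rfl, rfl⟩
      exact ⟨w, rfl⟩
  · have := bracket_mem_MDFil ([] : Word N)
    rwa [bracket_nil] at this
  · rintro _ _ _ ⟨w, rfl, rfl⟩ _ ⟨v, rfl, rfl⟩
    have h2 : bracketL (stuffleWord w v) ∈ MDFil N (weight w + weight v) := by
      rw [stuffleWord, map_list_sum, List.map_map]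
      refine list_sum_mem ?_
      intro f hf
      obtain ⟨u, hu, rfl⟩ := List.mem_map.1 hf
      rw [Function.comp_apply, bracketL_single]
      exact Submodule.subset_span ⟨u, (weight_of_mem_stuffle hu).le, rfl⟩
    have := add_mem (below_le MDFil_mono _ (bracket_mul_sub_mem w v)) h2
    simpa using this

end Spaces

/-! ### Evaluation of power series on the unit disc -/

section Evaluation

/-- Absolute convergence on the open unit disc. -/
def Conv (f : ℂ⟦X⟧) : Prop :=
  ∀ r : ℝ, 0 ≤ r → r < 1 → Summable fun n => ‖PowerSeries.coeff n f‖ * r ^ n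

/-- The value at `z`. -/
def ev (z : ℂ) (f : ℂ⟦X⟧) : ℂ := ∑' n, PowerSeries.coeff n f * z ^ n

variable {f g : ℂ⟦X⟧} {z : ℂ}

theorem Conv.summable_norm (hf : Conv f) (hz : ‖z‖ < 1) :
    Summable fun n => ‖PowerSeries.coeff n f * z ^ n‖ := by
  simpa [norm_mul, norm_pow] using hf ‖z‖ (norm_nonneg z) hz

theorem Conv.summable (hf : Conv f) (hz : ‖z‖ < 1) :
    Summable fun n => PowerSeries.coeff n f * z ^ n := (hf.summable_norm hz).of_norm

theorem Conv.add (hf : Conv f) (hg : Conv g) : Conv (f + g) := by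
  intro r h0 h1
  refine Summable.of_nonneg_of_le (fun n => by positivity) (fun n => ?_)
    ((hf r h0 h1).add (hg r h0 h1))
  rw [map_add, ← add_mul]
  exact mul_le_mul_of_nonneg_right (norm_add_le _ _) (by positivity)

theorem Conv.smul (c : ℂ) (hf : Conv f) : Conv (c • f) := by
  intro r h0 h1
  simpa [norm_mul, mul_assoc] using (hf r h0 h1).mul_left ‖c‖

theorem conv_zero : Conv 0 := by
  intro r h0 h1
  simp

theorem conv_one : Conv 1 := by
  intro r h0 h1
  refine summable_of_ne_finset_zero (s := {0}) fun n hn => ?_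
  have : n ≠ 0 := by simpa using hn
  simp [PowerSeries.coeff_one, this]

theorem ev_add (hf : Conv f) (hg : Conv g) (hz : ‖z‖ < 1) : ev z (f + g) = ev z f + ev z g := by
  rw [ev, ev, ev, ← (hf.summable hz).tsum_add (hg.summable hz)]
  simp [add_mul]

theorem ev_smul (c : ℂ) : ev z (c • f) = c * ev z f := by
  rw [ev, ev, ← tsum_mul_left]
  simp [mul_assoc]

theorem ev_zero : ev z 0 = 0 := by simp [ev]

theorem ev_one : ev z 1 = 1 := by
  rw [ev, tsum_eq_single 0]
  · simp
  · intro n hn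
    simp [PowerSeries.coeff_one, hn]

theorem coeff_mul_mul_pow (f g : ℂ⟦X⟧) (z : ℂ) (n : ℕ) :
    PowerSeries.coeff n (f * g) * z ^ n =
      ∑ p ∈ Finset.HasAntidiagonal.antidiagonal n,
        (PowerSeries.coeff p.1 f * z ^ p.1) * (PowerSeries.coeff p.2 g * z ^ p.2) := by
  rw [PowerSeries.coeff_mul, Finset.sum_mul]
  refine Finset.sum_congr rfl fun p hp => ?_
  rw [← Finset.HasAntidiagonal.mem_antidiagonal.1 hp, pow_add]
  ring

theorem Conv.mul (hf : Conv f) (hg : Conv g) : Conv (f * g) := by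
  intro r h0 h1
  have hz : ‖(r : ℂ)‖ < 1 := by simpa [abs_of_nonneg h0] using h1
  have := summable_norm_sum_mul_antidiagonal_of_summable_norm (hf.summable_norm hz)
    (hg.summable_norm hz)
  simp only [← coeff_mul_mul_pow] at this
  simpa [norm_mul, norm_pow, abs_of_nonneg h0] using this

theorem ev_mul (hf : Conv f) (hg : Conv g) (hz : ‖z‖ < 1) : ev z (f * g) = ev z f * ev z g := by
  rw [ev, ev, ev, tsum_mul_tsum_eq_tsum_sum_antidiagonal_of_summable_norm (hf.summable_norm hz)
    (hg.summable_norm hz)]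
  exact tsum_congr (coeff_mul_mul_pow f g z)

theorem Conv.sum {ι : Type*} (s : Finset ι) {F : ι → ℂ⟦X⟧} (h : ∀ i ∈ s, Conv (F i)) :
    Conv (∑ i ∈ s, F i) := by
  induction s using Finset.cons_induction with
  | empty => simpa using conv_zero
  | cons a s ha ih =>
    rw [Finset.sum_cons]
    exact (h a (by simp)).add (ih fun i hi => h i (by simp [hi]))

theorem ev_sum {ι : Type*} (s : Finset ι) {F : ι → ℂ⟦X⟧} (h : ∀ i ∈ s, Conv (F i))
    (hz : ‖z‖ < 1) : ev z (∑ i ∈ s, F i) = ∑ i ∈ s, ev z (F i) := by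
  induction s using Finset.cons_induction with
  | empty => simp [ev_zero]
  | cons a s ha ih =>
    have h2 : ∀ i ∈ s, Conv (F i) := fun i hi => h i (by simp [hi])
    rw [Finset.sum_cons, Finset.sum_cons, ev_add (h a (by simp)) (Conv.sum s h2) hz, ih h2]

theorem Conv.sub (hf : Conv f) (hg : Conv g) : Conv (f - g) := by
  have := hf.add (hg.smul (-1))
  simpa [sub_eq_add_neg] using this

theorem ev_sub (hf : Conv f) (hg : Conv g) (hz : ‖z‖ < 1) : ev z (f - g) = ev z f - ev z g := by
  have h : f - g = f + (-1 : ℂ) • g := by simp [sub_eq_add_neg]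
  rw [h, ev_add hf (hg.smul _) hz, ev_smul]
  ring

theorem Conv.pow (hf : Conv f) (n : ℕ) : Conv (f ^ n) := by
  induction n with
  | zero => simpa using conv_one
  | succ n ih => rw [pow_succ]; exact ih.mul hf

theorem ev_pow (hf : Conv f) (hz : ‖z‖ < 1) (n : ℕ) : ev z (f ^ n) = ev z f ^ n := by
  induction n with
  | zero => simp [ev_one]
  | succ n ih => rw [pow_succ, ev_mul (hf.pow n) hf hz, ih, pow_succ]

theorem mul_left_injective' {u : ℕ} (hu : u ≠ 0) : Function.Injective fun n : ℕ => u * n :=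
  fun _ _ h => Nat.eq_of_mul_eq_mul_left (Nat.pos_of_ne_zero hu) h

theorem coeff_dil_of_notMem_range {u : ℕ} (hu : u ≠ 0) (f : ℂ⟦X⟧) {n : ℕ}
    (hn : n ∉ Set.range fun n : ℕ => u * n) : PowerSeries.coeff n (dil u f) = 0 := by
  rw [dil_of_ne hu]
  exact PowerSeries.coeff_expand_of_not_dvd u hu f fun ⟨m, hm⟩ => hn ⟨m, hm.symm⟩

theorem Conv.dil (hf : Conv f) (u : ℕ) : Conv (dil u f) := by
  by_cases hu : u = 0
  · rw [hu, dil_zero]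
    exact conv_zero
  intro r h0 h1
  rw [← (mul_left_injective' hu).summable_iff]
  · have := hf (r ^ u) (by positivity) (pow_lt_one₀ h0 h1 hu)
    refine this.congr fun n => ?_
    simp only [Function.comp_apply]
    rw [dil_of_ne hu, PowerSeries.coeff_expand_mul, pow_mul]
  · intro n hn
    rw [coeff_dil_of_notMem_range hu f hn, norm_zero, zero_mul]

theorem ev_dil {u : ℕ} (hu : u ≠ 0) (f : ℂ⟦X⟧) : ev z (LevelMZV.dil u f) = ev (z ^ u) f := by
  rw [ev, ev, ← (mul_left_injective' hu).tsum_eq]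
  · refine tsum_congr fun n => ?_
    rw [dil_of_ne hu, PowerSeries.coeff_expand_mul, pow_mul]
  · intro n hn
    by_contra h
    exact hn (by simp only [coeff_dil_of_notMem_range hu f h, zero_mul])

theorem summable_add_one_pow_mul_geometric (K : ℕ) {r : ℝ} (h0 : 0 ≤ r) (h1 : r < 1) :
    Summable fun n : ℕ => ((n : ℝ) + 1) ^ K * r ^ n := by
  have hr : ‖r‖ < 1 := by rwa [Real.norm_of_nonneg h0]
  have h2 := ((summable_pow_mul_geometric_of_norm_lt_one K hr).add
    (summable_geometric_of_lt_one h0 h1)).mul_left (2 ^ K)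
  refine Summable.of_nonneg_of_le (fun n => by positivity) (fun n => ?_) h2
  rw [← add_one_mul, ← mul_assoc]
  refine mul_le_mul_of_nonneg_right ?_ (by positivity)
  rcases Nat.eq_zero_or_pos n with rfl | hn
  · have h3 : (1 : ℝ) ≤ 2 ^ K := one_le_pow₀ (by norm_num)
    have h4 : (0 : ℝ) ≤ 0 ^ K := by positivity
    simp only [Nat.cast_zero, zero_add, one_pow]
    nlinarith
  · have h3 : (1 : ℝ) ≤ n := by exact_mod_cast hn
    calc ((n : ℝ) + 1) ^ K ≤ (2 * n) ^ K := pow_le_pow_left₀ (by positivity) (by linarith) K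
      _ = 2 ^ K * n ^ K := mul_pow _ _ _
      _ ≤ 2 ^ K * (n ^ K + 1) := by gcongr; linarith

theorem conv_of_norm_coeff_le {K : ℕ} (h : ∀ n, ‖PowerSeries.coeff n f‖ ≤ ((n : ℝ) + 1) ^ K) :
    Conv f := fun _ h0 h1 =>
  Summable.of_nonneg_of_le (fun n => by positivity)
    (fun n => mul_le_mul_of_nonneg_right (h n) (by positivity))
    (summable_add_one_pow_mul_geometric K h0 h1)

/-! ### Polynomial growth of coefficients and convergence of the truncated sums. -/

variable {N : ℕ}

theorem norm_eta : ‖eta N‖ = 1 := by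
  rw [eta, show 2 * (Real.pi : ℂ) * Complex.I / N = ((2 * Real.pi / N : ℝ) : ℂ) * Complex.I by
    push_cast; ring]
  exact Complex.norm_exp_ofReal_mul_I _

theorem norm_coeff_letterSeries_le (n : ℕ) (a : ZMod N) (m : ℕ) :
    ‖PowerSeries.coeff m (letterSeries n a)‖ ≤ (m : ℝ) ^ n := by
  rw [letterSeries, PowerSeries.coeff_mk]
  split_ifs with h
  · rw [norm_zero]
    positivity
  · rw [norm_mul, norm_mul, norm_pow, norm_eta, one_pow, one_mul, norm_pow, Complex.norm_natCast,
      norm_div, norm_one, Complex.norm_natCast]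
    have h1 : (1 : ℝ) ≤ n.factorial := by exact_mod_cast n.factorial_pos
    have h2 : 1 / (n.factorial : ℝ) ≤ 1 := by
      rw [div_le_one (by linarith)]
      exact h1
    exact mul_le_of_le_one_right (by positivity) h2

theorem conv_letterSeries (n : ℕ) (a : ZMod N) : Conv (letterSeries n a) :=
  conv_of_norm_coeff_le (K := n) fun m => (norm_coeff_letterSeries_le n a m).trans
    (pow_le_pow_left₀ (by positivity) (by linarith) n)

/-- A letter of weight s contributes at most n + 1 values of u, at most n values of v and a factor
v^(s-1), hence at most s + 1 ≤ 2s powers of n + 1. Uniformity in the bound M is what dominated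
convergence needs. -/
theorem norm_coeff_trunc_le (w : Word N) (M n : ℕ) :
    ‖PowerSeries.coeff n (trunc w M)‖ ≤ ((n : ℝ) + 1) ^ (2 * weight w) := by
  induction w generalizing M n with
  | nil =>
    simp only [trunc, Pi.one_apply, PowerSeries.coeff_one]
    split_ifs <;> simp [weight]
  | cons a w ih =>
    -- Beyond n + 1 the coefficient no longer depends on M.
    wlog hM : M ≤ n + 1 generalizing M with H
    · rw [coeff_trunc_of_lt _ (by omega : n < M), ← coeff_trunc_of_lt _ (Nat.lt_succ_self n)]
      exact H (n + 1) le_rfl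
    have hn : (1 : ℝ) ≤ (n : ℝ) + 1 := by linarith [(Nat.cast_nonneg n : (0 : ℝ) ≤ n)]
    have key : ∀ u ∈ Finset.range M, ‖PowerSeries.coeff n (dil u (letter a) * trunc w u)‖ ≤
        ((n : ℝ) + 1) ^ ((a.1 : ℕ) + 2 * weight w) := by
      intro u _
      by_cases hu : u = 0
      · rw [hu, dil_zero]
        simp only [LinearMap.zero_apply, zero_mul, map_zero, norm_zero]
        positivity
      rw [coeff_dil_mul hu (coeff_zero_letter a)]
      refine (norm_sum_le _ _).trans ?_
      have h1 : ∀ v ∈ (Finset.Icc 1 n).filter (fun v => u * v ≤ n),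
          ‖PowerSeries.coeff v (letter a) * PowerSeries.coeff (n - u * v) (trunc w u)‖ ≤
            ((n : ℝ) + 1) ^ ((a.1 : ℕ) - 1 + 2 * weight w) := by
        intro v hv
        have hv' := (Finset.mem_Icc.1 (Finset.mem_filter.1 hv).1).2
        have hvn : (v : ℝ) ≤ n := by exact_mod_cast hv'
        rw [norm_mul, pow_add]
        refine mul_le_mul ?_ ?_ (norm_nonneg _) (by positivity)
        · exact (norm_coeff_letterSeries_le _ _ v).trans
            (pow_le_pow_left₀ (by positivity) (by linarith) _)
        · refine (ih u (n - u * v)).trans (pow_le_pow_left₀ (by positivity) ?_ _)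
          have : ((n - u * v : ℕ) : ℝ) ≤ n := by exact_mod_cast Nat.sub_le _ _
          linarith
      refine (Finset.sum_le_card_nsmul _ _ _ h1).trans ?_
      have hc : (((Finset.Icc 1 n).filter (fun v => u * v ≤ n)).card : ℝ) ≤ (n : ℝ) + 1 := by
        have := Finset.card_filter_le (Finset.Icc 1 n) (fun v => u * v ≤ n)
        rw [Nat.card_Icc, Nat.add_sub_cancel] at this
        have h2 : (((Finset.Icc 1 n).filter (fun v => u * v ≤ n)).card : ℝ) ≤ n := by
          exact_mod_cast this
        linarith
      rw [nsmul_eq_mul]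
      have e : (a.1 : ℕ) + 2 * weight w = ((a.1 : ℕ) - 1 + 2 * weight w) + 1 := by
        have := a.1.pos
        omega
      rw [e, pow_succ, mul_comm]
      exact mul_le_mul_of_nonneg_left hc (by positivity)
    rw [trunc_cons, sumOp_apply, map_sum]
    refine (norm_sum_le _ _).trans ((Finset.sum_le_card_nsmul _ _ _ key).trans ?_)
    rw [Finset.card_range, nsmul_eq_mul]
    have hM' : (M : ℝ) ≤ (n : ℝ) + 1 := by exact_mod_cast hM
    calc (M : ℝ) * ((n : ℝ) + 1) ^ ((a.1 : ℕ) + 2 * weight w)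
        ≤ ((n : ℝ) + 1) * ((n : ℝ) + 1) ^ ((a.1 : ℕ) + 2 * weight w) := by gcongr
      _ = ((n : ℝ) + 1) ^ ((a.1 : ℕ) + 2 * weight w + 1) := by rw [pow_succ]; ring
      _ ≤ _ := by
        refine pow_le_pow_right₀ hn ?_
        have := a.1.pos
        rw [weight_cons]
        omega

theorem conv_trunc (w : Word N) (M : ℕ) : Conv (trunc w M) :=
  conv_of_norm_coeff_le (norm_coeff_trunc_le w M)

theorem norm_coeff_bracket_le (w : Word N) (n : ℕ) :
    ‖PowerSeries.coeff n (bracket w)‖ ≤ ((n : ℝ) + 1) ^ (2 * weight w) := by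
  rw [← coeff_trunc_of_lt w (Nat.lt_succ_self n)]
  exact norm_coeff_trunc_le w _ n

theorem conv_bracket (w : Word N) : Conv (bracket w) :=
  conv_of_norm_coeff_le (norm_coeff_bracket_le w)

theorem tendsto_ev_trunc (w : Word N) (hz : ‖z‖ < 1) :
    Filter.Tendsto (fun M => ev z (trunc w M)) Filter.atTop (𝓝 (ev z (bracket w))) := by
  refine tendsto_tsum_of_dominated_convergence
    (bound := fun n : ℕ => ((n : ℝ) + 1) ^ (2 * weight w) * ‖z‖ ^ n)
    (summable_add_one_pow_mul_geometric _ (norm_nonneg z) hz) ?_ ?_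
  · intro n
    refine tendsto_const_nhds.congr' ?_
    filter_upwards [Filter.eventually_gt_atTop n] with M hM
    rw [coeff_trunc_of_lt w hM]
  · refine Filter.Eventually.of_forall fun M n => ?_
    rw [norm_mul, norm_pow]
    exact mul_le_mul_of_nonneg_right (norm_coeff_trunc_le w M n) (by positivity)

theorem ev_trunc_cons (a : Letter N) (w : Word N) (M : ℕ) (hz : ‖z‖ < 1) :
    ev z (trunc (a :: w) M) =
      ∑ u ∈ Finset.range M, (if u = 0 then 0 else ev (z ^ u) (letter a)) * ev z (trunc w u) := by
  have hc : Conv (letter a) := conv_letterSeries _ _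
  rw [trunc_cons, sumOp_apply, ev_sum _ (fun u _ => (hc.dil u).mul (conv_trunc w u)) hz]
  refine Finset.sum_congr rfl fun u _ => ?_
  rw [ev_mul (hc.dil u) (conv_trunc w u) hz]
  split_ifs with hu
  · rw [hu, dil_zero, LinearMap.zero_apply, ev_zero]
  · rw [ev_dil hu]

theorem ev_letterSeries_zero (a : ZMod N) (hz : ‖z‖ < 1) :
    ev z (letterSeries 0 a) = eta N ^ a.val * z / (1 - eta N ^ a.val * z) := by
  have hx : ‖eta N ^ a.val * z‖ < 1 := by simpa [norm_mul, norm_eta] using hz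
  have h1 : (1 : ℂ) - eta N ^ a.val * z ≠ 0 := by
    intro h
    rw [← sub_eq_zero.1 h, norm_one] at hx
    exact lt_irrefl _ hx
  have h2 : Summable fun n : ℕ => PowerSeries.coeff n (letterSeries 0 a) * z ^ n :=
    (conv_letterSeries 0 a).summable hz
  rw [ev, h2.tsum_eq_zero_add, eq_div_iff h1]
  have h3 : ∀ n : ℕ, PowerSeries.coeff (n + 1) (letterSeries 0 a) * z ^ (n + 1) =
      eta N ^ a.val * z * (eta N ^ a.val * z) ^ n := by
    intro n
    rw [letterSeries, PowerSeries.coeff_mk, if_neg (Nat.succ_ne_zero n), pow_mul]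
    simp
    ring
  simp only [h3]
  rw [tsum_mul_left, tsum_geometric_of_norm_lt_one hx, coeff_zero_letterSeries]
  field_simp
  ring

end Evaluation

/-! ### Uniform estimates near the root of unity -/

section Estimates

variable {N : ℕ}

/-- With t = u(1-r) one has r^u ≤ e^(-t) ≤ 1/(1+t), hence (1-r)/(1-r^u) ≤ (1+t)/u, and the powers of
1+t are absorbed by e^(-t). The extra decay 1/(1 + u(1-r)) is needed only to bound the scaled value
of t_N. -/
theorem scaled_geometric_le (s : ℕ) : ∃ C : ℝ, 0 ≤ C ∧ ∀ r : ℝ, 0 < r → r < 1 → ∀ u : ℕ, 0 < u →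
    (1 - r) ^ s * (r ^ u / (1 - r ^ u) ^ s) ≤ C / (u ^ s * (1 + u * (1 - r))) := by
  refine ⟨(s + 1).factorial * Real.exp 1, by positivity, ?_⟩
  intro r h0 h1 u hu
  have hu' : (0 : ℝ) < u := by exact_mod_cast hu
  have hr : 0 < 1 - r := by linarith
  set t : ℝ := u * (1 - r) with ht
  have ht0 : 0 < t := by positivity
  have hru : r ^ u < 1 := pow_lt_one₀ h0.le h1 hu.ne'
  have e1 : r ^ u ≤ Real.exp (-t) := by
    have h2 : r ≤ Real.exp (-(1 - r)) := by
      have := Real.add_one_le_exp (-(1 - r))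
      linarith
    calc r ^ u ≤ Real.exp (-(1 - r)) ^ u := pow_le_pow_left₀ h0.le h2 u
      _ = Real.exp (-t) := by
        rw [← Real.exp_nat_mul]
        congr 1
        rw [ht]
        ring
  have e2 : Real.exp (-t) ≤ 1 / (1 + t) := by
    rw [Real.exp_neg, ← one_div]
    exact one_div_le_one_div_of_le (by linarith) (by linarith [Real.add_one_le_exp t])
  have e3 : (1 - r) / (1 - r ^ u) ≤ (1 + t) / u := by
    have h3 : t / (1 + t) ≤ 1 - r ^ u := by
      have h4 : t / (1 + t) = 1 - 1 / (1 + t) := by field_simp; ring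
      rw [h4]
      linarith
    rw [div_le_div_iff₀ (by linarith) hu']
    rw [div_le_iff₀ (by linarith)] at h3
    calc (1 - r) * u = t := by rw [ht]; ring
      _ ≤ (1 - r ^ u) * (1 + t) := h3
      _ = _ := by ring
  -- One power more than s is used here, so that a factor 1/(1+t) is left over.
  have e4 : (1 + t) ^ (s + 1) ≤ (s + 1).factorial * Real.exp (1 + t) := by
    have := Real.pow_div_factorial_le_exp (1 + t) (by linarith) (s + 1)
    rw [div_le_iff₀ (by positivity)] at this
    linarith
  calc (1 - r) ^ s * (r ^ u / (1 - r ^ u) ^ s)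
      = ((1 - r) / (1 - r ^ u)) ^ s * r ^ u := by rw [div_pow]; ring
    _ ≤ ((1 + t) / u) ^ s * Real.exp (-t) := by
        refine mul_le_mul (pow_le_pow_left₀ ?_ e3 s) e1 (by positivity) (by positivity)
        exact div_nonneg hr.le (by linarith)
    _ = (1 + t) ^ (s + 1) * Real.exp (-t) / (u ^ s * (1 + t)) := by
        rw [div_pow, pow_succ]
        field_simp
    _ ≤ (s + 1).factorial * Real.exp 1 / (u ^ s * (1 + t)) := by
        refine div_le_div_of_nonneg_right ?_ (by positivity)
        calc (1 + t) ^ (s + 1) * Real.exp (-t)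
            ≤ (s + 1).factorial * Real.exp (1 + t) * Real.exp (-t) := by gcongr
          _ = (s + 1).factorial * Real.exp 1 := by
            rw [mul_assoc, ← Real.exp_add]
            ring_nf

/-- The point `r η⁻¹`. -/
def zpt (N : ℕ) (r : ℝ) : ℂ := (eta N)⁻¹ * r

theorem norm_zpt {r : ℝ} (h0 : 0 < r) : ‖zpt N r‖ = r := by
  rw [zpt, norm_mul, norm_inv, norm_eta, inv_one, one_mul, Complex.norm_real,
    Real.norm_of_nonneg h0.le]

theorem norm_zpt_lt {r : ℝ} (h0 : 0 < r) (h1 : r < 1) : ‖zpt N r‖ < 1 := by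
  rwa [norm_zpt h0]

theorem norm_zpt_pow_lt {r : ℝ} (h0 : 0 < r) (h1 : r < 1) {u : ℕ} (hu : 0 < u) :
    ‖zpt N r ^ u‖ < 1 := by
  rw [norm_pow, norm_zpt h0]
  exact pow_lt_one₀ h0.le h1 hu.ne'

/-- The root of unity `η ^ (b - u)`. -/
def phase (b : ZMod N) (u : ℕ) : ℂ := eta N ^ b.val * (eta N)⁻¹ ^ u

theorem norm_phase (b : ZMod N) (u : ℕ) : ‖phase b u‖ = 1 := by
  simp [phase, norm_eta]

theorem eta_ne_zero : eta N ≠ 0 := by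
  intro h
  have := norm_eta (N := N)
  rw [h, norm_zero] at this
  exact zero_ne_one this

theorem phase_eq_one [NeZero N] {b : ZMod N} {u : ℕ} (h : (u : ZMod N) = b) : phase b u = 1 := by
  rw [phase, ← h, eta_pow_val, inv_pow, mul_inv_cancel₀ (pow_ne_zero _ eta_ne_zero)]

/-- Shifting the index and the residue together does not change the root of unity. This makes the
two halves of g_β comparable after a shift. -/
theorem phase_add (b : ZMod N) [NeZero N] (u g : ℕ) : phase (b + (g : ZMod N)) (u + g) = phase b u := by
  have h : eta N ^ (b + (g : ZMod N)).val = eta N ^ b.val * eta N ^ g := by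
    have h2 : (b + (g : ZMod N)) = ((b.val + g : ℕ) : ZMod N) := by simp
    rw [h2, eta_pow_val, pow_add]
  have hg : eta N ^ g * (eta N)⁻¹ ^ g = 1 := by
    rw [inv_pow, mul_inv_cancel₀ (pow_ne_zero _ eta_ne_zero)]
  rw [phase, phase, h, pow_add]
  linear_combination eta N ^ b.val * (eta N)⁻¹ ^ u * hg

/-- Only finitely many pairs of N-th roots of unity occur; the sum of all inverse distances serves
as a uniform constant, the pairs of equal roots contributing 0⁻¹ = 0. -/
theorem exists_phase_bound (N : ℕ) [NeZero N] : ∃ C : ℝ, 0 ≤ C ∧ ∀ (b : ZMod N) (u : ℕ),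
    (u : ZMod N) ≠ b → 1 ≤ C * ‖1 - phase b u‖ := by
  refine ⟨∑ p : ZMod N × ZMod N, ‖eta N ^ p.1.val - eta N ^ p.2.val‖⁻¹,
    Finset.sum_nonneg fun _ _ => by positivity, fun b u hu => ?_⟩
  have h1 : ‖1 - phase b u‖ = ‖eta N ^ ((u : ZMod N)).val - eta N ^ b.val‖ := by
    have h2 : 1 - phase b u = (eta N ^ ((u : ZMod N)).val - eta N ^ b.val) * (eta N)⁻¹ ^ u := by
      rw [eta_pow_val, phase, sub_mul, inv_pow, mul_inv_cancel₀ (pow_ne_zero _ eta_ne_zero)]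
    rw [h2, norm_mul, norm_pow, norm_inv, norm_eta, inv_one, one_pow, mul_one]
  have hpos : 0 < ‖eta N ^ ((u : ZMod N)).val - eta N ^ b.val‖ := by
    rw [norm_pos_iff, sub_ne_zero]
    exact fun h => hu (eta_pow_val_injective h)
  have h3 : ‖eta N ^ ((u : ZMod N)).val - eta N ^ b.val‖⁻¹ ≤
      ∑ p : ZMod N × ZMod N, ‖eta N ^ p.1.val - eta N ^ p.2.val‖⁻¹ :=
    Finset.single_le_sum (f := fun p : ZMod N × ZMod N => ‖eta N ^ p.1.val - eta N ^ p.2.val‖⁻¹)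
      (fun _ _ => by positivity) (Finset.mem_univ ((u : ZMod N), b))
  rw [h1]
  calc (1 : ℝ) = ‖eta N ^ ((u : ZMod N)).val - eta N ^ b.val‖⁻¹ *
        ‖eta N ^ ((u : ZMod N)).val - eta N ^ b.val‖ := by rw [inv_mul_cancel₀ hpos.ne']
    _ ≤ _ := by gcongr

theorem one_sub_le_norm {ζ : ℂ} (hζ : ‖ζ‖ = 1) {ρ : ℝ} (h0 : 0 ≤ ρ) : 1 - ρ ≤ ‖1 - ζ * ρ‖ := by
  have := norm_sub_norm_le (1 : ℂ) (ζ * ρ)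
  rwa [norm_one, norm_mul, hζ, one_mul, Complex.norm_real, Real.norm_of_nonneg h0] at this

theorem norm_one_sub_le {ζ : ℂ} (hζ : ‖ζ‖ = 1) {ρ : ℝ} (h0 : 0 ≤ ρ) (h1 : ρ ≤ 1) :
    ‖1 - ζ‖ ≤ 2 * ‖1 - ζ * ρ‖ := by
  have h2 : ‖1 - ζ‖ ≤ ‖1 - ζ * ρ‖ + ‖ζ * ρ - ζ‖ := by
    have := norm_add_le (1 - ζ * ρ) (ζ * ρ - ζ)
    rwa [show (1 - ζ * ρ) + (ζ * ρ - ζ) = 1 - ζ by ring] at this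
  have h3 : ‖ζ * ρ - ζ‖ = 1 - ρ := by
    rw [show ζ * ρ - ζ = ζ * ((ρ - 1 : ℝ) : ℂ) by push_cast; ring, norm_mul, hζ, one_mul,
      Complex.norm_real, Real.norm_of_nonpos (by linarith)]
    ring
  linarith [one_sub_le_norm hζ h0]

/-- The value of the basic letter of weight one. -/
def yval (b : ZMod N) (r : ℝ) (u : ℕ) : ℂ := ev (zpt N r ^ u) (letterSeries 0 b)

theorem yval_eq (b : ZMod N) {r : ℝ} (h0 : 0 < r) (h1 : r < 1) {u : ℕ} (hu : 0 < u) :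
    yval b r u = phase b u * (r ^ u : ℝ) / (1 - phase b u * (r ^ u : ℝ)) := by
  rw [yval, ev_letterSeries_zero b (norm_zpt_pow_lt h0 h1 hu), zpt, phase, mul_pow]
  push_cast
  rw [mul_assoc]

theorem norm_yval_le (b : ZMod N) {r : ℝ} (h0 : 0 < r) (h1 : r < 1) {u : ℕ} (hu : 0 < u) :
    ‖yval b r u‖ ≤ r ^ u / (1 - r ^ u) := by
  have hru : r ^ u < 1 := pow_lt_one₀ h0.le h1 hu.ne'
  rw [yval_eq b h0 h1 hu, norm_div, norm_mul, norm_phase, one_mul, Complex.norm_real,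
    Real.norm_of_nonneg (by positivity)]
  exact div_le_div_of_nonneg_left (by positivity) (by linarith)
    (one_sub_le_norm (norm_phase b u) (by positivity))

theorem norm_yval_pow_le (b : ZMod N) {r : ℝ} (h0 : 0 < r) (h1 : r < 1) {u : ℕ} (hu : 0 < u)
    {i s : ℕ} (hi : i < s) : ‖yval b r u‖ ^ (i + 1) ≤ r ^ u / (1 - r ^ u) ^ s := by
  have hru : r ^ u < 1 := pow_lt_one₀ h0.le h1 hu.ne'
  have hru0 : 0 < r ^ u := by positivity
  have hd : 0 < 1 - r ^ u := by linarith
  calc ‖yval b r u‖ ^ (i + 1) ≤ (r ^ u / (1 - r ^ u)) ^ (i + 1) :=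
        pow_le_pow_left₀ (norm_nonneg _) (norm_yval_le b h0 h1 hu) _
    _ = (r ^ u) ^ (i + 1) / (1 - r ^ u) ^ (i + 1) := div_pow _ _ _
    _ ≤ r ^ u / (1 - r ^ u) ^ s := by
      refine div_le_div₀ hru0.le ?_ (by positivity) ?_
      · exact pow_le_of_le_one hru0.le hru.le (Nat.succ_ne_zero i)
      · exact pow_le_pow_of_le_one hd.le (by linarith) hi

/-- Uniform in the residue, since |1 - ζρ| ≥ 1 - ρ for every root of unity ζ. Allowing k < s
matters: lower powers of y need fewer factors 1-r. -/
theorem powSpan_bound {s k : ℕ} (hk : k ≤ s) {g : ℂ⟦X⟧ × QN N} (hg : g ∈ powSpan N k) :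
    Conv g.1 ∧ ∃ C : ℝ, 0 ≤ C ∧ ∀ r : ℝ, 0 < r → r < 1 → ∀ u : ℕ, 0 < u →
      (1 - r) ^ s * ‖ev (zpt N r ^ u) g.1‖ ≤ C / (u ^ s * (1 + u * (1 - r))) := by
  obtain ⟨C₀, hC₀, hb⟩ := scaled_geometric_le s
  induction hg using Submodule.span_induction with
  | mem g hg =>
    obtain ⟨i, b, hi, rfl⟩ := hg
    have hc : Conv (letterSeries 0 b) := conv_letterSeries 0 b
    refine ⟨hc.pow (i + 1), C₀, hC₀, fun r h0 h1 u hu => ?_⟩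
    refine le_trans ?_ (hb r h0 h1 u hu)
    refine mul_le_mul_of_nonneg_left ?_ (pow_nonneg (by linarith) _)
    have := norm_yval_pow_le b h0 h1 hu (hi.trans_le hk)
    rw [Prod.pow_fst]
    change ‖ev _ (letterSeries 0 b ^ (i + 1))‖ ≤ _
    rwa [ev_pow hc (norm_zpt_pow_lt h0 h1 hu), norm_pow]
  | zero =>
    refine ⟨conv_zero, 0, le_rfl, fun r h0 h1 u hu => ?_⟩
    simp [ev_zero]
  | add f g _ _ hf hg =>
    obtain ⟨cf, C, hC, h⟩ := hf
    obtain ⟨cg, D, hD, h'⟩ := hg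
    refine ⟨cf.add cg, C + D, by positivity, fun r h0 h1 u hu => ?_⟩
    rw [Prod.fst_add, ev_add cf cg (norm_zpt_pow_lt h0 h1 hu), add_div]
    refine le_trans ?_ (add_le_add (h r h0 h1 u hu) (h' r h0 h1 u hu))
    rw [← mul_add]
    exact mul_le_mul_of_nonneg_left (norm_add_le _ _) (pow_nonneg (by linarith) _)
  | smul c g _ hg =>
    obtain ⟨cg, C, hC, h⟩ := hg
    refine ⟨cg.smul (c : ℂ), ‖(c : ℂ)‖ * C, by positivity, fun r h0 h1 u hu => ?_⟩
    change (1 - r) ^ s * ‖ev _ ((c : ℂ) • g.1)‖ ≤ _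
    rw [ev_smul, norm_mul, mul_div_assoc, mul_left_comm]
    exact mul_le_mul_of_nonneg_left (h r h0 h1 u hu) (norm_nonneg _)

/-- The letter of weight `s`, multiplied by `(1 - r) ^ s`. -/
def scaled (a : Letter N) (r : ℝ) (u : ℕ) : ℂ :=
  if u = 0 then 0 else ((1 - r : ℝ) : ℂ) ^ (a.1 : ℕ) * ev (zpt N r ^ u) (letter a)

/-- The limit of the scaled letter. -/
def scaledLim (a : Letter N) (u : ℕ) : ℂ :=
  if 0 < u ∧ (u : ZMod N) = a.2 then 1 / (u : ℂ) ^ (a.1 : ℕ) else 0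

theorem scaled_zero (a : Letter N) (r : ℝ) : scaled a r 0 = 0 := by simp [scaled]

theorem scaledLim_zero (a : Letter N) : scaledLim a 0 = 0 := by simp [scaledLim]

theorem norm_ofReal_one_sub {r : ℝ} (h1 : r < 1) : ‖((1 - r : ℝ) : ℂ)‖ = 1 - r := by
  rw [Complex.norm_real, Real.norm_of_nonneg (by linarith)]

theorem scaled_bound (a : Letter N) : ∃ C : ℝ, 0 ≤ C ∧ ∀ r : ℝ, 0 < r → r < 1 → ∀ u : ℕ, 0 < u →
    ‖scaled a r u‖ ≤ C / (u ^ (a.1 : ℕ) * (1 + u * (1 - r))) := by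
  obtain ⟨_, C, hC, h⟩ := powSpan_bound (N := N) (le_refl (a.1 : ℕ))
    (fullLetter_mem_powSpan a.2 (Nat.sub_lt a.1.pos one_pos))
  refine ⟨C, hC, fun r h0 h1 u hu => ?_⟩
  rw [scaled, if_neg hu.ne', norm_mul, norm_pow, norm_ofReal_one_sub h1]
  exact h r h0 h1 u hu

theorem scaled_bound' (a : Letter N) : ∃ C : ℝ, 0 ≤ C ∧ ∀ r : ℝ, 0 < r → r < 1 → ∀ u : ℕ, 0 < u →
    ‖scaled a r u‖ ≤ C / u ^ (a.1 : ℕ) := by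
  obtain ⟨C, hC, h⟩ := scaled_bound a
  refine ⟨C, hC, fun r h0 h1 u hu => (h r h0 h1 u hu).trans ?_⟩
  have hu' : (0 : ℝ) < u := by exact_mod_cast hu
  refine div_le_div_of_nonneg_left hC (by positivity) ?_
  refine le_mul_of_one_le_right (by positivity) ?_
  have : 0 ≤ (u : ℝ) * (1 - r) := mul_nonneg hu'.le (by linarith)
  linarith

/-- With g = 1 + r + ⋯ + r^(u-1) one has 1 - r^u = (1-r) g, so the difference is -(g - u r^u)/(u g),
and u r^u ≤ g ≤ u. -/
theorem abs_scaled_geometric_sub_le {r : ℝ} (h0 : 0 < r) (h1 : r < 1) {u : ℕ} (hu : 0 < u) :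
    |(1 - r) * (r ^ u / (1 - r ^ u)) - 1 / u| ≤ (1 - r) * u := by
  have hu' : (1 : ℝ) ≤ u := by exact_mod_cast hu
  have hru : r ^ u < 1 := pow_lt_one₀ h0.le h1 hu.ne'
  set g : ℝ := ∑ i ∈ Finset.range u, r ^ i with hg
  have hgr : (1 - r) * g = 1 - r ^ u := mul_neg_geom_sum r u
  have hr : 0 < 1 - r := by linarith
  have hle : 1 - r ^ u ≤ u * (1 - r) := by
    have := one_add_mul_le_pow (a := r - 1) (by linarith) u
    have e : (1 + (r - 1)) = r := by ring
    rw [e] at this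
    linarith
  have hg1 : 1 ≤ g := by
    have : r ^ 0 ≤ g := Finset.single_le_sum (f := fun i => r ^ i) (fun i _ => by positivity)
      (Finset.mem_range.2 hu)
    simpa using this
  have hgu : g ≤ u := by
    have : g ≤ ∑ i ∈ Finset.range u, (1 : ℝ) :=
      Finset.sum_le_sum fun i _ => pow_le_one₀ h0.le h1.le
    simpa using this
  have hgl : u * r ^ u ≤ g := by
    have : ∑ i ∈ Finset.range u, r ^ u ≤ g :=
      Finset.sum_le_sum fun i hi => pow_le_pow_of_le_one h0.le h1.le (Finset.mem_range.1 hi).le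
    simpa using this
  have e1 : (1 - r) * (r ^ u / (1 - r ^ u)) - 1 / u = -((g - u * r ^ u) / (u * g)) := by
    rw [← hgr]
    field_simp
    ring
  rw [e1, abs_neg, abs_of_nonneg (div_nonneg (by linarith) (by positivity)),
    div_le_iff₀ (by positivity)]
  have h2 : g - u * r ^ u ≤ u * (u * (1 - r)) := by
    calc g - u * r ^ u ≤ u - u * r ^ u := by linarith
      _ = u * (1 - r ^ u) := by ring
      _ ≤ _ := by gcongr
  calc g - u * r ^ u ≤ u * (u * (1 - r)) := h2
    _ = (1 - r) * u * (u * 1) := by ring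
    _ ≤ (1 - r) * u * (u * g) := by gcongr

/-- The choice of the point r η⁻¹ acts here: only u ≡ b mod N approaches the pole of y; for the
other u the denominator stays away from 0 and the factor 1-r remains. -/
theorem yval_rate [NeZero N] (b : ZMod N) : ∃ C : ℝ, 0 ≤ C ∧ ∀ r : ℝ, 0 < r → r < 1 →
    ∀ u : ℕ, 0 < u → ‖((1 - r : ℝ) : ℂ) * yval b r u -
      (if (u : ZMod N) = b then 1 / (u : ℂ) else 0)‖ ≤ C * (1 - r) * u := by
  obtain ⟨C, hC, h⟩ := exists_phase_bound N
  refine ⟨1 + 2 * C, by positivity, fun r h0 h1 u hu => ?_⟩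
  have hu' : (1 : ℝ) ≤ u := by exact_mod_cast hu
  have hr : 0 < 1 - r := by linarith
  have hru : r ^ u < 1 := pow_lt_one₀ h0.le h1 hu.ne'
  have hru0 : 0 < r ^ u := by positivity
  rw [yval_eq b h0 h1 hu]
  split_ifs with hb
  · rw [phase_eq_one hb]
    have e : ((1 - r : ℝ) : ℂ) * (1 * (r ^ u : ℝ) / (1 - 1 * (r ^ u : ℝ))) - 1 / (u : ℂ) =
        (((1 - r) * (r ^ u / (1 - r ^ u)) - 1 / u : ℝ) : ℂ) := by
      push_cast
      ring
    rw [e, Complex.norm_real, Real.norm_eq_abs]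
    refine (abs_scaled_geometric_sub_le h0 h1 hu).trans ?_
    nlinarith [mul_nonneg hC (mul_nonneg hr.le (by linarith : (0 : ℝ) ≤ u))]
  · rw [sub_zero, norm_mul, norm_ofReal_one_sub h1, norm_div, norm_mul, norm_phase, one_mul,
      Complex.norm_real, Real.norm_of_nonneg hru0.le]
    have h2 := h b u hb
    have h3 := norm_one_sub_le (norm_phase b u) hru0.le hru.le
    have h4 : 1 ≤ 2 * C * ‖1 - phase b u * (r ^ u : ℝ)‖ := by nlinarith
    have h5 : 0 < ‖1 - phase b u * (r ^ u : ℝ)‖ := by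
      have := one_sub_le_norm (norm_phase b u) hru0.le
      linarith
    have h6 : r ^ u / ‖1 - phase b u * (r ^ u : ℝ)‖ ≤ 2 * C := by
      rw [div_le_iff₀ h5]
      linarith
    calc (1 - r) * (r ^ u / ‖1 - phase b u * (r ^ u : ℝ)‖) ≤ (1 - r) * (2 * C) := by gcongr
      _ ≤ (1 - r) * (2 * C) * u := le_mul_of_one_le_right (by positivity) hu'
      _ ≤ (1 + 2 * C) * (1 - r) * u := by nlinarith [mul_nonneg hr.le (by linarith : (0 : ℝ) ≤ u)]

theorem norm_pow_sub_pow_le {x y : ℂ} {C : ℝ} (hx : ‖x‖ ≤ C) (hy : ‖y‖ ≤ 1) (hC : 1 ≤ C) (n : ℕ) :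
    ‖x ^ n - y ^ n‖ ≤ n * C ^ n * ‖x - y‖ := by
  induction n with
  | zero => simp
  | succ n ih =>
    have e : x ^ (n + 1) - y ^ (n + 1) = x ^ n * (x - y) + (x ^ n - y ^ n) * y := by ring
    have hC0 : 0 ≤ C := by linarith
    have h1 : ‖x ^ n * (x - y)‖ ≤ C ^ (n + 1) * ‖x - y‖ := by
      rw [norm_mul, norm_pow]
      refine mul_le_mul_of_nonneg_right ?_ (norm_nonneg _)
      exact (pow_le_pow_left₀ (norm_nonneg _) hx n).trans (pow_le_pow_right₀ hC (Nat.le_succ n))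
    have h2 : ‖(x ^ n - y ^ n) * y‖ ≤ n * C ^ (n + 1) * ‖x - y‖ := by
      rw [norm_mul]
      calc ‖x ^ n - y ^ n‖ * ‖y‖ ≤ n * C ^ n * ‖x - y‖ * 1 :=
            mul_le_mul ih hy (norm_nonneg _) (by positivity)
        _ = n * C ^ n * ‖x - y‖ := mul_one _
        _ ≤ n * C ^ (n + 1) * ‖x - y‖ := by
            gcongr
            exact Nat.le_succ n
    rw [e]
    refine (norm_add_le _ _).trans ((add_le_add h1 h2).trans ?_)
    push_cast
    linarith

/-- The leading power of y converges by the case of weight one, and the lower powers are negligible.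
-/
theorem scaled_rate [NeZero N] (a : Letter N) : ∃ C : ℝ, 0 ≤ C ∧ ∀ r : ℝ, 0 < r → r < 1 →
    ∀ u : ℕ, 0 < u → ‖scaled a r u - scaledLim a u‖ ≤ C * (1 - r) * u := by
  obtain ⟨⟨n, hn⟩, b⟩ := a
  obtain ⟨n, rfl⟩ : ∃ m, n = m + 1 := ⟨n - 1, by omega⟩
  obtain ⟨cg, C₁, hC₁, h1⟩ := powSpan_bound (N := N) (le_refl n) (fullLetter_sub_pow_mem n b)
  obtain ⟨C₂, hC₂, h2⟩ := yval_rate b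
  obtain ⟨C₃, hC₃, h3⟩ := scaled_bound' ((1, b) : Letter N)
  have hC3 : 1 ≤ 1 + C₃ := by linarith
  refine ⟨C₁ + ((n + 1 : ℕ) : ℝ) * (1 + C₃) ^ (n + 1) * C₂, by positivity, fun r hr0 hr1 u hu => ?_⟩
  have hu' : (1 : ℝ) ≤ u := by exact_mod_cast hu
  have hr : 0 < 1 - r := by linarith
  have hz := norm_zpt_pow_lt (N := N) hr0 hr1 hu
  have cy : Conv (letterSeries 0 b) := conv_letterSeries 0 b
  set G : ℂ⟦X⟧ := letterSeries n b - letterSeries 0 b ^ (n + 1) with hG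
  have hG' : (fullLetter n b - fullLetter 0 b ^ (n + 1)).1 = G := rfl
  rw [hG'] at cg h1
  have e1 : ev (zpt N r ^ u) (letterSeries n b) = ev (zpt N r ^ u) G + yval b r u ^ (n + 1) := by
    have : letterSeries n b = G + letterSeries 0 b ^ (n + 1) := by rw [hG]; ring
    rw [this, ev_add cg (cy.pow _) hz, ev_pow cy hz, yval]
  have e2 : scaled ((⟨n + 1, hn⟩, b) : Letter N) r u - scaledLim ((⟨n + 1, hn⟩, b) : Letter N) u =
      ((1 - r : ℝ) : ℂ) ^ (n + 1) * ev (zpt N r ^ u) G +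
      ((((1 - r : ℝ) : ℂ) * yval b r u) ^ (n + 1) -
        (if (u : ZMod N) = b then 1 / (u : ℂ) else 0) ^ (n + 1)) := by
    have e3 : ev (zpt N r ^ u) (letter ((⟨n + 1, hn⟩, b) : Letter N)) =
      ev (zpt N r ^ u) (letterSeries n b) := rfl
    rw [scaled, if_neg hu.ne', e3, e1, scaledLim]
    simp only [PNat.mk_coe]
    split_ifs with p q q
    · rw [one_div_pow, mul_pow]
      ring
    · exact absurd p.2 q
    · exact absurd ⟨hu, q⟩ p
    · rw [zero_pow (Nat.succ_ne_zero n), mul_pow]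
      ring
  -- The powers of y in `G` have exponent at most n and are tamed by (1-r)^n, which leaves one
  -- factor 1-r.
  have b1 : ‖((1 - r : ℝ) : ℂ) ^ (n + 1) * ev (zpt N r ^ u) G‖ ≤ C₁ * (1 - r) * u := by
    rw [norm_mul, norm_pow, norm_ofReal_one_sub hr1]
    have h4 := h1 r hr0 hr1 u hu
    have h5 : C₁ / ((u : ℝ) ^ n * (1 + u * (1 - r))) ≤ C₁ := by
      refine div_le_self hC₁ ?_
      have h6 : (1 : ℝ) ≤ (u : ℝ) ^ n := one_le_pow₀ hu'
      have h7 : 0 ≤ (u : ℝ) * (1 - r) := mul_nonneg (by linarith) hr.le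
      nlinarith
    calc (1 - r) ^ (n + 1) * ‖ev (zpt N r ^ u) G‖
        = (1 - r) * ((1 - r) ^ n * ‖ev (zpt N r ^ u) G‖) := by ring
      _ ≤ (1 - r) * C₁ := by gcongr; exact h4.trans h5
      _ ≤ (1 - r) * C₁ * u := le_mul_of_one_le_right (by positivity) hu'
      _ = C₁ * (1 - r) * u := by ring
  have b2 : ‖((1 - r : ℝ) : ℂ) * yval b r u‖ ≤ 1 + C₃ := by
    have h4 := h3 r hr0 hr1 u hu
    have e4 : scaled ((1, b) : Letter N) r u = ((1 - r : ℝ) : ℂ) * yval b r u := by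
      rw [scaled, if_neg hu.ne']
      simp only [PNat.one_coe, pow_one]
      rfl
    rw [e4] at h4
    have h5 : C₃ / (u : ℝ) ^ (((1, b) : Letter N).1 : ℕ) ≤ C₃ :=
      div_le_self hC₃ (one_le_pow₀ hu')
    linarith
  have b3 : ‖(if (u : ZMod N) = b then 1 / (u : ℂ) else 0)‖ ≤ 1 := by
    split_ifs
    · rw [norm_div, norm_one, Complex.norm_natCast]
      exact div_le_one_of_le₀ hu' (by linarith)
    · simp
  rw [e2]
  refine (norm_add_le _ _).trans ?_
  have b4 := (norm_pow_sub_pow_le b2 b3 hC3 (n + 1)).trans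
    (mul_le_mul_of_nonneg_left (h2 r hr0 hr1 u hu) (by positivity))
  refine (add_le_add b1 b4).trans (le_of_eq ?_)
  ring

end Estimates

/-! ### Asymptotics of truncated sums -/

section Sums

variable {N : ℕ}

/-- The truncated sum of `w`, multiplied by `(1 - r) ^ weight w`. -/
def scaledSum (w : Word N) (r : ℝ) (M : ℕ) : ℂ :=
  ((1 - r : ℝ) : ℂ) ^ weight w * ev (zpt N r) (trunc w M)

theorem scaledSum_nil (r : ℝ) (M : ℕ) : scaledSum ([] : Word N) r M = 1 := by
  simp [scaledSum, weight, trunc, ev_one]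

theorem scaledSum_cons (a : Letter N) (w : Word N) {r : ℝ} (h0 : 0 < r) (h1 : r < 1) (M : ℕ) :
    scaledSum (a :: w) r M = ∑ u ∈ Finset.range M, scaled a r u * scaledSum w r u := by
  rw [scaledSum, ev_trunc_cons a w M (norm_zpt_lt h0 h1), Finset.mul_sum]
  refine Finset.sum_congr rfl fun u _ => ?_
  rw [scaledSum, scaled, weight_cons, pow_add]
  split_ifs <;> ring

theorem hsum_cons (a : Letter N) (w : Word N) (M : ℕ) :
    hsum (a :: w) M = ∑ u ∈ Finset.range M, scaledLim a u * hsum w u := by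
  rw [hsum, Finset.sum_filter]
  refine Finset.sum_congr rfl fun u _ => ?_
  rw [scaledLim]
  split_ifs <;> simp

theorem tendsto_scaledSum (w : Word N) {r : ℝ} (h0 : 0 < r) (h1 : r < 1) :
    Filter.Tendsto (fun M => scaledSum w r M) Filter.atTop
      (𝓝 (((1 - r : ℝ) : ℂ) ^ weight w * ev (zpt N r) (bracket w))) :=
  (tendsto_ev_trunc w (norm_zpt_lt h0 h1)).const_mul _

theorem sum_range_inv_le (M : ℕ) :
    ∑ u ∈ Finset.range M, (1 / (u : ℝ)) ≤ 1 + Real.log M := by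
  cases M with
  | zero => simp
  | succ M =>
    have h := harmonic_le_one_add_log M
    have e : ∑ u ∈ Finset.range (M + 1), (1 / (u : ℝ)) = (harmonic M : ℝ) := by
      rw [Finset.sum_range_succ', harmonic]
      push_cast
      simp
    rw [e]
    refine h.trans ?_
    rcases Nat.eq_zero_or_pos M with rfl | hM
    · simp
    · have : Real.log M ≤ Real.log (M + 1 : ℕ) :=
        Real.log_le_log (by exact_mod_cast hM) (by exact_mod_cast Nat.le_succ M)
      linarith

theorem log_natCast_nonneg (M : ℕ) : 0 ≤ Real.log M := Real.log_natCast_nonneg M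

/-- Every letter is at most a constant times 1/u, so each level of nesting costs one harmonic sum.
-/
theorem scaledSum_log_bound (w : Word N) : ∃ C : ℝ, 0 ≤ C ∧ ∀ r : ℝ, 0 < r → r < 1 → ∀ M : ℕ,
    ‖scaledSum w r M‖ ≤ C * (1 + Real.log M) ^ w.length := by
  induction w with
  | nil => exact ⟨1, zero_le_one, fun r _ _ M => by simp [scaledSum_nil]⟩
  | cons a w ih =>
    obtain ⟨C, hC, h⟩ := ih
    obtain ⟨D, hD, h'⟩ := scaled_bound' a
    refine ⟨D * C, by positivity, fun r h0 h1 M => ?_⟩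
    have hM := log_natCast_nonneg M
    rw [scaledSum_cons a w h0 h1]
    have key : ∀ u ∈ Finset.range M, ‖scaled a r u * scaledSum w r u‖ ≤
        D * C * (1 + Real.log M) ^ w.length * (1 / (u : ℝ)) := by
      intro u hu
      rcases Nat.eq_zero_or_pos u with rfl | hu0
      · simp [scaled_zero]
      have hu1 : (1 : ℝ) ≤ u := by exact_mod_cast hu0
      have huM : (u : ℝ) ≤ M := by exact_mod_cast (Finset.mem_range.1 hu).le
      have hlog : Real.log u ≤ Real.log M := Real.log_le_log (by linarith) huM
      rw [norm_mul]
      have b1 : ‖scaled a r u‖ ≤ D * (1 / (u : ℝ)) := by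
        refine (h' r h0 h1 u hu0).trans ?_
        rw [mul_one_div]
        refine div_le_div_of_nonneg_left hD (by linarith) ?_
        exact le_self_pow₀ hu1 a.1.ne_zero
      have b2 : ‖scaledSum w r u‖ ≤ C * (1 + Real.log M) ^ w.length := by
        refine (h r h0 h1 u).trans ?_
        have := log_natCast_nonneg u
        gcongr
      calc ‖scaled a r u‖ * ‖scaledSum w r u‖
          ≤ D * (1 / (u : ℝ)) * (C * (1 + Real.log M) ^ w.length) :=
            mul_le_mul b1 b2 (norm_nonneg _) (by positivity)
        _ = _ := by ring
    refine (norm_sum_le _ _).trans ((Finset.sum_le_sum key).trans ?_)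
    rw [← Finset.mul_sum, List.length_cons, pow_succ, ← mul_assoc]
    exact mul_le_mul_of_nonneg_left (sum_range_inv_le M) (by positivity)

theorem one_add_log_pow_le (n : ℕ) : ∃ C : ℝ, 0 ≤ C ∧ ∀ M : ℕ, 0 < M →
    (1 + Real.log M) ^ n ≤ C * (M : ℝ) ^ (1 / 4 : ℝ) := by
  -- Chosen so that nε ≤ 1/4.
  set ε : ℝ := 1 / (4 * (n + 1)) with hε
  have hε0 : 0 < ε := by positivity
  refine ⟨(1 + 1 / ε) ^ n, by positivity, fun M hM => ?_⟩
  have hM1 : (1 : ℝ) ≤ M := by exact_mod_cast hM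
  have hM0 : (0 : ℝ) ≤ M := by linarith
  have h1 : Real.log M ≤ (M : ℝ) ^ ε / ε := Real.log_le_rpow_div hM0 hε0
  have h2 : (1 : ℝ) ≤ (M : ℝ) ^ ε := Real.one_le_rpow hM1 hε0.le
  have h3 : 1 + Real.log M ≤ (1 + 1 / ε) * (M : ℝ) ^ ε := by
    calc 1 + Real.log M ≤ (M : ℝ) ^ ε + (M : ℝ) ^ ε / ε := add_le_add h2 h1
      _ = _ := by ring
  have h4 := log_natCast_nonneg M
  calc (1 + Real.log M) ^ n ≤ ((1 + 1 / ε) * (M : ℝ) ^ ε) ^ n :=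
        pow_le_pow_left₀ (by linarith) h3 n
    _ = (1 + 1 / ε) ^ n * (M : ℝ) ^ (ε * n) := by
        rw [mul_pow, Real.rpow_mul hM0, Real.rpow_natCast]
    _ ≤ (1 + 1 / ε) ^ n * (M : ℝ) ^ (1 / 4 : ℝ) := by
        refine mul_le_mul_of_nonneg_left (Real.rpow_le_rpow_of_exponent_le hM1 ?_) (by positivity)
        rw [hε, div_mul_eq_mul_div, one_mul, div_le_div_iff₀ (by positivity) (by norm_num)]
        linarith

theorem scaledSum_bound (w : Word N) : ∃ C : ℝ, 0 ≤ C ∧ ∀ r : ℝ, 0 < r → r < 1 → ∀ M : ℕ, 0 < M →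
    ‖scaledSum w r M‖ ≤ C * (M : ℝ) ^ (1 / 4 : ℝ) := by
  obtain ⟨C, hC, h⟩ := scaledSum_log_bound w
  obtain ⟨D, hD, h'⟩ := one_add_log_pow_le w.length
  refine ⟨C * D, by positivity, fun r h0 h1 M hM => (h r h0 h1 M).trans ?_⟩
  rw [mul_assoc]
  exact mul_le_mul_of_nonneg_left (h' M hM) hC

theorem norm_scaledLim_le (a : Letter N) (u : ℕ) : ‖scaledLim a u‖ ≤ 1 := by
  rw [scaledLim]
  split_ifs with h
  · rw [norm_div, norm_one, norm_pow, Complex.norm_natCast]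
    exact div_le_one_of_le₀ (one_le_pow₀ (by exact_mod_cast h.1)) (by positivity)
  · simp

theorem rpow_quarter_le {u : ℕ} (hu : 0 < u) : (u : ℝ) ^ (1 / 4 : ℝ) ≤ u := by
  have h : (1 : ℝ) ≤ u := by exact_mod_cast hu
  calc (u : ℝ) ^ (1 / 4 : ℝ) ≤ (u : ℝ) ^ (1 : ℝ) :=
        Real.rpow_le_rpow_of_exponent_le h (by norm_num)
    _ = u := Real.rpow_one _

/-- Letter by letter comparison of a product with its limit. The polynomial dependence on M is
harmless: `tsum_rate` trades it for a smaller power of 1-r. -/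
theorem scaledSum_rate [NeZero N] (w : Word N) : ∃ (C : ℝ) (K : ℕ), 0 ≤ C ∧ ∀ r : ℝ, 0 < r → r < 1 →
    ∀ M : ℕ, ‖scaledSum w r M - hsum w M‖ ≤ C * (1 - r) * (M : ℝ) ^ K := by
  induction w with
  | nil =>
    refine ⟨0, 0, le_rfl, fun r _ _ M => ?_⟩
    simp [scaledSum_nil, hsum]
  | cons a w ih =>
    obtain ⟨C, K, hC, h⟩ := ih
    obtain ⟨D, hD, h'⟩ := scaled_rate a
    obtain ⟨E, hE, h''⟩ := scaledSum_bound w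
    refine ⟨D * E + C, K + 3, by positivity, fun r h0 h1 M => ?_⟩
    have hr : 0 < 1 - r := by linarith
    rw [scaledSum_cons a w h0 h1, hsum_cons, ← Finset.sum_sub_distrib]
    have key : ∀ u ∈ Finset.range M, ‖scaled a r u * scaledSum w r u - scaledLim a u * hsum w u‖ ≤
        (D * E + C) * (1 - r) * (M : ℝ) ^ (K + 2) := by
      intro u hu
      rcases Nat.eq_zero_or_pos u with rfl | hu0
      · rw [scaled_zero, scaledLim_zero, zero_mul, zero_mul, sub_zero, norm_zero]
        positivity
      have hu1 : (1 : ℝ) ≤ u := by exact_mod_cast hu0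
      have huM : (u : ℝ) ≤ M := by exact_mod_cast (Finset.mem_range.1 hu).le
      have e : scaled a r u * scaledSum w r u - scaledLim a u * hsum w u =
          (scaled a r u - scaledLim a u) * scaledSum w r u +
            scaledLim a u * (scaledSum w r u - hsum w u) := by ring
      rw [e]
      have b1 : ‖(scaled a r u - scaledLim a u) * scaledSum w r u‖ ≤
          D * (1 - r) * u * (E * u) := by
        rw [norm_mul]
        refine mul_le_mul (h' r h0 h1 u hu0) ?_ (norm_nonneg _) (by positivity)
        exact (h'' r h0 h1 u hu0).trans (mul_le_mul_of_nonneg_left (rpow_quarter_le hu0) hE)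
      have b2 : ‖scaledLim a u * (scaledSum w r u - hsum w u)‖ ≤ C * (1 - r) * (u : ℝ) ^ K := by
        rw [norm_mul]
        refine (mul_le_of_le_one_left (norm_nonneg _) (norm_scaledLim_le a u)).trans (h r h0 h1 u)
      have b3 : (u : ℝ) ^ 2 ≤ (M : ℝ) ^ (K + 2) :=
        (pow_le_pow_left₀ (by linarith) huM 2).trans
          (pow_le_pow_right₀ (hu1.trans huM) (by omega))
      have b4 : (u : ℝ) ^ K ≤ (M : ℝ) ^ (K + 2) :=
        (pow_le_pow_left₀ (by linarith) huM K).trans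
          (pow_le_pow_right₀ (hu1.trans huM) (by omega))
      refine (norm_add_le _ _).trans ((add_le_add b1 b2).trans ?_)
      calc D * (1 - r) * u * (E * u) + C * (1 - r) * (u : ℝ) ^ K
          = D * E * (1 - r) * (u : ℝ) ^ 2 + C * (1 - r) * (u : ℝ) ^ K := by ring
        _ ≤ D * E * (1 - r) * (M : ℝ) ^ (K + 2) + C * (1 - r) * (M : ℝ) ^ (K + 2) := by gcongr
        _ = _ := by ring
    refine (norm_sum_le _ _).trans ((Finset.sum_le_card_nsmul _ _ _ key).trans (le_of_eq ?_))
    rw [Finset.card_range, nsmul_eq_mul]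
    ring

theorem term_rate [NeZero N] (a : Letter N) (w : Word N) : ∃ (C : ℝ) (K : ℕ), 0 ≤ C ∧
    ∀ r : ℝ, 0 < r → r < 1 → ∀ u : ℕ,
      ‖scaled a r u * scaledSum w r u - scaledLim a u * hsum w u‖ ≤ C * (1 - r) * (u : ℝ) ^ K := by
  obtain ⟨C', hC', h3⟩ := scaled_rate a
  obtain ⟨D, hD, h2⟩ := scaledSum_bound w
  obtain ⟨D', K, hD', h4⟩ := scaledSum_rate w
  refine ⟨C' * D + D', K + 2, by positivity, fun r hr0 hr1 u => ?_⟩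
  have hr : 0 < 1 - r := by linarith
  rcases Nat.eq_zero_or_pos u with rfl | hu
  · rw [scaled_zero, scaledLim_zero, zero_mul, zero_mul, sub_zero, norm_zero]
    positivity
  have hu1 : (1 : ℝ) ≤ u := by exact_mod_cast hu
  have e : scaled a r u * scaledSum w r u - scaledLim a u * hsum w u =
      (scaled a r u - scaledLim a u) * scaledSum w r u +
        scaledLim a u * (scaledSum w r u - hsum w u) := by ring
  have b1 : ‖(scaled a r u - scaledLim a u) * scaledSum w r u‖ ≤
      C' * (1 - r) * u * (D * u) := by
    rw [norm_mul]
    refine mul_le_mul (h3 r hr0 hr1 u hu) ?_ (norm_nonneg _) (by positivity)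
    exact (h2 r hr0 hr1 u hu).trans (mul_le_mul_of_nonneg_left (rpow_quarter_le hu) hD)
  have b2 : ‖scaledLim a u * (scaledSum w r u - hsum w u)‖ ≤ D' * (1 - r) * (u : ℝ) ^ K := by
    rw [norm_mul]
    exact (mul_le_of_le_one_left (norm_nonneg _) (norm_scaledLim_le a u)).trans
      (h4 r hr0 hr1 u)
  have b3 : (u : ℝ) ^ 2 ≤ (u : ℝ) ^ (K + 2) := pow_le_pow_right₀ hu1 (by omega)
  have b4 : (u : ℝ) ^ K ≤ (u : ℝ) ^ (K + 2) := pow_le_pow_right₀ hu1 (by omega)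
  rw [e]
  refine (norm_add_le _ _).trans ((add_le_add b1 b2).trans ?_)
  calc C' * (1 - r) * u * (D * u) + D' * (1 - r) * (u : ℝ) ^ K
      = C' * D * (1 - r) * (u : ℝ) ^ 2 + D' * (1 - r) * (u : ℝ) ^ K := by ring
    _ ≤ C' * D * (1 - r) * (u : ℝ) ^ (K + 2) + D' * (1 - r) * (u : ℝ) ^ (K + 2) := by gcongr
    _ = _ := by ring

/-- Interpolation between a summable bound and a pointwise rate of convergence. -/
theorem tsum_rate {x : ℝ → ℕ → ℂ} {x₀ : ℕ → ℂ} {C D : ℝ} {K : ℕ} (hC : 0 ≤ C) (hD : 0 ≤ D)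
    (hx : ∀ r : ℝ, 0 < r → r < 1 → ∀ u : ℕ, ‖x r u‖ ≤ C * (u : ℝ) ^ (-(7 / 4) : ℝ))
    (hd : ∀ r : ℝ, 0 < r → r < 1 → ∀ u : ℕ, ‖x r u - x₀ u‖ ≤ D * (1 - r) * (u : ℝ) ^ K) :
    (∀ r : ℝ, 0 < r → r < 1 → Summable (x r)) ∧ Summable x₀ ∧
      ∃ θ : ℝ, 0 < θ ∧ ∃ E : ℝ, ∀ r : ℝ, 0 < r → r < 1 →
        ‖∑' u, x r u - ∑' u, x₀ u‖ ≤ E * (1 - r) ^ θ := by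
  have hs : Summable fun u : ℕ => C * (u : ℝ) ^ (-(7 / 4) : ℝ) :=
    (Real.summable_nat_rpow.2 (by norm_num)).mul_left C
  have hx₀ : ∀ u : ℕ, ‖x₀ u‖ ≤ C * (u : ℝ) ^ (-(7 / 4) : ℝ) := by
    intro u
    have hlim : Filter.Tendsto (fun r : ℝ => C * (u : ℝ) ^ (-(7 / 4) : ℝ) +
        D * (1 - r) * (u : ℝ) ^ K) (𝓝[<] 1) (𝓝 (C * (u : ℝ) ^ (-(7 / 4) : ℝ) +
        D * (1 - 1) * (u : ℝ) ^ K)) := by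
      refine Filter.Tendsto.mono_left (Continuous.tendsto ?_ 1) nhdsWithin_le_nhds
      fun_prop
    rw [sub_self, mul_zero, zero_mul, add_zero] at hlim
    refine ge_of_tendsto hlim ?_
    have hpos : ∀ᶠ r : ℝ in 𝓝[<] 1, 0 < r :=
      nhdsWithin_le_nhds (lt_mem_nhds one_pos)
    filter_upwards [self_mem_nhdsWithin, hpos] with r h1 h0
    have h2 := norm_sub_norm_le (x₀ u) (x r u)
    rw [norm_sub_rev] at h2
    linarith [hx r h0 h1 u, hd r h0 h1 u]
  have hsx : ∀ r : ℝ, 0 < r → r < 1 → Summable (x r) := fun r h0 h1 =>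
    Summable.of_norm_bounded hs (hx r h0 h1)
  have hsx₀ : Summable x₀ := Summable.of_norm_bounded hs hx₀
  refine ⟨hsx, hsx₀, ?_⟩
  -- The geometric mean of the two bounds with weights 1-θ and θ has exponent -(7/4)(1-θ) + Kθ ≤
  -- -7/4 + (K+2)θ = -3/2, still summable, and keeps (1-r)^θ.
  set θ : ℝ := 1 / (4 * (K + 2)) with hθ
  have hθ0 : 0 < θ := by positivity
  have hθ1 : θ ≤ 1 := by
    rw [hθ]
    refine div_le_one_of_le₀ ?_ (by positivity)
    have : (0 : ℝ) ≤ K := by positivity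
    linarith
  have hθK : θ * (K + 2) = 1 / 4 := by
    rw [hθ]
    field_simp
  have key : ∀ r : ℝ, 0 < r → r < 1 → ∀ u : ℕ, ‖x r u - x₀ u‖ ≤
      (2 * C) ^ (1 - θ) * D ^ θ * (1 - r) ^ θ * (u : ℝ) ^ (-(3 / 2) : ℝ) := by
    intro r h0 h1 u
    have hr : 0 < 1 - r := by linarith
    rcases Nat.eq_zero_or_pos u with rfl | hu
    · have h2 := hx r h0 h1 0
      have h3 := hx₀ 0
      rw [Nat.cast_zero, Real.zero_rpow (by norm_num), mul_zero] at h2 h3 ⊢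
      have := norm_sub_le (x r 0) (x₀ 0)
      linarith
    have hu1 : (1 : ℝ) ≤ u := by exact_mod_cast hu
    have hu0 : (0 : ℝ) ≤ u := by linarith
    have hA : ‖x r u - x₀ u‖ ≤ 2 * C * (u : ℝ) ^ (-(7 / 4) : ℝ) := by
      have := norm_sub_le (x r u) (x₀ u)
      linarith [hx r h0 h1 u, hx₀ u]
    have hB := hd r h0 h1 u
    have hn := norm_nonneg (x r u - x₀ u)
    calc ‖x r u - x₀ u‖ = ‖x r u - x₀ u‖ ^ (1 - θ) * ‖x r u - x₀ u‖ ^ θ := by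
          rw [← Real.rpow_add_of_nonneg hn (by linarith) hθ0.le, sub_add_cancel, Real.rpow_one]
      _ ≤ (2 * C * (u : ℝ) ^ (-(7 / 4) : ℝ)) ^ (1 - θ) * (D * (1 - r) * (u : ℝ) ^ K) ^ θ := by
          refine mul_le_mul (Real.rpow_le_rpow hn hA (by linarith))
            (Real.rpow_le_rpow hn hB hθ0.le) (by positivity) (by positivity)
      _ = (2 * C) ^ (1 - θ) * D ^ θ * (1 - r) ^ θ *
            (u : ℝ) ^ (-(7 / 4) * (1 - θ) + K * θ : ℝ) := by
          rw [Real.mul_rpow (x := 2 * C) (by positivity) (by positivity),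
            Real.mul_rpow (x := D * (1 - r)) (by positivity) (by positivity),
            Real.mul_rpow hD hr.le, ← Real.rpow_natCast, ← Real.rpow_mul hu0,
            ← Real.rpow_mul hu0, Real.rpow_add (by linarith)]
          ring
      _ ≤ _ := by
          refine mul_le_mul_of_nonneg_left (Real.rpow_le_rpow_of_exponent_le hu1 ?_)
            (by positivity)
          nlinarith
  have hs2 : Summable fun u : ℕ => (u : ℝ) ^ (-(3 / 2) : ℝ) :=
    Real.summable_nat_rpow.2 (by norm_num)
  refine ⟨θ, hθ0, (2 * C) ^ (1 - θ) * D ^ θ * ∑' u : ℕ, (u : ℝ) ^ (-(3 / 2) : ℝ), fun r h0 h1 => ?_⟩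
  rw [← (hsx r h0 h1).tsum_sub hsx₀]
  refine (tsum_of_norm_bounded ((hs2.mul_left _).hasSum) (key r h0 h1)).trans (le_of_eq ?_)
  rw [tsum_mul_left]
  ring

theorem tendsto_sum_range_of_summable {x : ℕ → ℂ} (h : Summable x) :
    Filter.Tendsto (fun M => ∑ u ∈ Finset.range M, x u) Filter.atTop (𝓝 (∑' u, x u)) :=
  h.hasSum.tendsto_sum_nat

theorem zeta_cons (a : Letter N) (w : Word N) :
    zeta (a :: w) = ∑' u : ℕ, scaledLim a u * hsum w u := by
  rw [zeta]
  refine tsum_congr fun u => ?_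
  rw [scaledLim]
  split_ifs <;> simp

/-- Since s₁ ≥ 2, the outer letter is O(u⁻²) and the inner sum is O(u^(1/4)), which gives the
exponent -7/4 required by `tsum_rate`. -/
theorem adm_rate [NeZero N] {w : Word N} (hw : Adm w) :
    ∃ θ : ℝ, 0 < θ ∧ ∃ E : ℝ, ∀ r : ℝ, 0 < r → r < 1 →
      ‖((1 - r : ℝ) : ℂ) ^ weight w * ev (zpt N r) (bracket w) - zeta w‖ ≤ E * (1 - r) ^ θ := by
  cases w with
  | nil =>
    refine ⟨1, one_pos, 0, fun r _ _ => ?_⟩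
    simp [bracket_nil, ev_one, weight, zeta]
  | cons a w =>
    have ha : 2 ≤ (a.1 : ℕ) := by
      have : 1 < a.1 := hw a (by simp)
      exact_mod_cast this
    obtain ⟨C, hC, h1⟩ := scaled_bound' a
    obtain ⟨D, hD, h2⟩ := scaledSum_bound w
    obtain ⟨C', K, hC', hd⟩ := term_rate a w
    have hx : ∀ r : ℝ, 0 < r → r < 1 → ∀ u : ℕ, ‖scaled a r u * scaledSum w r u‖ ≤
        C * D * (u : ℝ) ^ (-(7 / 4) : ℝ) := by
      intro r hr0 hr1 u
      rcases Nat.eq_zero_or_pos u with rfl | hu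
      · rw [scaled_zero, zero_mul, norm_zero]
        positivity
      have hu1 : (1 : ℝ) ≤ u := by exact_mod_cast hu
      have b1 : ‖scaled a r u‖ ≤ C * (u : ℝ) ^ (-2 : ℝ) := by
        refine (h1 r hr0 hr1 u hu).trans ?_
        rw [Real.rpow_neg (by linarith), ← div_eq_mul_inv]
        refine div_le_div_of_nonneg_left hC (by positivity) ?_
        rw [← Real.rpow_natCast (u : ℝ) (a.1 : ℕ)]
        exact Real.rpow_le_rpow_of_exponent_le hu1 (by exact_mod_cast ha)
      rw [norm_mul]
      calc ‖scaled a r u‖ * ‖scaledSum w r u‖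
          ≤ C * (u : ℝ) ^ (-2 : ℝ) * (D * (u : ℝ) ^ (1 / 4 : ℝ)) :=
            mul_le_mul b1 (h2 r hr0 hr1 u hu) (norm_nonneg _) (by positivity)
        _ = C * D * ((u : ℝ) ^ (-2 : ℝ) * (u : ℝ) ^ (1 / 4 : ℝ)) := by ring
        _ = _ := by
          rw [← Real.rpow_add (by linarith)]
          norm_num
    obtain ⟨s1, s2, θ, hθ, E, hE⟩ := tsum_rate (by positivity) hC' hx hd
    refine ⟨θ, hθ, E, fun r hr0 hr1 => ?_⟩
    have e : ((1 - r : ℝ) : ℂ) ^ weight (a :: w) * ev (zpt N r) (bracket (a :: w)) =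
        ∑' u, scaled a r u * scaledSum w r u := by
      refine tendsto_nhds_unique (tendsto_scaledSum (a :: w) hr0 hr1) ?_
      simp only [scaledSum_cons a w hr0 hr1]
      exact tendsto_sum_range_of_summable (s1 r hr0 hr1)
    rw [e, zeta_cons]
    exact hE r hr0 hr1

end Sums

/-! ### The values `Γ_β` as limits, and the size of `t_N` -/

section Small

/-- `F r` is bounded by a positive power of `1 - r`. -/
def Small (F : ℝ → ℂ) : Prop :=
  ∃ θ : ℝ, 0 < θ ∧ ∃ E : ℝ, ∀ r : ℝ, 0 < r → r < 1 → ‖F r‖ ≤ E * (1 - r) ^ θ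

theorem Small.congr {F G : ℝ → ℂ} (hF : Small F) (h : ∀ r : ℝ, 0 < r → r < 1 → G r = F r) :
    Small G := by
  obtain ⟨θ, hθ, E, hE⟩ := hF
  exact ⟨θ, hθ, E, fun r h0 h1 => by rw [h r h0 h1]; exact hE r h0 h1⟩

theorem Small.add {F G : ℝ → ℂ} (hF : Small F) (hG : Small G) : Small fun r => F r + G r := by
  obtain ⟨θ, hθ, E, hE⟩ := hF
  obtain ⟨τ, hτ, D, hD⟩ := hG
  refine ⟨min θ τ, lt_min hθ hτ, |E| + |D|, fun r h0 h1 => ?_⟩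
  have hr : 0 < 1 - r := by linarith
  have e1 : (1 - r) ^ θ ≤ (1 - r) ^ min θ τ :=
    Real.rpow_le_rpow_of_exponent_ge hr (by linarith) (min_le_left _ _)
  have e2 : (1 - r) ^ τ ≤ (1 - r) ^ min θ τ :=
    Real.rpow_le_rpow_of_exponent_ge hr (by linarith) (min_le_right _ _)
  have p1 : 0 ≤ (1 - r) ^ θ := by positivity
  have p2 : 0 ≤ (1 - r) ^ τ := by positivity
  calc ‖F r + G r‖ ≤ E * (1 - r) ^ θ + D * (1 - r) ^ τ :=
        (norm_add_le _ _).trans (add_le_add (hE r h0 h1) (hD r h0 h1))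
    _ ≤ |E| * (1 - r) ^ min θ τ + |D| * (1 - r) ^ min θ τ := by
        refine add_le_add ?_ ?_
        · exact (mul_le_mul_of_nonneg_right (le_abs_self E) p1).trans
            (mul_le_mul_of_nonneg_left e1 (abs_nonneg E))
        · exact (mul_le_mul_of_nonneg_right (le_abs_self D) p2).trans
            (mul_le_mul_of_nonneg_left e2 (abs_nonneg D))
    _ = _ := by ring

theorem Small.const_mul {F : ℝ → ℂ} (c : ℂ) (hF : Small F) : Small fun r => c * F r := by
  obtain ⟨θ, hθ, E, hE⟩ := hF
  refine ⟨θ, hθ, ‖c‖ * E, fun r h0 h1 => ?_⟩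
  rw [norm_mul, mul_assoc]
  exact mul_le_mul_of_nonneg_left (hE r h0 h1) (norm_nonneg c)

theorem Small.neg {F : ℝ → ℂ} (hF : Small F) : Small fun r => -F r := by
  simpa using hF.const_mul (-1)

theorem Small.sub {F G : ℝ → ℂ} (hF : Small F) (hG : Small G) : Small fun r => F r - G r := by
  simpa [sub_eq_add_neg] using hF.add hG.neg

theorem small_zero : Small fun _ => 0 :=
  ⟨1, one_pos, 0, fun r _ _ => by simp⟩

theorem Small.sum {ι : Type*} (s : Finset ι) {F : ι → ℝ → ℂ} (h : ∀ i ∈ s, Small (F i)) :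
    Small fun r => ∑ i ∈ s, F i r := by
  induction s using Finset.cons_induction with
  | empty => simpa using small_zero
  | cons a s ha ih =>
    simp only [Finset.sum_cons]
    exact (h a (by simp)).add (ih fun i hi => h i (by simp [hi]))

theorem small_of_linear {F : ℝ → ℂ} {C : ℝ}
    (h : ∀ r : ℝ, 0 < r → r < 1 → ‖F r‖ ≤ C * (1 - r)) : Small F :=
  ⟨1, one_pos, C, fun r h0 h1 => by rw [Real.rpow_one]; exact h r h0 h1⟩

end Small

/-! ### Shifted sums and the limits of the series g_β. -/

section Gamma

variable {N : ℕ}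

/-- Pairing the u-th term of one series with the (u+γ)-th term of the other leaves the terms of
index at most γ of the second unpaired. The pairing starts at u = 1 since p 0 = 0. -/
theorem tsum_shift_eq {p q : ℕ → ℂ} {P Q : ℂ} {γ : ℕ} (hp0 : p 0 = 0)
    (hp : Filter.Tendsto (fun M => ∑ u ∈ Finset.range M, p u) Filter.atTop (𝓝 P))
    (hq : Filter.Tendsto (fun M => ∑ u ∈ Finset.range M, q u) Filter.atTop (𝓝 Q))
    (hd : Summable fun u => if u = 0 then 0 else p u - q (u + γ)) :
    P - Q = ∑' u, (if u = 0 then 0 else p u - q (u + γ)) - ∑ u ∈ Finset.range (γ + 1), q u := by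
  have key : ∀ M : ℕ, ∑ u ∈ Finset.range (M + 1), (if u = 0 then 0 else p u - q (u + γ)) =
      ∑ u ∈ Finset.range (M + 1), p u - (∑ u ∈ Finset.range (M + (γ + 1)), q u -
        ∑ u ∈ Finset.range (γ + 1), q u) := by
    intro M
    induction M with
    | zero => simp [hp0]
    | succ M ih =>
      rw [Finset.sum_range_succ, ih, Finset.sum_range_succ p (M + 1), if_neg (Nat.succ_ne_zero M),
        show M + 1 + (γ + 1) = M + (γ + 1) + 1 by omega, Finset.sum_range_succ q (M + (γ + 1)),
        show M + 1 + γ = M + (γ + 1) by omega]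
      ring
  have h1 := (tendsto_sum_range_of_summable hd).comp (Filter.tendsto_add_atTop_nat 1)
  have h2 := (hp.comp (Filter.tendsto_add_atTop_nat 1)).sub
    ((hq.comp (Filter.tendsto_add_atTop_nat (γ + 1))).sub_const
      (∑ u ∈ Finset.range (γ + 1), q u))
  have h3 := tendsto_nhds_unique (h1.congr fun M => key M) h2
  rw [h3]
  ring

theorem scaled_one_eq (b : ZMod N) (r : ℝ) {u : ℕ} (hu : 0 < u) :
    scaled ((1, b) : Letter N) r u = ((1 - r : ℝ) : ℂ) * yval b r u := by
  rw [scaled, if_neg hu.ne']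
  simp only [PNat.one_coe, pow_one]
  rfl

/-- Both letters have the same phase ζ, so the numerator of their difference is ζ (r^u - r^(u+γ)),
at most γ(1-r) r^u in size. This gains a factor 1-r, and the difference behaves like a letter of
weight two. -/
theorem scaled_shift_bound [NeZero N] (α : ZMod N) (γ : ℕ) : ∃ C : ℝ, 0 ≤ C ∧ ∀ r : ℝ, 0 < r →
    r < 1 → ∀ u : ℕ, 0 < u → ‖scaled ((1, α) : Letter N) r u -
      scaled ((1, α + (γ : ZMod N)) : Letter N) r (u + γ)‖ ≤ C * (u : ℝ) ^ (-2 : ℝ) := by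
  obtain ⟨C, hC, h⟩ := scaled_geometric_le 2
  refine ⟨γ * C, by positivity, fun r h0 h1 u hu => ?_⟩
  have hu' : (1 : ℝ) ≤ u := by exact_mod_cast hu
  have hr : 0 < 1 - r := by linarith
  have hru : r ^ u < 1 := pow_lt_one₀ h0.le h1 hu.ne'
  have hru0 : 0 < r ^ u := by positivity
  have hle : r ^ (u + γ) ≤ r ^ u := pow_le_pow_of_le_one h0.le h1.le (Nat.le_add_right u γ)
  have hd0 : 0 < r ^ (u + γ) := by positivity
  set ζ := phase α u with hζ
  have hζ1 : ‖ζ‖ = 1 := norm_phase α u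
  have n1 := one_sub_le_norm hζ1 hru0.le
  have n2 := one_sub_le_norm hζ1 hd0.le
  have hA : (1 : ℂ) - ζ * (r ^ u : ℝ) ≠ 0 := by
    rw [← norm_pos_iff]
    linarith
  have hB : (1 : ℂ) - ζ * (r ^ (u + γ) : ℝ) ≠ 0 := by
    rw [← norm_pos_iff]
    linarith
  rw [scaled_one_eq α r hu, scaled_one_eq _ r (by omega : 0 < u + γ), yval_eq α h0 h1 hu,
    yval_eq _ h0 h1 (by omega : 0 < u + γ), phase_add, ← mul_sub, ← hζ, div_sub_div _ _ hA hB]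
  have e : ζ * (r ^ u : ℝ) * (1 - ζ * (r ^ (u + γ) : ℝ)) -
      (1 - ζ * (r ^ u : ℝ)) * (ζ * (r ^ (u + γ) : ℝ)) =
      ζ * ((r ^ u - r ^ (u + γ) : ℝ) : ℂ) := by
    push_cast
    ring
  rw [e, norm_mul, norm_ofReal_one_sub h1, norm_div, norm_mul, norm_mul, hζ1, one_mul,
    Complex.norm_real, Real.norm_of_nonneg (by linarith)]
  have hnum : r ^ u - r ^ (u + γ) ≤ γ * (1 - r) * r ^ u := by
    have := one_add_mul_le_pow (a := r - 1) (by linarith) γ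
    rw [show 1 + (r - 1) = r by ring] at this
    rw [pow_add]
    nlinarith
  have hden : (1 - r ^ u) ^ 2 ≤ ‖1 - ζ * (r ^ u : ℝ)‖ * ‖1 - ζ * (r ^ (u + γ) : ℝ)‖ := by
    rw [pow_two]
    exact mul_le_mul n1 (by linarith) (by linarith) (norm_nonneg _)
  have hpos : 0 < (1 - r ^ u) ^ 2 := by
    have : 0 < 1 - r ^ u := by linarith
    positivity
  calc (1 - r) * ((r ^ u - r ^ (u + γ)) / (‖1 - ζ * (r ^ u : ℝ)‖ * ‖1 - ζ * (r ^ (u + γ) : ℝ)‖))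
      ≤ (1 - r) * (γ * (1 - r) * r ^ u / (1 - r ^ u) ^ 2) := by
        refine mul_le_mul_of_nonneg_left ?_ hr.le
        exact div_le_div₀ (by positivity) hnum hpos hden
    _ = γ * ((1 - r) ^ 2 * (r ^ u / (1 - r ^ u) ^ 2)) := by ring
    _ ≤ γ * (C / (u ^ 2 * (1 + u * (1 - r)))) :=
        mul_le_mul_of_nonneg_left (h r h0 h1 u hu) (by positivity)
    _ ≤ γ * (C / u ^ 2) := by
        refine mul_le_mul_of_nonneg_left ?_ (by positivity)
        refine div_le_div_of_nonneg_left hC (by positivity) ?_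
        refine le_mul_of_one_le_right (by positivity) ?_
        have : 0 ≤ (u : ℝ) * (1 - r) := by positivity
        linarith
    _ = γ * C * (u : ℝ) ^ (-2 : ℝ) := by
        rw [Real.rpow_neg (by linarith), mul_div_assoc']
        norm_cast

/-- Only γ terms separate the two sums, each being O(u⁻¹ · u^(1/4)). -/
theorem scaledSum_shift_bound (w : Word N) (γ : ℕ) : ∃ C : ℝ, 0 ≤ C ∧ ∀ r : ℝ, 0 < r →
    r < 1 → ∀ u : ℕ, 0 < u → ‖scaledSum w r u - scaledSum w r (u + γ)‖ ≤
      C * (u : ℝ) ^ (-(3 / 4) : ℝ) := by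
  cases w with
  | nil => exact ⟨0, le_rfl, fun r _ _ u _ => by simp [scaledSum_nil]⟩
  | cons b w =>
    obtain ⟨C, hC, h⟩ := scaled_bound' b
    obtain ⟨D, hD, h'⟩ := scaledSum_bound w
    refine ⟨γ * (C * D), by positivity, fun r h0 h1 u hu => ?_⟩
    have hu' : (1 : ℝ) ≤ u := by exact_mod_cast hu
    rw [scaledSum_cons b w h0 h1, scaledSum_cons b w h0 h1, Finset.sum_range_add, norm_sub_rev,
      add_sub_cancel_left]
    have key : ∀ j ∈ Finset.range γ, ‖scaled b r (u + j) * scaledSum w r (u + j)‖ ≤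
        C * D * (u : ℝ) ^ (-(3 / 4) : ℝ) := by
      intro j _
      have hj : (u : ℝ) ≤ ((u + j : ℕ) : ℝ) := by exact_mod_cast Nat.le_add_right u j
      have hj1 : (1 : ℝ) ≤ ((u + j : ℕ) : ℝ) := hu'.trans hj
      have b1 : ‖scaled b r (u + j)‖ ≤ C * ((u + j : ℕ) : ℝ) ^ (-1 : ℝ) := by
        refine (h r h0 h1 (u + j) (by omega)).trans ?_
        rw [Real.rpow_neg_one, ← div_eq_mul_inv]
        exact div_le_div_of_nonneg_left hC (by linarith) (le_self_pow₀ hj1 b.1.ne_zero)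
      rw [norm_mul]
      calc ‖scaled b r (u + j)‖ * ‖scaledSum w r (u + j)‖
          ≤ C * ((u + j : ℕ) : ℝ) ^ (-1 : ℝ) * (D * ((u + j : ℕ) : ℝ) ^ (1 / 4 : ℝ)) :=
            mul_le_mul b1 (h' r h0 h1 _ (by omega)) (norm_nonneg _) (by positivity)
        _ = C * D * (((u + j : ℕ) : ℝ) ^ (-1 : ℝ) * ((u + j : ℕ) : ℝ) ^ (1 / 4 : ℝ)) := by ring
        _ = C * D * ((u + j : ℕ) : ℝ) ^ (-(3 / 4) : ℝ) := by
          rw [← Real.rpow_add (by linarith)]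
          norm_num
        _ ≤ C * D * (u : ℝ) ^ (-(3 / 4) : ℝ) := by
          refine mul_le_mul_of_nonneg_left ?_ (by positivity)
          exact Real.rpow_le_rpow_of_nonpos (by linarith) hj (by norm_num)
    refine (norm_sum_le _ _).trans ((Finset.sum_le_card_nsmul _ _ _ key).trans (le_of_eq ?_))
    rw [Finset.card_range, nsmul_eq_mul]
    ring

/-- After the shift, the difference of two series with s₁ = 1 is dominated by u^(-7/4), so
`tsum_rate` applies although each of them diverges in the limit. -/
theorem shift_rate [NeZero N] (α : ZMod N) (γ : ℕ) (w : Word N) :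
    Small fun r => ((1 - r : ℝ) : ℂ) ^ (weight w + 1) * (ev (zpt N r) (bracket ((1, α) :: w)) -
      ev (zpt N r) (bracket ((1, α + (γ : ZMod N)) :: w))) -
      (∑' u : ℕ, (if u = 0 then 0 else scaledLim ((1, α) : Letter N) u * hsum w u -
        scaledLim ((1, α + (γ : ZMod N)) : Letter N) (u + γ) * hsum w (u + γ)) -
        ∑ u ∈ Finset.range (γ + 1),
          scaledLim ((1, α + (γ : ZMod N)) : Letter N) u * hsum w u) := by
  set a : Letter N := (1, α) with ha
  set b : Letter N := (1, α + (γ : ZMod N)) with hb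
  obtain ⟨C₁, hC₁, h1⟩ := scaled_shift_bound α γ
  obtain ⟨C₂, hC₂, h2⟩ := scaledSum_bound w
  obtain ⟨C₃, hC₃, h3⟩ := scaled_bound' b
  obtain ⟨C₄, hC₄, h4⟩ := scaledSum_shift_bound w γ
  obtain ⟨C₅, K, hC₅, h5⟩ := term_rate a w
  obtain ⟨C₆, K', hC₆, h6⟩ := term_rate b w
  set x : ℝ → ℕ → ℂ := fun r u => if u = 0 then 0 else
    scaled a r u * scaledSum w r u - scaled b r (u + γ) * scaledSum w r (u + γ) with hx
  set x₀ : ℕ → ℂ := fun u => if u = 0 then 0 else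
    scaledLim a u * hsum w u - scaledLim b (u + γ) * hsum w (u + γ) with hx₀
  have bx : ∀ r : ℝ, 0 < r → r < 1 → ∀ u : ℕ,
      ‖x r u‖ ≤ (C₁ * C₂ + C₃ * C₄) * (u : ℝ) ^ (-(7 / 4) : ℝ) := by
    intro r hr0 hr1 u
    simp only [hx]
    split_ifs with hu
    · rw [norm_zero]
      positivity
    have hu0 : 0 < u := Nat.pos_of_ne_zero hu
    have hu' : (1 : ℝ) ≤ u := by exact_mod_cast hu0
    -- The outer letter is shifted first, with bound u⁻² · u^(1/4), and then the inner sum, with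
    -- bound u⁻¹ · u^(-3/4).
    have e : scaled a r u * scaledSum w r u - scaled b r (u + γ) * scaledSum w r (u + γ) =
        (scaled a r u - scaled b r (u + γ)) * scaledSum w r u +
          scaled b r (u + γ) * (scaledSum w r u - scaledSum w r (u + γ)) := by ring
    have b1 : ‖(scaled a r u - scaled b r (u + γ)) * scaledSum w r u‖ ≤
        C₁ * C₂ * (u : ℝ) ^ (-(7 / 4) : ℝ) := by
      rw [norm_mul]
      calc _ ≤ C₁ * (u : ℝ) ^ (-2 : ℝ) * (C₂ * (u : ℝ) ^ (1 / 4 : ℝ)) :=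
            mul_le_mul (h1 r hr0 hr1 u hu0) (h2 r hr0 hr1 u hu0) (norm_nonneg _) (by positivity)
        _ = C₁ * C₂ * ((u : ℝ) ^ (-2 : ℝ) * (u : ℝ) ^ (1 / 4 : ℝ)) := by ring
        _ = _ := by
          rw [← Real.rpow_add (by linarith)]
          norm_num
    have b2 : ‖scaled b r (u + γ)‖ ≤ C₃ * (u : ℝ) ^ (-1 : ℝ) := by
      refine (h3 r hr0 hr1 (u + γ) (by omega)).trans ?_
      rw [Real.rpow_neg_one, ← div_eq_mul_inv]
      refine div_le_div_of_nonneg_left hC₃ (by linarith) ?_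
      simp only [hb, PNat.one_coe, pow_one]
      exact_mod_cast Nat.le_add_right u γ
    have b3 : ‖scaled b r (u + γ) * (scaledSum w r u - scaledSum w r (u + γ))‖ ≤
        C₃ * C₄ * (u : ℝ) ^ (-(7 / 4) : ℝ) := by
      rw [norm_mul]
      calc _ ≤ C₃ * (u : ℝ) ^ (-1 : ℝ) * (C₄ * (u : ℝ) ^ (-(3 / 4) : ℝ)) :=
            mul_le_mul b2 (h4 r hr0 hr1 u hu0) (norm_nonneg _) (by positivity)
        _ = C₃ * C₄ * ((u : ℝ) ^ (-1 : ℝ) * (u : ℝ) ^ (-(3 / 4) : ℝ)) := by ring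
        _ = _ := by
          rw [← Real.rpow_add (by linarith)]
          norm_num
    rw [e, add_mul]
    exact (norm_add_le _ _).trans (add_le_add b1 b3)
  have bd : ∀ r : ℝ, 0 < r → r < 1 → ∀ u : ℕ,
      ‖x r u - x₀ u‖ ≤ (C₅ + C₆ * (1 + γ) ^ K') * (1 - r) * (u : ℝ) ^ (K + K') := by
    intro r hr0 hr1 u
    have hr : 0 < 1 - r := by linarith
    simp only [hx, hx₀]
    split_ifs with hu
    · rw [sub_zero, norm_zero]
      positivity
    have hu0 : 0 < u := Nat.pos_of_ne_zero hu
    have hu' : (1 : ℝ) ≤ u := by exact_mod_cast hu0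
    rw [sub_sub_sub_comm]
    have b1 : (u : ℝ) ^ K ≤ (u : ℝ) ^ (K + K') := pow_le_pow_right₀ hu' (by omega)
    have b2 : ((u + γ : ℕ) : ℝ) ^ K' ≤ (1 + γ) ^ K' * (u : ℝ) ^ (K + K') := by
      calc ((u + γ : ℕ) : ℝ) ^ K' ≤ ((1 + γ) * u) ^ K' := by
            refine pow_le_pow_left₀ (by positivity) ?_ _
            push_cast
            have : (0 : ℝ) ≤ γ := by positivity
            nlinarith
        _ = (1 + γ) ^ K' * (u : ℝ) ^ K' := mul_pow _ _ _
        _ ≤ _ := by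
            refine mul_le_mul_of_nonneg_left (pow_le_pow_right₀ hu' (by omega)) (by positivity)
    calc _ ≤ C₅ * (1 - r) * (u : ℝ) ^ K + C₆ * (1 - r) * ((u + γ : ℕ) : ℝ) ^ K' :=
          (norm_sub_le _ _).trans (add_le_add (h5 r hr0 hr1 u) (h6 r hr0 hr1 (u + γ)))
      _ ≤ C₅ * (1 - r) * (u : ℝ) ^ (K + K') +
          C₆ * (1 - r) * ((1 + γ) ^ K' * (u : ℝ) ^ (K + K')) := by gcongr
      _ = _ := by ring
  obtain ⟨s1, s2, hsmall⟩ := tsum_rate (by positivity) (by positivity) bx bd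
  have hsmall' : Small fun r => ∑' u, x r u - ∑' u, x₀ u := hsmall
  have hbd : Small fun r => ∑ u ∈ Finset.range (γ + 1),
      (scaled b r u * scaledSum w r u - scaledLim b u * hsum w u) := by
    refine Small.sum _ fun u _ => small_of_linear (C := C₆ * (u : ℝ) ^ K') fun r hr0 hr1 => ?_
    refine (h6 r hr0 hr1 u).trans (le_of_eq ?_)
    ring
  refine (hsmall'.sub hbd).congr fun r hr0 hr1 => ?_
  have hp := tendsto_scaledSum (a :: w) hr0 hr1
  have hq := tendsto_scaledSum (b :: w) hr0 hr1
  simp only [scaledSum_cons _ w hr0 hr1] at hp hq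
  have key := tsum_shift_eq (γ := γ) (by simp [scaled_zero]) hp hq (s1 r hr0 hr1)
  have wa : weight (a :: w) = weight w + 1 := by
    rw [weight_cons, ha, PNat.one_coe, add_comm]
  have wb : weight (b :: w) = weight w + 1 := by
    rw [weight_cons, hb, PNat.one_coe, add_comm]
  rw [wa, wb] at key
  rw [mul_sub, key, Finset.sum_sub_distrib]
  ring

theorem hsum_add_eq (a : Letter N) (w : Word N) {u γ : ℕ}
    (h : ∀ j < γ, ((u + j : ℕ) : ZMod N) ≠ a.2) : hsum (a :: w) (u + γ) = hsum (a :: w) u := by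
  rw [hsum_cons, hsum_cons, Finset.sum_range_add, add_eq_left]
  refine Finset.sum_eq_zero fun j hj => ?_
  rw [scaledLim, if_neg (fun h' => h j (Finset.mem_range.1 hj) h'.2), zero_mul]

theorem hsum_cons_zero (a : Letter N) (w : Word N) : hsum (a :: w) 0 = 0 := by
  simp [hsum_cons]

theorem scaledLim_one (b : ZMod N) (u : ℕ) :
    scaledLim ((1, b) : Letter N) u = if 0 < u ∧ (u : ZMod N) = b then 1 / (u : ℂ) else 0 := by
  simp [scaledLim]

theorem eq_val_of_natCast_eq {b : ZMod N} {u : ℕ} (hu : u < N) (h : (u : ZMod N) = b) :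
    u = b.val := by
  rw [← h, ZMod.val_cast_of_lt hu]

/-- The paired indices are a positive multiple of N and that multiple plus β; the one unpaired index
is β itself and yields the term -1/β. -/
theorem gam_limit_nil [NeZero N] {β : ZMod N} (hβ : β ≠ 0) :
    ∑' u : ℕ, (if u = 0 then 0 else scaledLim ((1, 0) : Letter N) u * hsum ([] : Word N) u -
      scaledLim ((1, β) : Letter N) (u + β.val) * hsum ([] : Word N) (u + β.val)) -
      ∑ u ∈ Finset.range (β.val + 1), scaledLim ((1, β) : Letter N) u * hsum ([] : Word N) u =
    Gam β [] := by
  have hN : 0 < N := Nat.pos_of_ne_zero (NeZero.ne N)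
  have hv : β.val < N := ZMod.val_lt β
  have hv0 : 0 < β.val := Nat.pos_of_ne_zero fun h => hβ ((ZMod.val_eq_zero β).1 h)
  simp only [hsum, mul_one, Gam, if_neg hβ, scaledLim_one]
  have hb : ∑ u ∈ Finset.range (β.val + 1),
      (if 0 < u ∧ (u : ZMod N) = β then 1 / (u : ℂ) else 0) = 1 / (β.val : ℂ) := by
    rw [Finset.sum_eq_single β.val]
    · rw [if_pos ⟨hv0, ZMod.natCast_zmod_val β⟩]
    · intro u hu hne
      refine if_neg fun h => hne (eq_val_of_natCast_eq ?_ h.2)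
      have := Finset.mem_range.1 hu
      omega
    · intro h
      simp at h
  have hinj : Function.Injective fun n : ℕ => (n + 1) * N := by
    intro m n h
    have := Nat.eq_of_mul_eq_mul_right hN h
    omega
  have hmult : ∀ u : ℕ, 0 < u ∧ (u : ZMod N) = 0 → u ∈ Set.range fun n : ℕ => (n + 1) * N := by
    rintro u ⟨hu, h⟩
    obtain ⟨m, hm⟩ := (ZMod.natCast_eq_zero_iff u N).1 h
    have hm0 : m ≠ 0 := by
      rintro rfl
      omega
    refine ⟨m - 1, ?_⟩
    simp only
    rw [Nat.sub_add_cancel (Nat.pos_of_ne_zero hm0), hm, mul_comm]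
  rw [hb, ← hinj.tsum_eq, sub_eq_neg_add]
  · congr 1
    refine tsum_congr fun n => ?_
    have h1 : (n + 1) * N ≠ 0 := by positivity
    have h2 : (((n + 1) * N : ℕ) : ZMod N) = 0 := by simp
    rw [if_neg h1, if_pos ⟨Nat.pos_of_ne_zero h1, h2⟩, if_pos]
    · push_cast
      ring
    · refine ⟨by omega, ?_⟩
      rw [Nat.cast_add, h2, zero_add, ZMod.natCast_zmod_val]
  · intro u hu
    by_contra hr
    apply hu
    simp only
    split_ifs with h0 h1 h2 h2
    · rfl
    · exact absurd (hmult u h1) hr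
    · exact absurd (hmult u h1) hr
    · refine absurd ⟨Nat.pos_of_ne_zero h0, ?_⟩ h1
      have := h2.2
      rw [Nat.cast_add, ZMod.natCast_zmod_val] at this
      simpa using this
    · simp

/-- If β ≤ α₁, no integer congruent to α₁ lies in [u, u+β) for a multiple u of N, so both inner sums
agree and factor out. The unpaired terms vanish because the inner sum up to β is empty. -/
theorem gam_limit_le [NeZero N] {β : ZMod N} (hβ : β ≠ 0) (a : Letter N) (w : Word N)
    (hle : β.val ≤ a.2.val) :
    ∑' u : ℕ, (if u = 0 then 0 else scaledLim ((1, 0) : Letter N) u * hsum (a :: w) u -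
      scaledLim ((1, β) : Letter N) (u + β.val) * hsum (a :: w) (u + β.val)) -
      ∑ u ∈ Finset.range (β.val + 1), scaledLim ((1, β) : Letter N) u * hsum (a :: w) u =
    Gam β (a :: w) := by
  have hv : β.val < N := ZMod.val_lt β
  have ha : a.2.val < N := ZMod.val_lt a.2
  have hv0 : 0 < β.val := Nat.pos_of_ne_zero fun h => hβ ((ZMod.val_eq_zero β).1 h)
  have hshift : ∀ u : ℕ, (u : ZMod N) = 0 → hsum (a :: w) (u + β.val) = hsum (a :: w) u := by
    intro u hu
    refine hsum_add_eq a w fun j hj h => ?_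
    rw [Nat.cast_add, hu, zero_add] at h
    have := eq_val_of_natCast_eq (by omega) h
    omega
  have hb : ∑ u ∈ Finset.range (β.val + 1), scaledLim ((1, β) : Letter N) u * hsum (a :: w) u
      = 0 := by
    refine Finset.sum_eq_zero fun u hu => ?_
    rw [scaledLim_one]
    split_ifs with h
    · have h1 : u = β.val := eq_val_of_natCast_eq (by
        have := Finset.mem_range.1 hu
        omega) h.2
      have h2 := hshift 0 (by simp)
      rw [zero_add, hsum_cons_zero] at h2
      rw [h1, h2, mul_zero]
    · rw [zero_mul]
  rw [hb, sub_zero]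
  simp only [Gam, if_neg hβ, if_pos hle]
  refine tsum_congr fun u => ?_
  by_cases hu : u = 0
  · subst hu
    simp [hsum_cons_zero]
  rw [if_neg hu, scaledLim_one, scaledLim_one]
  by_cases hd : N ∣ u
  · have h0 : (u : ZMod N) = 0 := (ZMod.natCast_eq_zero_iff u N).2 hd
    rw [if_pos ⟨Nat.pos_of_ne_zero hu, h0⟩, if_pos, if_pos hd, hshift u h0]
    · push_cast
      ring
    · refine ⟨by omega, ?_⟩
      rw [Nat.cast_add, h0, zero_add, ZMod.natCast_zmod_val]
  · have h0 : (u : ZMod N) ≠ 0 := fun h => hd ((ZMod.natCast_eq_zero_iff u N).1 h)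
    rw [if_neg (fun h => h0 h.2), if_neg, if_neg hd]
    · ring
    · rintro ⟨-, h⟩
      rw [Nat.cast_add, ZMod.natCast_zmod_val] at h
      exact h0 (by simpa using h)

/-- If α₁ < β, the interval from u up to u + β does meet the class of α₁. One shifts instead from u
≡ β up to the next multiple of N; the interval passed over avoids the class of α₁. In terms of that
multiple n₀ the other index is n₀ + β - N, which explains β' = β - N and the sign. -/
theorem gam_limit_gt [NeZero N] {β : ZMod N} (hβ : β ≠ 0) (a : Letter N) (w : Word N)
    (hgt : a.2.val < β.val) :
    ∑' u : ℕ, (if u = 0 then 0 else scaledLim ((1, β) : Letter N) u * hsum (a :: w) u -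
      scaledLim ((1, 0) : Letter N) (u + (N - β.val)) * hsum (a :: w) (u + (N - β.val))) -
      ∑ u ∈ Finset.range (N - β.val + 1), scaledLim ((1, 0) : Letter N) u * hsum (a :: w) u =
    -Gam β (a :: w) := by
  have hv : β.val < N := ZMod.val_lt β
  have ha : a.2.val < N := ZMod.val_lt a.2
  have hv0 : 0 < β.val := by omega
  set γ := N - β.val with hγ
  have hγβ : (γ : ZMod N) + β = 0 := by
    have : ((γ + β.val : ℕ) : ZMod N) = 0 := by
      rw [hγ, Nat.sub_add_cancel hv.le, ZMod.natCast_self]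
    rwa [Nat.cast_add, ZMod.natCast_zmod_val] at this
  have hiff : ∀ u : ℕ, N ∣ u + γ ↔ (u : ZMod N) = β := by
    intro u
    rw [← ZMod.natCast_eq_zero_iff, Nat.cast_add, eq_neg_of_add_eq_zero_left hγβ]
    constructor
    · intro h
      linear_combination h
    · intro h
      rw [h]
      ring
  have hshift : ∀ u : ℕ, (u : ZMod N) = β → hsum (a :: w) (u + γ) = hsum (a :: w) u := by
    intro u hu
    refine hsum_add_eq a w fun j hj h => ?_
    have h1 : ((β.val + j : ℕ) : ZMod N) = a.2 := by
      rw [Nat.cast_add, ZMod.natCast_zmod_val, ← hu, ← Nat.cast_add]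
      exact h
    have := eq_val_of_natCast_eq (by omega) h1
    omega
  have hb : ∑ u ∈ Finset.range (γ + 1), scaledLim ((1, 0) : Letter N) u * hsum (a :: w) u
      = 0 := by
    refine Finset.sum_eq_zero fun u hu => ?_
    rw [scaledLim_one, if_neg, zero_mul]
    rintro ⟨h1, h2⟩
    have h3 := eq_val_of_natCast_eq (by
      have := Finset.mem_range.1 hu
      omega) h2
    rw [ZMod.val_zero] at h3
    omega
  have hinj : Function.Injective fun u : ℕ => u + γ := add_left_injective γ
  rw [hb, sub_zero]
  simp only [Gam, if_neg hβ, if_neg (not_le.2 hgt)]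
  -- Reindexing by n = u + γ drops only n < γ; among these only n = 0 is a multiple of N, and its
  -- inner sum is empty.
  rw [← hinj.tsum_eq (f := fun n : ℕ => if N ∣ n then
    (1 / (n : ℂ) - 1 / ((β.val : ℂ) - N + n)) * hsum (a :: w) n else 0), ← tsum_neg]
  · refine tsum_congr fun u => ?_
    by_cases hu : (u : ZMod N) = β
    · have hu0 : u ≠ 0 := by
        rintro rfl
        exact hβ (by simpa using hu.symm)
      rw [if_neg hu0, if_pos ((hiff u).2 hu), scaledLim_one, scaledLim_one,
        if_pos ⟨Nat.pos_of_ne_zero hu0, hu⟩, if_pos ⟨by omega,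
          (ZMod.natCast_eq_zero_iff _ N).2 ((hiff u).2 hu)⟩, hshift u hu]
      have e : (β.val : ℂ) - N + ((u + γ : ℕ) : ℂ) = u := by
        rw [hγ, Nat.cast_add, Nat.cast_sub hv.le]
        ring
      rw [e]
      ring
    · have h1 : scaledLim ((1, β) : Letter N) u = 0 := by
        rw [scaledLim_one]
        exact if_neg fun h => hu h.2
      have h2 : scaledLim ((1, 0) : Letter N) (u + γ) = 0 := by
        rw [scaledLim_one]
        exact if_neg fun h => hu ((hiff u).1 ((ZMod.natCast_eq_zero_iff _ N).1 h.2))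
      have h3 : ¬ N ∣ u + γ := fun h => hu ((hiff u).1 h)
      simp [h1, h2, h3]
  · intro n hn
    by_contra hr
    apply hn
    have hlt : n < γ := by
      by_contra h
      exact hr ⟨n - γ, by simp only; omega⟩
    simp only
    split_ifs with hd
    · have : n = 0 := by
        by_contra h0
        have := Nat.le_of_dvd (Nat.pos_of_ne_zero h0) hd
        omega
      rw [this, hsum_cons_zero, mul_zero]
    · rfl

theorem gam_rate [NeZero N] (β : ZMod N) (w : Word N) :
    Small fun r => ((1 - r : ℝ) : ℂ) ^ (weight w + 1) * ev (zpt N r) (gser β w) - Gam β w := by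
  by_cases hβ : β = 0
  · refine small_zero.congr fun r _ _ => ?_
    simp [hβ, gser, Gam, ev_zero]
  have hev : ∀ r : ℝ, 0 < r → r < 1 → ev (zpt N r) (gser β w) =
      ev (zpt N r) (bracket ((1, 0) :: w)) - ev (zpt N r) (bracket ((1, β) :: w)) := by
    intro r h0 h1
    rw [gser, ev_sub (conv_bracket _) (conv_bracket _) (norm_zpt_lt h0 h1)]
  have e1 : (0 : ZMod N) + (β.val : ZMod N) = β := by simp
  have e2 : β + ((N - β.val : ℕ) : ZMod N) = 0 := by
    have : ((β.val + (N - β.val) : ℕ) : ZMod N) = 0 := by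
      rw [Nat.add_sub_cancel' (ZMod.val_lt β).le, ZMod.natCast_self]
    rwa [Nat.cast_add, ZMod.natCast_zmod_val] at this
  have hup := shift_rate (0 : ZMod N) β.val w
  rw [e1] at hup
  cases w with
  | nil =>
    rw [gam_limit_nil hβ] at hup
    exact hup.congr fun r h0 h1 => by rw [hev r h0 h1]
  | cons a w =>
    by_cases hle : β.val ≤ a.2.val
    · rw [gam_limit_le hβ a w hle] at hup
      exact hup.congr fun r h0 h1 => by rw [hev r h0 h1]
    · have hdown := shift_rate β (N - β.val) (a :: w)
      rw [e2, gam_limit_gt hβ a w (not_le.1 hle)] at hdown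
      refine hdown.neg.congr fun r h0 h1 => ?_
      rw [hev r h0 h1]
      ring

end Gamma

/-! ### Expansions in powers of `(1 - r) t_N` -/

section Expansion

variable {N : ℕ} [NeZero N]

/-- The scaled value of `t_N` at `r η⁻¹`. -/
def tval (N : ℕ) [NeZero N] (r : ℝ) : ℂ := ((1 - r : ℝ) : ℂ) * ev (zpt N r) (tN N)

theorem conv_tN : Conv (tN N) := Conv.sum _ fun _ _ => conv_bracket _

theorem tendsto_tval {r : ℝ} (h0 : 0 < r) (h1 : r < 1) :
    Filter.Tendsto (fun M => ∑ u ∈ Finset.range M, ∑ α : ZMod N, scaled ((1, α) : Letter N) r u)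
      Filter.atTop (𝓝 (tval N r)) := by
  have e : tval N r = ∑ α : ZMod N, ((1 - r : ℝ) : ℂ) ^ weight [((1, α) : Letter N)] *
      ev (zpt N r) (bracket [((1, α) : Letter N)]) := by
    rw [tval, tN, ev_sum _ (fun α _ => conv_bracket _) (norm_zpt_lt h0 h1), Finset.mul_sum]
    simp [weight]
  rw [e]
  have h := tendsto_finsetSum (Finset.univ : Finset (ZMod N)) fun α _ =>
    tendsto_scaledSum [((1, α) : Letter N)] h0 h1
  refine h.congr fun M => ?_
  simp only [scaledSum_cons _ _ h0 h1, scaledSum_nil, mul_one]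
  rw [Finset.sum_comm]

/-- The letters of weight one are O(1/(u(1+t))) with t = u(1-r), and t^ε ≤ 1 + t. This turns part of
the decay in t into summability over u at the price of (1-r)^(-ε). -/
theorem tval_bound {ε : ℝ} (hε : 0 < ε) (hε1 : ε ≤ 1) : ∃ C : ℝ, 0 ≤ C ∧ ∀ r : ℝ, 0 < r → r < 1 →
    ‖tval N r‖ ≤ C * (1 - r) ^ (-ε) := by
  choose C hC h using fun α : ZMod N => scaled_bound ((1, α) : Letter N)
  have hs : Summable fun u : ℕ => (u : ℝ) ^ (-1 - ε) := Real.summable_nat_rpow.2 (by linarith)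
  set S := ∑' u : ℕ, (u : ℝ) ^ (-1 - ε) with hS
  have hS0 : 0 ≤ S := tsum_nonneg fun u => by positivity
  refine ⟨(∑ α, C α) * S, mul_nonneg (Finset.sum_nonneg fun α _ => hC α) hS0, fun r h0 h1 => ?_⟩
  have hr : 0 < 1 - r := by linarith
  refine le_of_tendsto (tendsto_tval h0 h1).norm (Filter.Eventually.of_forall fun M => ?_)
  have key : ∀ u ∈ Finset.range M, ‖∑ α : ZMod N, scaled ((1, α) : Letter N) r u‖ ≤
      (∑ α, C α) * (1 - r) ^ (-ε) * (u : ℝ) ^ (-1 - ε) := by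
    intro u _
    rcases Nat.eq_zero_or_pos u with rfl | hu
    · simp only [scaled_zero, Finset.sum_const_zero, norm_zero]
      have := Finset.sum_nonneg fun α (_ : α ∈ Finset.univ) => hC α
      positivity
    have hu' : (1 : ℝ) ≤ u := by exact_mod_cast hu
    refine (norm_sum_le _ _).trans ?_
    rw [mul_assoc, Finset.sum_mul]
    refine Finset.sum_le_sum fun α _ => ?_
    refine (h α r h0 h1 u hu).trans ?_
    set t : ℝ := u * (1 - r) with ht
    have ht0 : 0 < t := by positivity
    have h2 : t ^ ε ≤ 1 + t := by
      rcases le_total t 1 with h3 | h3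
      · have := Real.rpow_le_one ht0.le h3 hε.le
        linarith
      · have := Real.rpow_le_rpow_of_exponent_le h3 hε1
        rw [Real.rpow_one] at this
        linarith
    have h4 : (1 - r) ^ (-ε) * (u : ℝ) ^ (-1 - ε) = 1 / (u * t ^ ε) := by
      rw [ht, Real.mul_rpow (by positivity) hr.le, Real.rpow_neg hr.le,
        Real.rpow_sub (by linarith), Real.rpow_neg_one]
      field_simp
    rw [h4]
    simp only [PNat.one_coe, pow_one]
    rw [mul_one_div]
    exact div_le_div_of_nonneg_left (hC α) (by positivity) (by gcongr)
  refine (norm_sum_le _ _).trans ((Finset.sum_le_sum key).trans ?_)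
  rw [← Finset.mul_sum]
  have h5 : ∑ u ∈ Finset.range M, (u : ℝ) ^ (-1 - ε) ≤ S :=
    hs.sum_le_tsum _ fun u _ => by positivity
  have h6 : 0 ≤ (∑ α, C α) * (1 - r) ^ (-ε) :=
    mul_nonneg (Finset.sum_nonneg fun α _ => hC α) (by positivity)
  calc _ ≤ (∑ α, C α) * (1 - r) ^ (-ε) * S := mul_le_mul_of_nonneg_left h5 h6
    _ = _ := by ring

/-- The residue α ≡ u gives a real term at least r^u/u, by Bernoulli's inequality 1 - r^u ≤ u(1-r);
the other residues are of size (1-r) r^u, since their phases stay away from 1. -/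
theorem re_sum_scaled_ge : ∃ C : ℝ, 0 ≤ C ∧ ∀ r : ℝ, 0 < r → r < 1 → ∀ u : ℕ, 0 < u →
    r ^ u / u - C * ((1 - r) * r ^ u) ≤ (∑ α : ZMod N, scaled ((1, α) : Letter N) r u).re := by
  obtain ⟨C, hC, h⟩ := exists_phase_bound N
  refine ⟨N * (2 * C), by positivity, fun r h0 h1 u hu => ?_⟩
  have hu' : (1 : ℝ) ≤ u := by exact_mod_cast hu
  have hr : 0 < 1 - r := by linarith
  have hru : r ^ u < 1 := pow_lt_one₀ h0.le h1 hu.ne'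
  have hru0 : 0 < r ^ u := by positivity
  rw [← Finset.add_sum_erase _ _ (Finset.mem_univ (u : ZMod N)), Complex.add_re]
  have b1 : r ^ u / u ≤ (scaled ((1, (u : ZMod N)) : Letter N) r u).re := by
    rw [scaled_one_eq _ r hu, yval_eq _ h0 h1 hu, phase_eq_one rfl]
    have e : ((1 - r : ℝ) : ℂ) * (1 * (r ^ u : ℝ) / (1 - 1 * (r ^ u : ℝ))) =
        (((1 - r) * (r ^ u / (1 - r ^ u)) : ℝ) : ℂ) := by
      push_cast
      ring
    rw [e, Complex.ofReal_re, mul_div_assoc', div_le_div_iff₀ (by linarith) (by linarith)]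
    have := one_add_mul_le_pow (a := r - 1) (by linarith) u
    rw [show 1 + (r - 1) = r by ring] at this
    nlinarith
  have b2 : ∀ α ∈ Finset.univ.erase (u : ZMod N),
      ‖scaled ((1, α) : Letter N) r u‖ ≤ 2 * C * ((1 - r) * r ^ u) := by
    intro α hα
    have hne : (u : ZMod N) ≠ α := fun h => (Finset.ne_of_mem_erase hα) h.symm
    rw [scaled_one_eq _ r hu, yval_eq _ h0 h1 hu, norm_mul, norm_ofReal_one_sub h1, norm_div,
      norm_mul, norm_phase, one_mul, Complex.norm_real, Real.norm_of_nonneg hru0.le]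
    have h2 := h α u hne
    have h3 := norm_one_sub_le (norm_phase α u) hru0.le hru.le
    have h4 : 1 ≤ 2 * C * ‖1 - phase α u * (r ^ u : ℝ)‖ := by nlinarith
    have h5 : 0 < ‖1 - phase α u * (r ^ u : ℝ)‖ := by
      have := one_sub_le_norm (norm_phase α u) hru0.le
      linarith
    have h6 : r ^ u / ‖1 - phase α u * (r ^ u : ℝ)‖ ≤ 2 * C * r ^ u := by
      rw [div_le_iff₀ h5]
      nlinarith
    calc (1 - r) * (r ^ u / ‖1 - phase α u * (r ^ u : ℝ)‖) ≤ (1 - r) * (2 * C * r ^ u) := by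
          gcongr
      _ = _ := by ring
  have b3 : ‖∑ α ∈ Finset.univ.erase (u : ZMod N), scaled ((1, α) : Letter N) r u‖ ≤
      N * (2 * C) * ((1 - r) * r ^ u) := by
    refine (norm_sum_le _ _).trans ((Finset.sum_le_card_nsmul _ _ _ b2).trans ?_)
    rw [nsmul_eq_mul, mul_assoc (N : ℝ)]
    refine mul_le_mul_of_nonneg_right ?_ (by positivity)
    have := Finset.card_erase_le (s := Finset.univ) (a := (u : ZMod N))
    rw [Finset.card_univ, ZMod.card] at this
    exact_mod_cast this
  have b4 := (abs_le.1 (Complex.abs_re_le_norm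
    (∑ α ∈ Finset.univ.erase (u : ZMod N), scaled ((1, α) : Letter N) r u))).1
  linarith

/-- The errors (1-r) r^u sum to at most 1, whence a constant independent of r and U. The terms
beyond U in the main sum are positive and may be dropped. -/
theorem tval_ge : ∃ C : ℝ, ∀ r : ℝ, 0 < r → r < 1 → ∀ U : ℕ,
    ∑ i ∈ Finset.range U, r ^ (i + 1) * (1 / ((i : ℝ) + 1)) - C ≤ ‖tval N r‖ := by
  obtain ⟨C, hC, h⟩ := re_sum_scaled_ge (N := N)
  refine ⟨C, fun r h0 h1 U => le_trans ?_ (Complex.re_le_norm _)⟩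
  have hr : 0 < 1 - r := by linarith
  have hre := (Complex.continuous_re.tendsto _).comp (tendsto_tval (N := N) h0 h1)
  refine ge_of_tendsto hre ?_
  filter_upwards [Filter.eventually_ge_atTop (U + 1)] with M hM
  obtain ⟨m, rfl⟩ : ∃ m, M = m + 1 := ⟨M - 1, by omega⟩
  rw [Function.comp_apply, Finset.sum_range_succ', Complex.add_re, Complex.re_sum]
  simp only [scaled_zero, Finset.sum_const_zero, Complex.zero_re, add_zero]
  have h2 : ∑ i ∈ Finset.range m, (r ^ (i + 1) * (1 / ((i : ℝ) + 1)) - C * ((1 - r) * r ^ (i + 1)))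
      ≤ ∑ i ∈ Finset.range m, (∑ α : ZMod N, scaled ((1, α) : Letter N) r (i + 1)).re := by
    refine Finset.sum_le_sum fun i _ => ?_
    have := h r h0 h1 (i + 1) (Nat.succ_pos i)
    rw [Nat.cast_add, Nat.cast_one, ← mul_one_div] at this
    exact this
  refine le_trans ?_ h2
  rw [Finset.sum_sub_distrib, ← Finset.mul_sum, ← Finset.mul_sum]
  have h3 : ∑ i ∈ Finset.range U, r ^ (i + 1) * (1 / ((i : ℝ) + 1)) ≤
      ∑ i ∈ Finset.range m, r ^ (i + 1) * (1 / ((i : ℝ) + 1)) :=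
    Finset.sum_le_sum_of_subset_of_nonneg (Finset.range_subset_range.2 (by omega))
      fun i _ _ => by positivity
  have h4 : (1 - r) * ∑ i ∈ Finset.range m, r ^ (i + 1) ≤ 1 := by
    have e : ∑ i ∈ Finset.range m, r ^ (i + 1) = r * ∑ i ∈ Finset.range m, r ^ i := by
      rw [Finset.mul_sum]
      exact Finset.sum_congr rfl fun i _ => by ring
    have e2 : (1 - r) * ∑ i ∈ Finset.range m, r ^ i = 1 - r ^ m := mul_neg_geom_sum r m
    have : 0 < r ^ m := by positivity
    calc (1 - r) * ∑ i ∈ Finset.range m, r ^ (i + 1) = r * (1 - r ^ m) := by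
          rw [e, ← e2]
          ring
      _ ≤ 1 := by nlinarith
  have h5 : C * ((1 - r) * ∑ i ∈ Finset.range m, r ^ (i + 1)) ≤ C * 1 :=
    mul_le_mul_of_nonneg_left h4 hC
  linarith

theorem eventually_mem_Ioo : ∀ᶠ r : ℝ in 𝓝[<] 1, 0 < r ∧ r < 1 := by
  filter_upwards [self_mem_nhdsWithin,
    (nhdsWithin_le_nhds (lt_mem_nhds one_pos) : ∀ᶠ r : ℝ in 𝓝[<] 1, 0 < r)] with r h1 h0
  exact ⟨h0, h1⟩

/-- For fixed U the lower bound tends to a partial sum of the harmonic series, which is as large as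
desired. -/
theorem tendsto_norm_tval : Filter.Tendsto (fun r => ‖tval N r‖) (𝓝[<] 1) Filter.atTop := by
  obtain ⟨C, h⟩ := tval_ge (N := N)
  refine Filter.tendsto_atTop.2 fun B => ?_
  obtain ⟨U, hU⟩ := (Filter.tendsto_atTop.1 Real.tendsto_sum_range_one_div_nat_succ_atTop
    (B + C + 1)).exists
  have hlim : Filter.Tendsto
      (fun r : ℝ => ∑ i ∈ Finset.range U, r ^ (i + 1) * (1 / ((i : ℝ) + 1))) (𝓝[<] 1)
      (𝓝 (∑ i ∈ Finset.range U, 1 ^ (i + 1) * (1 / ((i : ℝ) + 1)))) := by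
    refine Filter.Tendsto.mono_left (Continuous.tendsto ?_ 1) nhdsWithin_le_nhds
    fun_prop
  simp only [one_pow, one_mul] at hlim
  filter_upwards [hlim.eventually (lt_mem_nhds (a := B + C) (by linarith)), eventually_mem_Ioo]
    with r hr ⟨h0, h1⟩
  linarith [h r h0 h1 U]

/-- Growth slower than any negative power of `1 - r`. -/
def Moderate (F : ℝ → ℂ) : Prop :=
  ∀ ε : ℝ, 0 < ε → ∃ C : ℝ, 0 ≤ C ∧ ∀ r : ℝ, 0 < r → r < 1 → ‖F r‖ ≤ C * (1 - r) ^ (-ε)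

theorem Moderate.add {F G : ℝ → ℂ} (hF : Moderate F) (hG : Moderate G) :
    Moderate fun r => F r + G r := by
  intro ε hε
  obtain ⟨C, hC, h⟩ := hF ε hε
  obtain ⟨D, hD, h'⟩ := hG ε hε
  refine ⟨C + D, by positivity, fun r h0 h1 => ?_⟩
  rw [add_mul]
  exact (norm_add_le _ _).trans (add_le_add (h r h0 h1) (h' r h0 h1))

theorem Moderate.mul {F G : ℝ → ℂ} (hF : Moderate F) (hG : Moderate G) :
    Moderate fun r => F r * G r := by
  intro ε hε
  obtain ⟨C, hC, h⟩ := hF (ε / 2) (by positivity)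
  obtain ⟨D, hD, h'⟩ := hG (ε / 2) (by positivity)
  refine ⟨C * D, by positivity, fun r h0 h1 => ?_⟩
  have hr : 0 < 1 - r := by linarith
  rw [norm_mul]
  calc ‖F r‖ * ‖G r‖ ≤ (C * (1 - r) ^ (-(ε / 2))) * (D * (1 - r) ^ (-(ε / 2))) :=
        mul_le_mul (h r h0 h1) (h' r h0 h1) (norm_nonneg _) (by positivity)
    _ = C * D * ((1 - r) ^ (-(ε / 2)) * (1 - r) ^ (-(ε / 2))) := by ring
    _ = C * D * (1 - r) ^ (-ε) := by
      rw [← Real.rpow_add hr]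
      ring_nf

theorem one_le_rpow_neg {r : ℝ} (h0 : 0 < r) (h1 : r < 1) {ε : ℝ} (hε : 0 < ε) :
    1 ≤ (1 - r) ^ (-ε) :=
  Real.one_le_rpow_of_pos_of_le_one_of_nonpos (by linarith) (by linarith) (by linarith)

theorem moderate_const (c : ℂ) : Moderate fun _ => c := by
  intro ε hε
  refine ⟨‖c‖, norm_nonneg c, fun r h0 h1 => ?_⟩
  exact le_mul_of_one_le_right (norm_nonneg c) (one_le_rpow_neg h0 h1 hε)

theorem moderate_tval : Moderate (tval N) := by
  intro ε hε
  obtain ⟨C, hC, h⟩ := tval_bound (N := N) (lt_min hε one_pos) (min_le_right ε 1)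
  refine ⟨C, hC, fun r h0 h1 => (h r h0 h1).trans (mul_le_mul_of_nonneg_left ?_ hC)⟩
  exact Real.rpow_le_rpow_of_exponent_ge (by linarith) (by linarith)
    (neg_le_neg (min_le_left ε 1))

theorem moderate_eval (P : ℂ[X]) : Moderate fun r => P.eval (tval N r) := by
  induction P using Polynomial.induction_on' with
  | add P Q hP hQ => simpa only [Polynomial.eval_add] using hP.add hQ
  | monomial n c =>
    simp only [Polynomial.eval_monomial]
    refine (moderate_const c).mul ?_
    induction n with
    | zero => simpa using moderate_const 1
    | succ n ih =>
      simp only [pow_succ]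
      exact ih.mul moderate_tval

theorem Small.moderate {F : ℝ → ℂ} (hF : Small F) : Moderate F := by
  intro ε hε
  obtain ⟨θ, hθ, E, h⟩ := hF
  refine ⟨|E|, abs_nonneg E, fun r h0 h1 => (h r h0 h1).trans ?_⟩
  have hr : 0 < 1 - r := by linarith
  have h2 : (1 - r) ^ θ ≤ 1 := Real.rpow_le_one hr.le (by linarith) hθ.le
  have h3 := one_le_rpow_neg h0 h1 hε
  calc E * (1 - r) ^ θ ≤ |E| * (1 - r) ^ θ :=
        mul_le_mul_of_nonneg_right (le_abs_self E) (by positivity)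
    _ ≤ |E| * (1 - r) ^ (-ε) := mul_le_mul_of_nonneg_left (h2.trans h3) (abs_nonneg E)

theorem Small.mul_moderate {F G : ℝ → ℂ} (hF : Small F) (hG : Moderate G) :
    Small fun r => F r * G r := by
  obtain ⟨θ, hθ, E, h⟩ := hF
  obtain ⟨C, hC, h'⟩ := hG (θ / 2) (by positivity)
  refine ⟨θ / 2, by positivity, |E| * C, fun r h0 h1 => ?_⟩
  have hr : 0 < 1 - r := by linarith
  rw [norm_mul]
  have h2 : ‖F r‖ ≤ |E| * (1 - r) ^ θ :=
    (h r h0 h1).trans (mul_le_mul_of_nonneg_right (le_abs_self E) (by positivity))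
  calc ‖F r‖ * ‖G r‖ ≤ (|E| * (1 - r) ^ θ) * (C * (1 - r) ^ (-(θ / 2))) :=
        mul_le_mul h2 (h' r h0 h1) (norm_nonneg _) (by positivity)
    _ = |E| * C * ((1 - r) ^ θ * (1 - r) ^ (-(θ / 2))) := by ring
    _ = |E| * C * (1 - r) ^ (θ / 2) := by
      rw [← Real.rpow_add hr]
      ring_nf

theorem Small.tendsto {F : ℝ → ℂ} (hF : Small F) : Filter.Tendsto F (𝓝[<] 1) (𝓝 0) := by
  obtain ⟨θ, hθ, E, h⟩ := hF
  have hlim : Filter.Tendsto (fun r : ℝ => E * (1 - r) ^ θ) (𝓝[<] 1) (𝓝 (E * (1 - 1) ^ θ)) := by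
    refine Filter.Tendsto.mono_left (Continuous.tendsto ?_ 1) nhdsWithin_le_nhds
    exact continuous_const.mul ((continuous_const.sub continuous_id).rpow_const
      fun _ => Or.inr hθ.le)
  rw [sub_self, Real.zero_rpow hθ.ne', mul_zero] at hlim
  refine squeeze_zero_norm' ?_ hlim
  filter_upwards [eventually_mem_Ioo] with r ⟨h0, h1⟩
  exact h r h0 h1

/-- The series `f`, considered in weight `k`, has the expansion `P` in powers of the scaled value
of `t_N`. -/
def HasExp (N : ℕ) [NeZero N] (k : ℕ) (f : ℂ⟦X⟧) (P : ℂ[X]) : Prop :=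
  Conv f ∧ Small fun r => ((1 - r : ℝ) : ℂ) ^ k * ev (zpt N r) f - P.eval (tval N r)

theorem HasExp.add {k : ℕ} {f g : ℂ⟦X⟧} {P Q : ℂ[X]} (hf : HasExp N k f P) (hg : HasExp N k g Q) :
    HasExp N k (f + g) (P + Q) := by
  refine ⟨hf.1.add hg.1, (hf.2.add hg.2).congr fun r h0 h1 => ?_⟩
  rw [ev_add hf.1 hg.1 (norm_zpt_lt h0 h1), Polynomial.eval_add]
  ring

theorem HasExp.smul {k : ℕ} {f : ℂ⟦X⟧} {P : ℂ[X]} (c : ℂ) (hf : HasExp N k f P) :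
    HasExp N k (c • f) (c • P) := by
  refine ⟨hf.1.smul c, (hf.2.const_mul c).congr fun r h0 h1 => ?_⟩
  rw [ev_smul, Polynomial.eval_smul, smul_eq_mul]
  ring

theorem hasExp_zero (k : ℕ) : HasExp N k 0 0 := by
  refine ⟨conv_zero, small_zero.congr fun r _ _ => ?_⟩
  simp [ev_zero]

theorem HasExp.mul {j k : ℕ} {f g : ℂ⟦X⟧} {P Q : ℂ[X]} (hf : HasExp N j f P)
    (hg : HasExp N k g Q) : HasExp N (j + k) (f * g) (P * Q) := by
  refine ⟨hf.1.mul hg.1, ?_⟩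
  -- FG - PQ is written as (F - P) G + (G - Q) P, with G itself split as (G - Q) + Q to see its
  -- moderate growth.
  have h1 := hf.2.mul_moderate (hg.2.moderate.add (moderate_eval (N := N) Q))
  have h2 := hg.2.mul_moderate (moderate_eval (N := N) P)
  refine (h1.add h2).congr fun r h0 h1 => ?_
  rw [ev_mul hf.1 hg.1 (norm_zpt_lt h0 h1), Polynomial.eval_mul, pow_add]
  ring

/-- A polynomial whose value at tval tends to 0 while |tval| → ∞ is zero: positive degree would make
it unbounded, and a constant equals its limit. -/
theorem HasExp.unique {k : ℕ} {f : ℂ⟦X⟧} {P Q : ℂ[X]} (hP : HasExp N k f P)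
    (hQ : HasExp N k f Q) : P = Q := by
  have h : Small fun r => (P - Q).eval (tval N r) := by
    refine (hQ.2.sub hP.2).congr fun r _ _ => ?_
    rw [Polynomial.eval_sub]
    ring
  have hlim := h.tendsto
  rw [← sub_eq_zero]
  by_contra hne
  rcases lt_or_ge 0 (P - Q).degree with hd | hd
  · have h1 := Polynomial.tendsto_norm_atTop (P - Q) hd (tendsto_norm_tval (N := N))
    exact not_tendsto_nhds_of_tendsto_atTop h1 _ hlim.norm
  · rw [Polynomial.eq_C_of_degree_le_zero hd] at hlim hne
    simp only [Polynomial.eval_C] at hlim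
    have := tendsto_nhds_unique hlim tendsto_const_nhds
    rw [← this, map_zero] at hne
    exact hne rfl

/-- One more factor 1-r turns moderate growth into a power saving; this is why lower weights are
invisible to Z. -/
theorem HasExp.succ {k : ℕ} {f : ℂ⟦X⟧} {P : ℂ[X]} (hf : HasExp N k f P) :
    HasExp N (k + 1) f 0 := by
  refine ⟨hf.1, ?_⟩
  have h1 : Small fun r => ((1 - r : ℝ) : ℂ) :=
    small_of_linear (C := 1) fun r _ h1 => by rw [norm_ofReal_one_sub h1, one_mul]
  refine (h1.mul_moderate (hf.2.moderate.add (moderate_eval (N := N) P))).congr fun r _ _ => ?_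
  rw [pow_succ, Polynomial.eval_zero]
  ring

theorem hasExp_tN : HasExp N 1 (tN N) Polynomial.X := by
  refine ⟨conv_tN, small_zero.congr fun r _ _ => ?_⟩
  rw [pow_one, Polynomial.eval_X, tval, sub_self]

theorem hasExp_bracket {w : Word N} (hw : Adm w) :
    HasExp N (weight w) (bracket w) (Polynomial.C (zeta w)) := by
  refine ⟨conv_bracket w, ?_⟩
  simp only [Polynomial.eval_C]
  exact adm_rate hw

theorem hasExp_gser (β : ZMod N) (w : Word N) :
    HasExp N (weight w + 1) (gser β w) (Polynomial.C (Gam β w)) := by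
  refine ⟨(conv_bracket _).sub (conv_bracket _), ?_⟩
  simp only [Polynomial.eval_C]
  exact gam_rate β w

theorem hasExp_one : HasExp N 0 1 1 := by
  refine ⟨conv_one, small_zero.congr fun r _ _ => ?_⟩
  simp [ev_one]

theorem HasExp.pow {f : ℂ⟦X⟧} {P : ℂ[X]} (hf : HasExp N 1 f P) (n : ℕ) :
    HasExp N n (f ^ n) (P ^ n) := by
  induction n with
  | zero => simpa using hasExp_one
  | succ n ih => rw [pow_succ, pow_succ]; exact ih.mul hf

end Expansion

/-! ### The linear system for several leading ones -/

section System

variable {N : ℕ} [NeZero N]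

theorem regMatrix_mulVec {K V : Type*} [Field K] [CharZero K] [AddCommGroup V] [Module K V]
    (m : ℕ) (x : (Fin (m + 1) → ZMod N) → V) (β : Fin (m + 1) → ZMod N) :
    ∑ β', ((regMatrix N m β β' : ℚ) : K) • x β' =
      (N : K) • x β + ∑ l ∈ Finset.univ.filter (fun l : Fin (m + 1) => l ≠ 0), ∑ γ : ZMod N,
        x (l.insertNth γ (Fin.tail β)) := by
  simp only [regMatrix, Rat.cast_add, Rat.cast_sum, add_smul, Finset.sum_add_distrib,
    Finset.sum_smul]
  congr 1
  · rw [Finset.sum_eq_single β]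
    · simp
    · intro b _ hb
      rw [if_neg hb.symm, Rat.cast_zero, zero_smul]
    · simp
  · rw [Finset.sum_comm]
    refine Finset.sum_congr rfl fun l _ => ?_
    rw [Finset.sum_comm]
    refine Finset.sum_congr rfl fun γ _ => ?_
    rw [Finset.sum_eq_single (l.insertNth γ (Fin.tail β))]
    · simp
    · intro b _ hb
      rw [if_neg hb, Rat.cast_zero, zero_smul]
    · simp

theorem insertNth_tail_of_gt {N m : ℕ} (β : Fin (m + 1) → ZMod N) (l j : Fin (m + 1)) (γ : ZMod N)
    (h : l < j) : (l.insertNth γ (Fin.tail β) : Fin (m + 1) → ZMod N) j = β j := by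
  obtain ⟨i, rfl⟩ := Fin.exists_succAbove_eq h.ne'
  rw [Fin.insertNth_apply_succAbove, Fin.tail]
  rw [Fin.lt_succAbove_iff_le_castSucc] at h
  rw [Fin.succAbove_of_le_castSucc _ _ h]

theorem insertNth_tail_congr {N m : ℕ} {β β' : Fin (m + 1) → ZMod N} {i : ℕ}
    (h : ∀ j : Fin (m + 1), i < j → β j = β' j) (l j : Fin (m + 1)) (γ : ZMod N) (hl : i ≤ l)
    (hj : i ≤ j) :
    (l.insertNth γ (Fin.tail β) : Fin (m + 1) → ZMod N) j =
      (l.insertNth γ (Fin.tail β') : Fin (m + 1) → ZMod N) j := by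
  rcases lt_trichotomy l j with h1 | rfl | h1
  · rw [insertNth_tail_of_gt _ _ _ _ h1, insertNth_tail_of_gt _ _ _ _ h1]
    exact h j (hl.trans_lt h1)
  · rw [Fin.insertNth_apply_same, Fin.insertNth_apply_same]
  · obtain ⟨p, rfl⟩ := Fin.exists_succAbove_eq h1.ne
    rw [Fin.insertNth_apply_succAbove, Fin.insertNth_apply_succAbove, Fin.tail, Fin.tail]
    rw [Fin.succAbove_lt_iff_castSucc_lt] at h1
    rw [Fin.succAbove_of_castSucc_lt _ _ h1] at hj
    refine h _ ?_
    simp at hj ⊢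
    omega

/-- Coordinates of a kernel vector are discarded one at a time. Suppose x does not depend on the
coordinates below i, and let β, β' agree above i. An insertion at l ≥ i then gives equal values for
both, since each relevant entry is a coordinate above i or γ. An insertion at l < i does not disturb
the coordinates from i on, so it gives x β and x β' themselves. Subtracting the two equations leaves
a positive multiple of x β - x β'. -/
theorem eq_of_regMatrix_system {m : ℕ} {x : (Fin (m + 1) → ZMod N) → ℚ}
    (hx : ∀ β, (N : ℚ) * x β + ∑ l ∈ Finset.univ.filter (fun l : Fin (m + 1) => l ≠ 0),
      ∑ γ : ZMod N, x (l.insertNth γ (Fin.tail β)) = 0) (i : ℕ) :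
    ∀ β β' : Fin (m + 1) → ZMod N, (∀ j : Fin (m + 1), i ≤ j → β j = β' j) → x β = x β' := by
  induction i with
  | zero => exact fun β β' h => congrArg x (funext fun j => h j (Nat.zero_le _))
  | succ i ih =>
    intro β β' h
    have hN : (0 : ℚ) < N := by exact_mod_cast Nat.pos_of_ne_zero (NeZero.ne N)
    have key : ∀ l : Fin (m + 1), ∑ γ : ZMod N, x (l.insertNth γ (Fin.tail β)) -
        ∑ γ : ZMod N, x (l.insertNth γ (Fin.tail β')) =
          (if (l : ℕ) < i then (N : ℚ) else 0) * (x β - x β') := by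
      intro l
      split_ifs with hl
      · have e : ∀ (β : Fin (m + 1) → ZMod N) (γ : ZMod N),
            x (l.insertNth γ (Fin.tail β)) = x β := fun β γ => by
          refine ih _ _ fun j hj => insertNth_tail_of_gt _ _ _ _ ?_
          exact Fin.lt_def.2 (hl.trans_le hj)
        simp only [e, Finset.sum_const, Finset.card_univ, ZMod.card, nsmul_eq_mul]
        ring
      · rw [zero_mul, sub_eq_zero]
        refine Finset.sum_congr rfl fun γ _ => ih _ _ fun j hj => ?_
        exact insertNth_tail_congr (fun j hj => h j hj) l j γ (not_lt.1 hl) hj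
    have h1 := hx β
    have h2 := hx β'
    have h3 : (N + ∑ l ∈ Finset.univ.filter (fun l : Fin (m + 1) => l ≠ 0),
        if (l : ℕ) < i then (N : ℚ) else 0) * (x β - x β') = 0 := by
      rw [add_mul, Finset.sum_mul, ← Finset.sum_congr rfl fun l _ => key l,
        Finset.sum_sub_distrib]
      linear_combination h1 - h2
    have h4 : 0 ≤ ∑ l ∈ Finset.univ.filter (fun l : Fin (m + 1) => l ≠ 0),
        if (l : ℕ) < i then (N : ℚ) else 0 :=
      Finset.sum_nonneg fun l _ => by split_ifs <;> [exact hN.le; exact le_rfl]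
    rcases mul_eq_zero.1 h3 with h5 | h5
    · linarith
    · linarith

/-- A kernel vector is constant, and on constants the matrix acts as multiplication by N plus m
copies of N, which is positive. -/
theorem isUnit_regMatrix (m : ℕ) : IsUnit (regMatrix N m) := by
  rw [← Matrix.mulVec_injective_iff_isUnit]
  refine (injective_iff_map_eq_zero (Matrix.mulVecLin (regMatrix N m))).2 fun x hx => ?_
  have hsys : ∀ β, (N : ℚ) * x β + ∑ l ∈ Finset.univ.filter (fun l : Fin (m + 1) => l ≠ 0),
      ∑ γ : ZMod N, x (l.insertNth γ (Fin.tail β)) = 0 := fun β => by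
    have h := regMatrix_mulVec (K := ℚ) m x β
    rw [smul_eq_mul] at h
    rw [← h]
    exact congrFun hx β
  have hconst : ∀ β β', x β = x β' := fun β β' =>
    eq_of_regMatrix_system hsys (m + 1) β β' fun j hj => absurd j.2 (by omega)
  funext β
  have h := hsys β
  rw [Finset.sum_congr rfl fun l _ => Finset.sum_congr rfl fun γ _ => hconst _ β,
    Finset.sum_const, Finset.sum_const, Finset.card_univ, ZMod.card, nsmul_eq_mul,
    nsmul_eq_mul] at h
  have hN : (0 : ℚ) < N := by exact_mod_cast Nat.pos_of_ne_zero (NeZero.ne N)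
  have hpos : 0 < (N : ℚ) + (Finset.univ.filter (fun l : Fin (m + 1) => l ≠ 0)).card * N := by
    positivity
  have h3 : ((N : ℚ) + (Finset.univ.filter (fun l : Fin (m + 1) => l ≠ 0)).card * N) * x β = 0 := by
    linear_combination h
  exact (mul_eq_zero.1 h3).resolve_left hpos.ne'

theorem eq_sum_regMatrix_inv {K V : Type*} [Field K] [CharZero K] [AddCommGroup V] [Module K V]
    {m : ℕ} {x b : (Fin (m + 1) → ZMod N) → V}
    (h : ∀ β, (N : K) • x β + ∑ l ∈ Finset.univ.filter (fun l : Fin (m + 1) => l ≠ 0),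
      ∑ γ : ZMod N, x (l.insertNth γ (Fin.tail β)) = b β) (β : Fin (m + 1) → ZMod N) :
    x β = ∑ β', (((regMatrix N m)⁻¹ β β' : ℚ) : K) • b β' := by
  have h1 : ∀ β', b β' = ∑ β'', ((regMatrix N m β' β'' : ℚ) : K) • x β'' := fun β' => by
    rw [← h, regMatrix_mulVec]
  simp only [h1, Finset.smul_sum, smul_smul]
  rw [Finset.sum_comm]
  simp only [← Finset.sum_smul, ← Rat.cast_mul, ← Rat.cast_sum]
  have h2 : ∀ β'', ∑ β', (regMatrix N m)⁻¹ β β' * regMatrix N m β' β'' =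
      (1 : Matrix (Fin (m + 1) → ZMod N) (Fin (m + 1) → ZMod N) ℚ) β β'' := fun β'' => by
    rw [← Matrix.nonsing_inv_mul (regMatrix N m)
      ((Matrix.isUnit_iff_isUnit_det _).1 (isUnit_regMatrix m)), Matrix.mul_apply]
  simp only [h2, Matrix.one_apply]
  rw [Finset.sum_eq_single β]
  · simp
  · intro b _ hb
    rw [if_neg hb.symm, Rat.cast_zero, zero_smul]
  · simp

end System

/-! ### Leading ones -/

section Lead

variable {N : ℕ}

theorem onesCons_zero (β : Fin 0 → ZMod N) (s : Word N) : onesCons β s = s := by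
  simp [onesCons]

theorem onesCons_cons {m : ℕ} (b : ZMod N) (β : Fin m → ZMod N) (s : Word N) :
    onesCons (Fin.cons b β : Fin (m + 1) → ZMod N) s = (1, b) :: onesCons β s := by
  simp [onesCons, List.ofFn_succ]

theorem lead_one_cons (b : ZMod N) (w : Word N) : lead ((1, b) :: w) = lead w + 1 := by
  simp [lead]

theorem lead_cons_of_one_lt {a : Letter N} (ha : 1 < a.1) (w : Word N) : lead (a :: w) = 0 := by
  simp [lead, ha.ne']

theorem lead_of_adm {w : Word N} (hw : Adm w) : lead w = 0 := by
  cases w with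
  | nil => rfl
  | cons a w => exact lead_cons_of_one_lt (hw a rfl) w

theorem lead_onesCons {m : ℕ} (β : Fin m → ZMod N) {s : Word N} (hs : Adm s) :
    lead (onesCons β s) = m := by
  induction m with
  | zero => rw [onesCons_zero, lead_of_adm hs]
  | succ m ih =>
    rw [← Fin.cons_self_tail β, onesCons_cons, lead_one_cons, ih]

theorem exists_onesCons (w : Word N) :
    ∃ (β : Fin (lead w) → ZMod N) (s : Word N), Adm s ∧ w = onesCons β s := by
  suffices ∀ m, lead w = m → ∃ (β : Fin m → ZMod N) (s : Word N), Adm s ∧ w = onesCons β s from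
    this _ rfl
  induction w with
  | nil =>
    rintro m rfl
    exact ⟨fun _ => 0, [], by simp [Adm], by simp [onesCons, lead]⟩
  | cons a w ih =>
    rintro m hm
    rcases eq_or_lt_of_le (one_le (a := a.1)) with ha | ha
    · obtain ⟨a1, b⟩ := a
      obtain rfl : 1 = a1 := ha
      rw [lead_one_cons] at hm
      subst hm
      obtain ⟨β, s, hs, hw⟩ := ih _ rfl
      exact ⟨Fin.cons b β, s, hs, by rw [onesCons_cons, ← hw]⟩
    · rw [lead_cons_of_one_lt ha] at hm
      subst hm
      exact ⟨fun i => 0, a :: w, adm_cons ha w, (onesCons_zero _ _).symm⟩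

theorem adm_of_lead_eq_zero {w : Word N} (hw : lead w = 0) : Adm w := by
  intro a ha
  cases w with
  | nil => simp at ha
  | cons b w =>
    simp only [List.head?_cons, Option.mem_def, Option.some.injEq] at ha
    subst ha
    refine lt_of_le_of_ne one_le fun h => ?_
    obtain ⟨b1, b2⟩ := b
    obtain rfl : 1 = b1 := h
    rw [lead_one_cons] at hw
    omega

theorem getD_onesCons {m : ℕ} (β : Fin m → ZMod N) (s : Word N) :
    (fun i : Fin m => ((onesCons β s).getD i (1, 0)).2) = β := by
  funext i
  simp [onesCons, List.getD_eq_getElem?_getD, List.getElem?_append]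

theorem drop_onesCons {m : ℕ} (β : Fin m → ZMod N) (s : Word N) :
    (onesCons β s).drop m = s := by
  rw [onesCons, List.drop_append]
  simp

theorem weight_onesCons {m : ℕ} (β : Fin m → ZMod N) (s : Word N) :
    weight (onesCons β s) = m + weight s := by
  induction m with
  | zero => rw [onesCons_zero, zero_add]
  | succ m ih =>
    rw [← Fin.cons_self_tail β, onesCons_cons, weight_cons, ih, PNat.one_coe]
    ring

theorem stuffle_singleton_cons (a b : Letter N) (v : Word N) :
    stuffle [a] (b :: v) = (a :: b :: v) :: ((stuffle [a] v).map (b :: ·) ++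
      if a.2 = b.2 then [(a.1 + b.1, a.2) :: v] else []) := by
  rw [stuffle, stuffle, stuffle]
  simp

theorem one_lt_one_add (a : ℕ+) : 1 < 1 + a := by
  rw [← PNat.coe_lt_coe, PNat.add_coe]
  have := a.pos
  simp

/-- The terms of `z_{1;γ} * z_{1;β₁} ⋯ z_{1;β_m} s` with more than `m` leading ones are the
insertions of `z_{1;γ}` among the leading ones. -/
theorem sum_stuffle_onesCons {V : Type*} [AddCommMonoid V] (f : Word N → V) (γ : ZMod N) {m : ℕ}
    (β : Fin m → ZMod N) {s : Word N} (hs : Adm s) :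
    ((stuffle [(1, γ)] (onesCons β s)).map f).sum =
      (((stuffle [(1, γ)] (onesCons β s)).filter fun u => lead u ≤ m).map f).sum +
        ∑ l : Fin (m + 1), f (onesCons (l.insertNth γ β : Fin (m + 1) → ZMod N) s) := by
  induction m generalizing f with
  | zero =>
    rw [Fin.sum_univ_one, Fin.insertNth_zero', onesCons_cons]
    simp only [onesCons_zero]
    cases s with
    | nil => simp [stuffle, lead_one_cons]
    | cons b v =>
      have hb : 1 < b.1 := hs b rfl
      have h1 : ∀ u ∈ (stuffle [(1, γ)] v).map (b :: ·) ++
          (if γ = b.2 then [((1 + b.1, γ) : Letter N) :: v] else []), lead u ≤ 0 := by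
        intro u hu
        rcases List.mem_append.1 hu with hu | hu
        · obtain ⟨u, -, rfl⟩ := List.mem_map.1 hu
          exact (lead_cons_of_one_lt hb u).le
        · split_ifs at hu with h
          · rw [List.mem_singleton.1 hu]
            exact (lead_cons_of_one_lt (one_lt_one_add _) v).le
          · simp at hu
      rw [stuffle_singleton_cons, List.filter_cons_of_neg (by simp [lead_one_cons]),
        List.filter_eq_self.2 (fun u hu => by simpa using h1 u hu), List.map_cons, List.sum_cons,
        add_comm]
  | succ m ih =>
    obtain ⟨b, β, rfl⟩ : ∃ b β', β = (Fin.cons b β' : Fin (m + 1) → ZMod N) :=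
      ⟨β 0, Fin.tail β, (Fin.cons_self_tail β).symm⟩
    have h := ih (fun u => f ((1, b) :: u)) β
    rw [onesCons_cons, stuffle_singleton_cons, List.filter_cons_of_neg, Fin.sum_univ_succ,
      Fin.insertNth_zero', onesCons_cons, onesCons_cons]
    · simp only [Fin.insertNth_succ_cons, onesCons_cons, List.map_cons, List.sum_cons,
        List.map_append, List.sum_append, List.filter_append, List.filter_map, List.map_map]
      have e1 : (fun u => decide (lead u ≤ m + 1)) ∘ (fun u => ((1, b) : Letter N) :: u) =
          fun u => decide (lead u ≤ m) := by
        funext u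
        simp [lead_one_cons]
      have e2 : (List.filter (fun u => decide (lead u ≤ m + 1))
          (if γ = b then [((1 + 1, γ) : Letter N) :: onesCons β s] else [])) =
          if γ = b then [((1 + 1, γ) : Letter N) :: onesCons β s] else [] := by
        refine List.filter_eq_self.2 fun u hu => ?_
        split_ifs at hu with h
        · rw [List.mem_singleton.1 hu, lead_cons_of_one_lt (one_lt_one_add _)]
          simp
        · simp at hu
      rw [e1, e2]
      simp only [Function.comp_def]
      rw [h]
      abel
    · rw [lead_one_cons, lead_one_cons, lead_onesCons _ hs]
      simp

end Lead

/-! ### Generation by `t_N`, and the regularized values as expansions -/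

section Regularized

variable {N : ℕ} [NeZero N]

/-- The error of the stuffle relation for `t_N [w]`. -/
def tErr (w : Word N) : ℂ⟦X⟧ :=
  tN N * bracket w - ∑ γ : ZMod N, bracketL (stuffleWord [(1, γ)] w)

theorem tErr_mem (w : Word N) : tErr w ∈ below (MDFil N) (weight w + 1) := by
  rw [tErr, tN, Finset.sum_mul, ← Finset.sum_sub_distrib]
  refine Submodule.sum_mem _ fun γ _ => ?_
  have h := bracket_mul_sub_mem [((1, γ) : Letter N)] w
  rwa [show weight [((1, γ) : Letter N)] + weight w = weight w + 1 by
    simp [weight, add_comm]] at h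

theorem bracketL_stuffleWord {N : ℕ} (w v : Word N) :
    bracketL (stuffleWord w v) = ((stuffle w v).map bracket).sum := by
  rw [stuffleWord, map_list_sum, List.map_map]
  exact congrArg List.sum (List.map_congr_left fun u _ => bracketL_single u)

/-- The right-hand side of the linear system satisfied by the series
`[{1}^{m+1}, s; β, α]`. -/
def serRhs (m : ℕ) (s : Word N) (β : Fin (m + 1) → ZMod N) : ℂ⟦X⟧ :=
  tN N * bracket (onesCons (Fin.tail β) s) + ∑ γ : ZMod N, gser γ (onesCons (Fin.tail β) s) -
    (N : ℂ) • gser (β 0) (onesCons (Fin.tail β) s) -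
    ∑ γ : ZMod N, (((stuffle [(1, γ)] (onesCons (Fin.tail β) s)).filter
      fun u => lead u ≤ m).map bracket).sum - tErr (onesCons (Fin.tail β) s)

/-- The stuffle product of t_N with w' is the sum over γ of all insertions. Those in front of w' are
rewritten by [1,…;γ,…] = [1,…;0,…] - g_γ(w'), so that they become N copies of the word with first
residue β₀ plus series g_γ. -/
theorem bracket_system (m : ℕ) {s : Word N} (hs : Adm s) (β : Fin (m + 1) → ZMod N) :
    (N : ℂ) • bracket (onesCons β s) +
      ∑ l ∈ Finset.univ.filter (fun l : Fin (m + 1) => l ≠ 0), ∑ γ : ZMod N,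
        bracket (onesCons (l.insertNth γ (Fin.tail β) : Fin (m + 1) → ZMod N) s) =
      serRhs m s β := by
  have h1 : ∀ γ : ZMod N, bracketL (stuffleWord [(1, γ)] (onesCons (Fin.tail β) s)) =
      (((stuffle [(1, γ)] (onesCons (Fin.tail β) s)).filter
        fun u => lead u ≤ m).map bracket).sum +
      (bracket ((1, γ) :: onesCons (Fin.tail β) s) +
        ∑ l ∈ Finset.univ.filter (fun l : Fin (m + 1) => l ≠ 0),
          bracket (onesCons (l.insertNth γ (Fin.tail β) : Fin (m + 1) → ZMod N) s)) := by
    intro γ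
    rw [bracketL_stuffleWord, sum_stuffle_onesCons bracket γ (Fin.tail β) hs,
      ← Finset.sum_filter_add_sum_filter_not Finset.univ (fun l : Fin (m + 1) => l = 0)]
    congr 2
    rw [Finset.filter_eq', if_pos (Finset.mem_univ _), Finset.sum_singleton, Fin.insertNth_zero',
      onesCons_cons]
  have h2 : bracket (onesCons β s) = bracket ((1, 0) :: onesCons (Fin.tail β) s) -
      gser (β 0) (onesCons (Fin.tail β) s) := by
    conv_lhs => rw [← Fin.cons_self_tail β, onesCons_cons]
    rw [gser]
    ring
  have h3 : ∑ γ : ZMod N, gser γ (onesCons (Fin.tail β) s) =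
      (N : ℂ) • bracket ((1, 0) :: onesCons (Fin.tail β) s) -
        ∑ γ : ZMod N, bracket ((1, γ) :: onesCons (Fin.tail β) s) := by
    simp only [gser, Finset.sum_sub_distrib, Finset.sum_const, Finset.card_univ, ZMod.card,
      Nat.cast_smul_eq_nsmul]
  rw [serRhs, tErr, Finset.sum_congr rfl fun γ _ => h1 γ, Finset.sum_add_distrib,
    Finset.sum_add_distrib, h2, h3, smul_sub, Finset.sum_comm]
  abel

/-- The span of the products `f t_N ^ r` of weight at most `k`, with `f` in `qMZ N`. -/
def tSpan (N k : ℕ) [NeZero N] : Submodule (QN N) ℂ⟦X⟧ :=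
  Submodule.span (QN N) {h | ∃ j r, j + r ≤ k ∧ ∃ f ∈ qMZFil N j, h = f * tN N ^ r}

theorem tSpan_mono : Monotone fun k => tSpan N k := fun _ _ h =>
  Submodule.span_mono fun _ ⟨j, r, hj, hf⟩ => ⟨j, r, hj.trans h, hf⟩

theorem qMZFil_le_tSpan (k : ℕ) : qMZFil N k ≤ tSpan N k := fun f hf =>
  Submodule.subset_span ⟨k, 0, le_rfl, f, hf, by simp⟩

theorem tN_mul_mem_tSpan {k : ℕ} {f : ℂ⟦X⟧} (hf : f ∈ tSpan N k) : tN N * f ∈ tSpan N (k + 1) := by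
  suffices tSpan N k ≤ (tSpan N (k + 1)).comap (LinearMap.mulLeft (QN N) (tN N)) from this hf
  refine Submodule.span_le.2 ?_
  rintro _ ⟨j, r, hj, f, hf, rfl⟩
  refine Submodule.subset_span ⟨j, r + 1, by omega, f, hf, ?_⟩
  rw [LinearMap.mulLeft_apply]
  ring

theorem natCast_smul_eq {N : ℕ} (n : ℕ) (f : ℂ⟦X⟧) : (n : ℂ) • f = (n : QN N) • f := by
  rw [Nat.cast_smul_eq_nsmul, Nat.cast_smul_eq_nsmul]

/-- Each term of the right-hand side is t_N times a series of smaller weight, a series g_γ, a word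
with fewer leading ones, or an error of smaller weight. -/
theorem serRhs_mem_tSpan {m : ℕ} {s : Word N} (β : Fin (m + 1) → ZMod N)
    (hMD : ∀ j < m + 1 + weight s, MDFil N j ≤ tSpan N j)
    (hlead : ∀ w : Word N, weight w = m + 1 + weight s → lead w ≤ m →
      bracket w ∈ tSpan N (m + 1 + weight s)) :
    serRhs m s β ∈ tSpan N (m + 1 + weight s) := by
  have hw : weight (onesCons (Fin.tail β) s) + 1 = m + 1 + weight s := by
    rw [weight_onesCons]
    ring
  have hg : ∀ γ : ZMod N, gser γ (onesCons (Fin.tail β) s) ∈ tSpan N (m + 1 + weight s) :=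
    fun γ => qMZFil_le_tSpan _ (hw ▸ gser_mem_qMZFil γ _)
  refine sub_mem (sub_mem (sub_mem (add_mem ?_ (Submodule.sum_mem _ fun γ _ => hg γ)) ?_)
    (Submodule.sum_mem _ fun γ _ => list_sum_mem fun f hf => ?_)) ?_
  · rw [← hw]
    exact tN_mul_mem_tSpan (hMD _ (by omega) (bracket_mem_MDFil _))
  · rw [natCast_smul_eq (N := N)]
    exact Submodule.smul_mem _ _ (hg _)
  · obtain ⟨u, hu, rfl⟩ := List.mem_map.1 hf
    rw [List.mem_filter] at hu
    refine hlead u ?_ (by simpa using hu.2)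
    rw [weight_of_mem_stuffle hu.1, ← hw, add_comm]
    simp [weight]
  · have h := tErr_mem (onesCons (Fin.tail β) s)
    rw [below] at h
    exact tSpan_mono (by omega) (hMD _ (by omega) h)

/-- Induction on the weight, and for fixed weight on the number of leading ones: the linear system
expresses words with m + 1 leading ones through series already treated. Words without leading ones
are in qMZ. -/
theorem MDFil_le_tSpan (k : ℕ) : MDFil N k ≤ tSpan N k := by
  induction k using Nat.strong_induction_on with
  | _ k IH =>
  have key : ∀ n, ∀ w : Word N, weight w = k → lead w = n → bracket w ∈ tSpan N k := by
    intro n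
    induction n using Nat.strong_induction_on with
    | _ n ih =>
    intro w hw hn
    cases n with
    | zero => exact qMZFil_le_tSpan _ (hw ▸ bracket_mem_qMZFil (adm_of_lead_eq_zero hn))
    | succ m =>
      obtain ⟨β, s, hs, h⟩ := exists_onesCons w
      -- The length of β is `lead w`, so it has to become a variable before it can be replaced by m
      -- + 1.
      generalize lead w = l at hn β h
      subst hn
      have hk : k = m + 1 + weight s := by rw [← hw, h, weight_onesCons]
      have hsol := eq_sum_regMatrix_inv (K := QN N) (x := fun β => bracket (onesCons β s))
        (b := serRhs m s) (fun β => by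
          rw [← natCast_smul_eq (N := N)]
          exact bracket_system m hs β) β
      rw [h, hsol]
      refine Submodule.sum_mem _ fun β' _ => Submodule.smul_mem _ _ ?_
      subst hk
      exact serRhs_mem_tSpan β' IH fun w hw hl => ih (lead w) (by omega) w hw rfl
  refine Submodule.span_le.2 ?_
  rintro _ ⟨w, hw, rfl⟩
  rcases hw.lt_or_eq with h | h
  · exact tSpan_mono hw (IH _ h (bracket_mem_MDFil w))
  · exact key _ w h rfl

theorem HasExp.neg {k : ℕ} {f : ℂ⟦X⟧} {P : ℂ[X]} (hf : HasExp N k f P) : HasExp N k (-f) (-P) := by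
  simpa using hf.smul (-1)

theorem HasExp.sub {k : ℕ} {f g : ℂ⟦X⟧} {P Q : ℂ[X]} (hf : HasExp N k f P) (hg : HasExp N k g Q) :
    HasExp N k (f - g) (P - Q) := by
  simpa [sub_eq_add_neg] using hf.add hg.neg

theorem HasExp.sum {ι : Type*} {k : ℕ} (t : Finset ι) {f : ι → ℂ⟦X⟧} {P : ι → ℂ[X]}
    (h : ∀ i ∈ t, HasExp N k (f i) (P i)) : HasExp N k (∑ i ∈ t, f i) (∑ i ∈ t, P i) := by
  classical
  induction t using Finset.induction_on with
  | empty => simpa using hasExp_zero k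
  | insert a t ha ih =>
    rw [Finset.sum_insert ha, Finset.sum_insert ha]
    exact (h a (Finset.mem_insert_self a t)).add
      (ih fun i hi => h i (Finset.mem_insert_of_mem hi))

theorem HasExp.list_sum {ι : Type*} {k : ℕ} (l : List ι) {f : ι → ℂ⟦X⟧} {P : ι → ℂ[X]}
    (h : ∀ i ∈ l, HasExp N k (f i) (P i)) : HasExp N k (l.map f).sum (l.map P).sum := by
  induction l with
  | nil => simpa using hasExp_zero k
  | cons a l ih =>
    rw [List.map_cons, List.map_cons, List.sum_cons, List.sum_cons]
    exact (h a List.mem_cons_self).add (ih fun i hi => h i (List.mem_cons_of_mem a hi))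

theorem HasExp.zero_of_lt {j k : ℕ} {f : ℂ⟦X⟧} {P : ℂ[X]} (hf : HasExp N j f P) (h : j < k) :
    HasExp N k f 0 := by
  induction k with
  | zero => omega
  | succ k ih =>
    rcases (Nat.lt_succ_iff.1 h).eq_or_lt with rfl | h
    · exact hf.succ
    · exact (ih h).succ

theorem exists_hasExp_of_mem_span {k : ℕ} {S : Set ℂ⟦X⟧} {U : Submodule (QN N) ℂ[X]}
    (h : ∀ f ∈ S, ∃ P ∈ U, HasExp N k f P) {f : ℂ⟦X⟧} (hf : f ∈ Submodule.span (QN N) S) :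
    ∃ P ∈ U, HasExp N k f P := by
  induction hf using Submodule.span_induction with
  | mem f hf => exact h f hf
  | zero => exact ⟨0, zero_mem _, hasExp_zero k⟩
  | add f g _ _ hf hg =>
    obtain ⟨P, hP, h1⟩ := hf
    obtain ⟨Q, hQ, h2⟩ := hg
    exact ⟨P + Q, add_mem hP hQ, h1.add h2⟩
  | smul c f _ hf =>
    obtain ⟨P, hP, h1⟩ := hf
    exact ⟨c • P, U.smul_mem c hP, h1.smul (c : ℂ)⟩

/-- The constant polynomials with values in `MZFil N k`. -/
def constFil (N k : ℕ) : Submodule (QN N) ℂ[X] :=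
  (MZFil N k).map (Polynomial.CAlgHom (R := QN N) (A := ℂ)).toLinearMap

/-- Generators of weight exactly k expand to their constant; those of smaller weight expand to 0, so
the value stays in step k of the filtration. -/
theorem exists_hasExp_qMZ {k : ℕ} {f : ℂ⟦X⟧} (hf : f ∈ qMZFil N k) :
    ∃ z ∈ MZFil N k, HasExp N k f (Polynomial.C z) := by
  suffices ∃ P ∈ constFil N k, HasExp N k f P by
    obtain ⟨_, ⟨z, hz, rfl⟩, h⟩ := this
    exact ⟨z, hz, h⟩
  refine exists_hasExp_of_mem_span ?_ hf
  rintro f ⟨j, hj, hf⟩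
  obtain ⟨z, hz, h⟩ : ∃ z ∈ mGen N j, HasExp N j f (Polynomial.C z) := by
    rcases hf with ⟨w, hw, rfl, rfl⟩ | ⟨β, w, hβ, rfl, rfl⟩
    · exact ⟨_, Or.inl ⟨w, hw, rfl, rfl⟩, hasExp_bracket hw⟩
    · exact ⟨_, Or.inr ⟨β, w, hβ, rfl, rfl⟩, hasExp_gser β w⟩
  rcases hj.eq_or_lt with rfl | hj
  · exact ⟨_, ⟨z, Submodule.subset_span ⟨j, le_rfl, hz⟩, rfl⟩, h⟩
  · exact ⟨0, zero_mem _, h.zero_of_lt hj⟩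

/-- The polynomials with coefficients in `MZ N`. -/
def polyMZ (N : ℕ) : Submodule (QN N) ℂ[X] where
  carrier := {P | ∀ n, P.coeff n ∈ MZ N}
  add_mem' hP hQ n := by
    rw [Polynomial.coeff_add]
    exact add_mem (hP n) (hQ n)
  zero_mem' n := by
    rw [Polynomial.coeff_zero]
    exact zero_mem _
  smul_mem' c P hP n := by
    rw [Polynomial.coeff_smul]
    exact Submodule.smul_mem _ c (hP n)

theorem MZFil_le_MZ {N : ℕ} (k : ℕ) : MZFil N k ≤ MZ N :=
  Submodule.span_mono fun _ ⟨j, _, h⟩ => ⟨j, h⟩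

theorem exists_hasExp_MD {k : ℕ} {f : ℂ⟦X⟧} (hf : f ∈ MDFil N k) :
    ∃ P ∈ polyMZ N, HasExp N k f P := by
  refine exists_hasExp_of_mem_span ?_ (MDFil_le_tSpan k hf)
  rintro _ ⟨j, r, hj, f, hf, rfl⟩
  obtain ⟨z, hz, h⟩ := exists_hasExp_qMZ hf
  have h' := h.mul (hasExp_tN.pow r)
  rcases hj.eq_or_lt with rfl | hj
  · refine ⟨_, fun n => ?_, h'⟩
    rw [Polynomial.coeff_C_mul_X_pow]
    split_ifs
    · exact MZFil_le_MZ j hz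
    · exact zero_mem _
  · exact ⟨0, zero_mem _, h'.zero_of_lt hj⟩

theorem hasExp_zero_of_below {k : ℕ} {f : ℂ⟦X⟧} (hf : f ∈ below (MDFil N) k) :
    HasExp N k f 0 := by
  cases k with
  | zero =>
    rw [below, Submodule.mem_bot] at hf
    rw [hf]
    exact hasExp_zero 0
  | succ k =>
    obtain ⟨P, -, h⟩ := exists_hasExp_MD hf
    exact h.succ

/-- Term by term the expansion of the right-hand side is the one in the definition of ζ*; the error
of the stuffle relation has lower weight and expands to 0. -/
theorem hasExp_serRhs {m : ℕ} {s : Word N} (β : Fin (m + 1) → ZMod N) {prev : Word N → ℂ[X]}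
    (hs : Adm s) (hprev : ∀ w : Word N, lead w ≤ m → HasExp N (weight w) (bracket w) (prev w)) :
    HasExp N (m + 1 + weight s) (serRhs m s β) (regRhs m prev s β) := by
  have hw : weight (onesCons (Fin.tail β) s) + 1 = m + 1 + weight s := by
    rw [weight_onesCons]
    ring
  have hg : ∀ γ : ZMod N, HasExp N (m + 1 + weight s) (gser γ (onesCons (Fin.tail β) s))
      (Polynomial.C (Gam γ (onesCons (Fin.tail β) s))) := fun γ => hw ▸ hasExp_gser γ _
  have h1 := (hasExp_tN (N := N)).mul (hprev (onesCons (Fin.tail β) s) (lead_onesCons _ hs).le)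
  rw [add_comm 1, hw] at h1
  have h2 := HasExp.sum Finset.univ fun γ _ => hg γ
  have h3 := (hg (β 0)).smul (N : ℂ)
  have h4 := HasExp.sum Finset.univ fun (γ : ZMod N) (_ : γ ∈ Finset.univ) =>
    HasExp.list_sum (N := N) (k := m + 1 + weight s) (f := bracket) (P := prev)
      ((stuffle [(1, γ)] (onesCons (Fin.tail β) s)).filter fun u => lead u ≤ m) fun u hu => by
        rw [List.mem_filter] at hu
        have e : weight u = m + 1 + weight s := by
          rw [weight_of_mem_stuffle hu.1, ← hw, add_comm]
          simp [weight]
        exact e ▸ hprev u (by simpa using hu.2)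
  have h5 := hasExp_zero_of_below (tErr_mem (onesCons (Fin.tail β) s))
  rw [hw] at h5
  have h := (((h1.add h2).sub h3).sub h4).sub h5
  rwa [sub_zero, ← map_sum, Polynomial.smul_C, smul_eq_mul] at h

theorem hasExp_onesCons {m : ℕ} {s : Word N} (β : Fin (m + 1) → ZMod N) {prev : Word N → ℂ[X]}
    (hs : Adm s) (hprev : ∀ w : Word N, lead w ≤ m → HasExp N (weight w) (bracket w) (prev w)) :
    HasExp N (m + 1 + weight s) (bracket (onesCons β s))
      (∑ β' : Fin (m + 1) → ZMod N,
          Polynomial.C (((regMatrix N m)⁻¹ β β' : ℚ) : ℂ) * regRhs m prev s β') := by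
  have hsol := eq_sum_regMatrix_inv (K := ℂ) (x := fun β => bracket (onesCons β s))
    (b := serRhs m s) (bracket_system m hs) β
  rw [hsol]
  refine HasExp.sum _ fun β' _ => ?_
  rw [← Polynomial.smul_eq_C_mul]
  exact (hasExp_serRhs β' hs hprev).smul _

/-- Summing [1;0] - [1;γ] = g_γ over γ gives N [1;0] = t_N + ∑ g_γ, and [1;β] = [1;0] - g_β. -/
theorem hasExp_starOne (β : ZMod N) : HasExp N 1 (bracket [(1, β)]) (starOne β) := by
  have hN : (N : ℂ) ≠ 0 := by exact_mod_cast NeZero.ne N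
  have h0 : HasExp N 1 (∑ γ : ZMod N, gser γ []) (∑ γ : ZMod N, Polynomial.C (Gam γ [])) :=
    HasExp.sum _ fun γ _ => hasExp_gser γ []
  have h := ((hasExp_tN.add h0).smul (1 / (N : ℂ))).sub (hasExp_gser β [])
  rw [Polynomial.smul_eq_C_mul, ← map_sum] at h
  have e : tN N + ∑ γ : ZMod N, gser γ [] = (N : ℂ) • bracket [((1, 0) : Letter N)] := by
    simp only [gser, Finset.sum_sub_distrib, Finset.sum_const, Finset.card_univ, ZMod.card,
      Nat.cast_smul_eq_nsmul, tN]
    abel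
  rwa [e, smul_smul, one_div_mul_cancel hN, one_smul, gser, sub_sub_cancel] at h

/-- The brackets satisfy, modulo lower weight, the recursion that defines ζ*: the stuffle relation
for one leading one and the linear system for more. Expansions therefore follow the same recursion.
-/
theorem hasExp_starTab (m : ℕ) (w : Word N) (hw : lead w ≤ m) :
    HasExp N (weight w) (bracket w) (starTab m w) := by
  induction m generalizing w with
  | zero => exact hasExp_bracket (adm_of_lead_eq_zero (Nat.le_zero.1 hw))
  | succ m ih =>
    rw [starTab]
    dsimp only
    split_ifs with h1 h2
    · exact ih w h1
    · subst h2
      obtain ⟨β, s, hs, h⟩ := exists_onesCons w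
      generalize hl : lead w = l at hw h1 β h
      obtain rfl : l = 0 + 1 := by omega
      rw [h, drop_onesCons, show ((onesCons β s).getD ((0 : Fin (0 + 1)) : ℕ) (1, 0)).2 = β 0 from
        congrFun (getD_onesCons β s) 0]
      have e : onesCons β s = (1, β 0) :: s := by
        conv_lhs => rw [← Fin.cons_self_tail β, onesCons_cons, onesCons_zero]
      have h3 := (hasExp_starOne (β 0)).mul (hasExp_bracket hs)
      have h4 := hasExp_zero_of_below (bracket_mul_sub_mem [((1, β 0) : Letter N)] s)
      have e1 : weight [((1, β 0) : Letter N)] = 1 := by simp [weight]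
      have hsplit := sum_stuffle_onesCons bracket (β 0) (Fin.tail β) hs
      rw [Fin.sum_univ_one, Fin.insertNth_zero', Fin.cons_self_tail, onesCons_zero,
        ← bracketL_stuffleWord] at hsplit
      simp only [Nat.le_zero] at hsplit
      rw [e1] at h4
      have h5 := HasExp.list_sum (N := N) (k := 1 + weight s) (f := bracket)
        (P := fun u => Polynomial.C (zeta u))
        ((stuffle [(1, β 0)] s).filter fun u => lead u = 0) fun u hu => by
          rw [List.mem_filter] at hu
          have e : weight u = 1 + weight s := by rw [weight_of_mem_stuffle hu.1, e1]
          exact e ▸ hasExp_bracket (adm_of_lead_eq_zero (by simpa using hu.2))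
      have h6 := (h3.sub h4).sub h5
      rw [sub_zero, hsplit] at h6
      rw [e, weight_cons, PNat.one_coe, ← e]
      convert h6 using 1
      abel
    · obtain ⟨β, s, hs, h⟩ := exists_onesCons w
      generalize hl : lead w = l at hw h1 β h
      obtain rfl : l = m + 1 := by omega
      rw [h, drop_onesCons, getD_onesCons, weight_onesCons]
      exact hasExp_onesCons β hs ih

theorem hasExp_zetaStar (w : Word N) : HasExp N (weight w) (bracket w) (zetaStar w) :=
  hasExp_starTab _ w le_rfl

end Regularized

/-! ### The algebras of zeta values and the graded `ℚ`-form -/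

section Algebras

theorem IsFilteredAlg.one_mem_top {K A : Type*} [Field K] [CommRing A] [Algebra K A]
    {V : Submodule K A} {F : ℕ → Submodule K A} (h : IsFilteredAlg V F) : (1 : A) ∈ V := by
  rw [← h.exhaust]
  exact Submodule.mem_iSup_of_mem 0 h.one_mem

theorem IsFilteredAlg.mul_mem_top {K A : Type*} [Field K] [CommRing A] [Algebra K A]
    {V : Submodule K A} {F : ℕ → Submodule K A} (h : IsFilteredAlg V F) (x y : A) (hx : x ∈ V)
    (hy : y ∈ V) : x * y ∈ V := by
  rw [← h.exhaust, Submodule.mem_iSup_of_directed _ h.mono.directed_le] at hx hy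
  obtain ⟨i, hi⟩ := hx
  obtain ⟨j, hj⟩ := hy
  rw [← h.exhaust]
  exact Submodule.mem_iSup_of_mem (i + j) (h.mul_mem hi hj)

/-- A subspace spanned by a set whose products stay in the subspace is a subalgebra. -/
def spanSubalgebra {K A : Type*} [Field K] [CommRing A] [Algebra K A] (s : Set A)
    (h1 : (1 : A) ∈ Submodule.span K s)
    (h : ∀ x ∈ s, ∀ y ∈ s, x * y ∈ Submodule.span K s) : Subalgebra K A :=
  (Submodule.span K s).toSubalgebra h1 fun _ _ hx hy =>
    bilin_mem_of_mem_span (LinearMap.mul K A) h hx hy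

variable {N : ℕ} [NeZero N]

theorem exists_formalGen_hasExp {k : ℕ} {x : ℂ} (hx : x ∈ mGen N k) :
    ∃ y ∈ formalGen N k, HasExp N k (bracketL y) (Polynomial.C x) := by
  rcases hx with ⟨w, hw, rfl, rfl⟩ | ⟨β, w, -, rfl, rfl⟩
  · refine ⟨_, Or.inl ⟨w, hw, rfl, rfl⟩, ?_⟩
    rw [bracketL_single]
    exact hasExp_bracket hw
  · refine ⟨_, Or.inr ⟨β, w, rfl, rfl⟩, ?_⟩
    rw [map_sub, bracketL_single, bracketL_single]
    exact hasExp_gser β w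

/-- Integral combinations of generators of one weight have values in the ℚ-span, which is the source
of the rational forms. -/
theorem exists_hasExp_genGroup {k : ℕ} {y : Formal N} (hy : y ∈ genGroup N k) :
    ∃ z ∈ MZQ N, HasExp N k (bracketL y) (Polynomial.C z) := by
  induction hy using AddSubgroup.closure_induction with
  | mem y hy =>
    rcases hy with ⟨w, hw, rfl, rfl⟩ | ⟨β, w, rfl, rfl⟩
    · refine ⟨zeta w, Submodule.subset_span ⟨_, Or.inl ⟨w, hw, rfl, rfl⟩⟩, ?_⟩
      rw [bracketL_single]
      exact hasExp_bracket hw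
    · refine ⟨Gam β w, ?_, ?_⟩
      · by_cases hβ : β = 0
        · rw [Gam.eq_def, if_pos hβ]
          exact zero_mem _
        · exact Submodule.subset_span ⟨_, Or.inr ⟨β, w, hβ, rfl, rfl⟩⟩
      · rw [map_sub, bracketL_single, bracketL_single]
        exact hasExp_gser β w
  | zero => exact ⟨0, zero_mem _, by simpa using hasExp_zero k⟩
  | add x y _ _ hx hy =>
    obtain ⟨a, ha, h1⟩ := hx
    obtain ⟨b, hb, h2⟩ := hy
    exact ⟨a + b, add_mem ha hb, by simpa using h1.add h2⟩
  | neg x _ hx =>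
    obtain ⟨a, ha, h1⟩ := hx
    exact ⟨-a, neg_mem ha, by simpa using h1.neg⟩

/-- The product of two numbers is the expansion of the product of the corresponding series; as that
product lies in qMZ, its expansion is also a number in the filtration step, and expansions are
unique. -/
theorem mGen_mul_mem_MZFil {i j : ℕ} {x y : ℂ} (hx : x ∈ mGen N i) (hy : y ∈ mGen N j) :
    x * y ∈ MZFil N (i + j) := by
  obtain ⟨a, ha, h1⟩ := exists_formalGen_hasExp hx
  obtain ⟨b, hb, h2⟩ := exists_formalGen_hasExp hy
  obtain ⟨z, hz, h3⟩ := exists_hasExp_qMZ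
    (isFilteredAlg_qMZ.mul_mem (bracketL_mem_qMZFil ha) (bracketL_mem_qMZFil hb))
  have h := (h1.mul h2).unique h3
  rw [← map_mul] at h
  rwa [Polynomial.C_injective h]

/-- The product of series is replaced by the stuffle product, which is integral; the difference has
coefficients in ℚ(η) but lower weight, so it expands to 0. -/
theorem mGen_mul_mem_MZQ {i j : ℕ} {x y : ℂ} (hx : x ∈ mGen N i) (hy : y ∈ mGen N j) :
    x * y ∈ MZQ N := by
  obtain ⟨a, ha, h1⟩ := exists_formalGen_hasExp hx
  obtain ⟨b, hb, h2⟩ := exists_formalGen_hasExp hy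
  obtain ⟨z, hz, h3⟩ := exists_hasExp_genGroup (stuffleMul_mem_genGroup ha hb)
  have hlow : bracketL a * bracketL b - bracketL (stuffleMul a b) ∈ below (MDFil N) (i + j) := by
    have h := bracketL_mul_sub_mem ha hb
    cases hk : i + j with
    | zero => rwa [hk] at h
    | succ k =>
      rw [hk] at h
      exact qMZFil_le_MDFil k h
  have h4 := (h1.mul h2).sub (hasExp_zero_of_below hlow)
  rw [sub_sub_cancel, sub_zero, ← map_mul] at h4
  rwa [Polynomial.C_injective (h4.unique h3)]

theorem one_mem_mGen {N : ℕ} : (1 : ℂ) ∈ mGen N 0 := Or.inl ⟨[], by simp [Adm], rfl, rfl⟩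

theorem isFilteredAlg_MZ : IsFilteredAlg (MZ N) (MZFil N) :=
  isFilteredAlg_of_span (s := mGen N) (fun _ => rfl) rfl
    (Submodule.subset_span ⟨0, le_rfl, one_mem_mGen⟩)
    fun _ _ _ hx _ hy => mGen_mul_mem_MZFil hx hy

/-- The algebra of multiple zeta values of level `N` over `ℚ(η)`. -/
def MZAlg (N : ℕ) [NeZero N] : Subalgebra (QN N) ℂ :=
  (MZ N).toSubalgebra isFilteredAlg_MZ.one_mem_top isFilteredAlg_MZ.mul_mem_top

/-- The algebra of multiple zeta values of level `N` over `ℚ`. -/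
def MZQAlg (N : ℕ) [NeZero N] : Subalgebra ℚ ℂ :=
  spanSubalgebra {x | ∃ k, x ∈ mGen N k} (Submodule.subset_span ⟨0, one_mem_mGen⟩)
    fun _ ⟨_, hx⟩ _ ⟨_, hy⟩ => mGen_mul_mem_MZQ hx hy

theorem symb_mem_qMZbarQ {k : ℕ} {y : Formal N} (hy : y ∈ genGroup N k) :
    symb isFilteredAlg_qMZ k ⟨bracketL y, bracketL_mem_of_genGroup hy⟩ ∈
      qMZbarQ (N := N) isFilteredAlg_qMZ := by
  induction hy using AddSubgroup.closure_induction with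
  | mem y hy =>
    rcases bracketL_eq_zero_or_mem_qGen hy with h | h
    · rw [symb_eq_zero _ (Set.mem_of_eq_of_mem h (zero_mem _))]
      exact zero_mem _
    · exact Submodule.subset_span ⟨k, _, h, rfl⟩
  | zero =>
    rw [symb_eq_zero _ (Set.mem_of_eq_of_mem (map_zero bracketL) (zero_mem _))]
    exact zero_mem _
  | add x y hx hy ihx ihy =>
    convert add_mem ihx ihy using 1
    rw [← map_add]
    exact congrArg _ (Subtype.ext (map_add _ _ _))
  | neg x hx ihx =>
    convert neg_mem ihx using 1
    rw [← map_neg]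
    exact congrArg _ (Subtype.ext (map_neg _ _))

theorem symb_mul_eq_symb_stuffle {j k : ℕ} {x y : Formal N} (hx : x ∈ formalGen N j)
    (hy : y ∈ formalGen N k) :
    symb isFilteredAlg_qMZ j ⟨bracketL x, bracketL_mem_qMZFil hx⟩ *
      symb isFilteredAlg_qMZ k ⟨bracketL y, bracketL_mem_qMZFil hy⟩ =
    symb isFilteredAlg_qMZ (j + k) ⟨bracketL (stuffleMul x y),
      bracketL_mem_of_genGroup (stuffleMul_mem_genGroup hx hy)⟩ := by
  rw [symb_mul]
  exact symb_eq_symb _ (bracketL_mul_sub_mem hx hy)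

/-- The `ℚ`-form of the weight-graded algebra of `qMZ N`. -/
def qMZbarQAlg (N : ℕ) [NeZero N] : Subalgebra ℚ (AssocGr (isFilteredAlg_qMZ (N := N))) :=
  (qMZbarQ (N := N) isFilteredAlg_qMZ).toSubalgebra
    (by
      have h := symb_mem_qMZbarQ (single_mem_genGroup (N := N) (w := []) (by simp [Adm]))
      convert h using 1
      refine (symb_one _).symm.trans (symb_congr _ rfl ?_)
      exact ((bracketL_single []).trans bracket_nil).symm)
    (by
      intro x y hx hy
      have hmul : ∀ (r : ℚ) (a b : AssocGr (isFilteredAlg_qMZ (N := N))),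
        (r • a) * b = r • (a * b) := fun r a b => smul_mul_assoc r a b
      induction hx using Submodule.span_induction with
      | zero => rw [zero_mul]; exact zero_mem _
      | add a b _ _ ha hb => rw [add_mul]; exact add_mem ha hb
      | smul r a _ ha => rw [hmul]; exact Submodule.smul_mem _ r ha
      | mem x hx =>
        induction hy using Submodule.span_induction with
        | zero => rw [mul_zero]; exact zero_mem _
        | add a b _ _ ha hb => rw [mul_add]; exact add_mem ha hb
        | smul r a _ ha => rw [mul_comm, hmul, mul_comm a]; exact Submodule.smul_mem _ r ha
        | mem y hy =>
          obtain ⟨j, f, hf, rfl⟩ := hx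
          obtain ⟨k, g, hg, rfl⟩ := hy
          obtain ⟨a, ha, rfl⟩ := exists_formalGen hf
          obtain ⟨b, hb, rfl⟩ := exists_formalGen hg
          rw [symb_mul_eq_symb_stuffle ha hb]
          exact symb_mem_qMZbarQ (stuffleMul_mem_genGroup ha hb))

end Algebras

/-! ### The homomorphisms -/

section Maps

variable {N : ℕ} {A : Subalgebra (QN N) ℂ}

theorem C_coe_injective : Function.Injective fun z : A => Polynomial.C (z : ℂ) :=
  Polynomial.C_injective.comp Subtype.val_injective

theorem map_coe_injective : Function.Injective fun P : A[X] => P.map (algebraMap A ℂ) :=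
  Polynomial.map_injective _ Subtype.val_injective

theorem exists_map_eq {P : ℂ[X]} (hP : ∀ n, P.coeff n ∈ A) :
    ∃ Q : A[X], Q.map (algebraMap A ℂ) = P :=
  (Polynomial.mem_lifts P).1 ((Polynomial.lifts_iff_coeff_lifts P).2 fun n =>
    ⟨⟨P.coeff n, hP n⟩, rfl⟩)

theorem map_coe_smul (c : QN N) (P : A[X]) :
    (c • P).map (algebraMap A ℂ) = (c : ℂ) • P.map (algebraMap A ℂ) := by
  ext n
  rw [Polynomial.coeff_map, Polynomial.coeff_smul, Polynomial.coeff_smul, Polynomial.coeff_map]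
  rfl

variable [NeZero N]

/-- Expansions of the elements of a subspace depend linearly on the element. -/
theorem exists_expMap {C : Type*} [AddCommMonoid C] [Module (QN N) C] {ι : C → ℂ[X]}
    (hι : Function.Injective ι) (hadd : ∀ a b, ι (a + b) = ι a + ι b)
    (hsmul : ∀ (c : QN N) a, ι (c • a) = (c : ℂ) • ι a) {k : ℕ} {F : Submodule (QN N) ℂ⟦X⟧}
    (h : ∀ f ∈ F, ∃ c, HasExp N k f (ι c)) :
    ∃ Φ : F →ₗ[QN N] C, ∀ f : F, HasExp N k f (ι (Φ f)) := by
  choose c hc using fun f : F => h f f.2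
  refine ⟨⟨⟨c, fun f g => ?_⟩, fun a f => ?_⟩, hc⟩
  · refine hι ((hc (f + g)).unique ?_)
    rw [hadd]
    exact (hc f).add (hc g)
  · refine hι ((hc (a • f)).unique ?_)
    rw [hsmul]
    exact (hc f).smul (a : ℂ)

theorem exists_qMZ_map (hA : Subalgebra.toSubmodule A = MZ N) (k : ℕ) :
    ∃ Φ : qMZFil N k →ₗ[QN N] A, ∀ f : qMZFil N k, HasExp N k f (Polynomial.C (Φ f : ℂ)) := by
  refine exists_expMap C_coe_injective (fun a b => Polynomial.C_add)
    (fun c a => (Polynomial.smul_C (c : ℂ) (a : ℂ)).symm) fun f hf => ?_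
  obtain ⟨z, hz, h⟩ := exists_hasExp_qMZ hf
  have hz' : z ∈ Subalgebra.toSubmodule A := hA ▸ MZFil_le_MZ k hz
  exact ⟨⟨z, hz'⟩, h⟩

theorem exists_MD_map (hA : Subalgebra.toSubmodule A = MZ N) (k : ℕ) :
    ∃ Φ : MDFil N k →ₗ[QN N] A[X],
      ∀ f : MDFil N k, HasExp N k f ((Φ f).map (algebraMap A ℂ)) := by
  refine exists_expMap map_coe_injective (fun a b => Polynomial.map_add _) map_coe_smul
    fun f hf => ?_
  obtain ⟨P, hP, h⟩ := exists_hasExp_MD hf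
  obtain ⟨Q, rfl⟩ := exists_map_eq (A := A) (P := P) fun n => by
    rw [← Subalgebra.mem_toSubmodule, hA]
    exact hP n
  exact ⟨Q, h⟩

theorem tN_pow_mem_MDFil (r : ℕ) : tN N ^ r ∈ MDFil N r := by
  induction r with
  | zero => exact isFilteredAlg_MD.one_mem
  | succ r ih =>
    rw [pow_succ]
    exact isFilteredAlg_MD.mul_mem ih tN_mem_MDFil

/-- The type of `F` carries the weight j + r, so the equality of series is passed as a hypothesis;
this avoids transport between equal weights. -/
theorem symb_mul_pow {j r : ℕ} (f : MDFil N j) (F : MDFil N (j + r))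
    (hF : (F : ℂ⟦X⟧) = f * tN N ^ r) :
    symb isFilteredAlg_MD (j + r) F =
      symb isFilteredAlg_MD j f * symb isFilteredAlg_MD 1 ⟨tN N, tN_mem_MDFil⟩ ^ r := by
  induction r with
  | zero =>
    rw [pow_zero, mul_one]
    exact symb_congr _ rfl (by simpa using hF)
  | succ r ih =>
    rw [pow_succ, ← mul_assoc, ← ih ⟨_, isFilteredAlg_MD.mul_mem f.2 (tN_pow_mem_MDFil r)⟩ rfl,
      symb_mul]
    exact symb_congr _ rfl (hF.trans (by rw [pow_succ]; exact (mul_assoc _ _ _).symm))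

theorem exists_grInclusion : ∃ ι : AssocGr (isFilteredAlg_qMZ (N := N)) →ₐ[QN N]
    AssocGr (isFilteredAlg_MD (N := N)), ∀ (k : ℕ) (f : qMZFil N k),
      ι (symb isFilteredAlg_qMZ k f) =
        symb isFilteredAlg_MD k ⟨f, qMZFil_le_MDFil k f.2⟩ := by
  refine exists_grLift isFilteredAlg_qMZ
    (fun k => (symb isFilteredAlg_MD k).comp (Submodule.inclusion (qMZFil_le_MDFil k)))
    rfl (fun j k f g => (symb_mul isFilteredAlg_MD j k ⟨f, qMZFil_le_MDFil j f.2⟩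
      ⟨g, qMZFil_le_MDFil k g.2⟩).symm) fun k f => ?_
  exact symb_eq_zero _ (qMZFil_le_MDFil k f.2)

/-- Every series of weight at most k is a combination of products f t_N^r. Those of weight exactly k
have the image of a monomial as class, and those of smaller weight have class 0. -/
theorem gr_surjective {φ : (AssocGr (isFilteredAlg_qMZ (N := N)))[X] →ₐ[QN N]
      AssocGr (isFilteredAlg_MD (N := N))}
    (hC : ∀ (k : ℕ) (f : qMZFil N k), φ (Polynomial.C (symb isFilteredAlg_qMZ k f)) =
      symb isFilteredAlg_MD k ⟨f, qMZFil_le_MDFil k f.2⟩)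
    (hX : φ Polynomial.X = symb isFilteredAlg_MD 1 ⟨tN N, tN_mem_MDFil⟩) :
    Function.Surjective φ := by
  suffices ∀ y, y ∈ φ.range from this
  refine assocGr_induction _ (zero_mem _) (fun k f => ?_) fun x y hx hy => add_mem hx hy
  have key : tSpan N k ≤ Submodule.map (MDFil N k).subtype
      ((Subalgebra.toSubmodule φ.range).comap (symb isFilteredAlg_MD k)) := by
    refine Submodule.span_le.2 ?_
    rintro _ ⟨j, r, hj, p, hp, rfl⟩
    have hmem : p * tN N ^ r ∈ MDFil N (j + r) :=
      isFilteredAlg_MD.mul_mem (qMZFil_le_MDFil j hp) (tN_pow_mem_MDFil r)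
    refine ⟨⟨_, MDFil_mono hj hmem⟩, ?_, rfl⟩
    rw [SetLike.mem_coe, Submodule.mem_comap, Subalgebra.mem_toSubmodule]
    rcases hj.eq_or_lt with rfl | hj
    · rw [symb_mul_pow ⟨p, qMZFil_le_MDFil j hp⟩ ⟨_, MDFil_mono hj hmem⟩ rfl]
      refine ⟨Polynomial.C (symb isFilteredAlg_qMZ j ⟨p, hp⟩) * Polynomial.X ^ r, ?_⟩
      exact (map_mul φ _ _).trans (by rw [map_pow, hC, hX])
    · rw [symb_eq_zero _ (below_mono MDFil_mono hj hmem)]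
      exact zero_mem _
  obtain ⟨g, hg, e⟩ := key (MDFil_le_tSpan k f.2)
  obtain rfl : g = f := Subtype.ext e
  exact hg

/-- A homomorphism with the right values on classes restricts to the `ℚ`-forms. -/
theorem apply_mem_MZQ {Φ : AssocGr (isFilteredAlg_qMZ (N := N)) →ₐ[QN N] A}
    (hΦ : ∀ (k : ℕ) (f : qMZFil N k),
      HasExp N k f (Polynomial.C (Φ (symb isFilteredAlg_qMZ k f) : ℂ)))
    {x : AssocGr (isFilteredAlg_qMZ (N := N))} (hx : x ∈ qMZbarQ (N := N) isFilteredAlg_qMZ) :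
    (Φ x : ℂ) ∈ MZQ N := by
  let ψ : AssocGr (isFilteredAlg_qMZ (N := N)) →ₐ[ℚ] ℂ :=
    RingHom.toRatAlgHom ((A.val.comp Φ : _ →ₐ[QN N] ℂ) : _ →+* ℂ)
  suffices qMZbarQ (N := N) isFilteredAlg_qMZ ≤ (MZQ N).comap ψ.toLinearMap from this hx
  refine Submodule.span_le.2 ?_
  rintro _ ⟨k, f, hf, rfl⟩
  obtain ⟨y, hy, rfl⟩ := exists_formalGen hf
  obtain ⟨z, hz, h⟩ := exists_hasExp_genGroup (AddSubgroup.subset_closure hy)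
  have e : (Φ (symb isFilteredAlg_qMZ k ⟨bracketL y, qGen_mem hf⟩) : ℂ) = z :=
    Polynomial.C_injective ((hΦ k ⟨bracketL y, qGen_mem hf⟩).unique h)
  change (Φ (symb isFilteredAlg_qMZ k ⟨bracketL y, qGen_mem hf⟩) : ℂ) ∈ MZQ N
  rwa [e]

end Maps

/-! ### From expansions to algebra homomorphisms and their rational forms. -/

section Assembly

variable {N : ℕ} {A : Subalgebra (QN N) ℂ} [NeZero N]

theorem exists_qMZ_hom (hA : Subalgebra.toSubmodule A = MZ N) :
    ∃ (Z : ∀ k, qMZFil N k →ₗ[QN N] A)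
      (Zbar : AssocGr (isFilteredAlg_qMZ (N := N)) →ₐ[QN N] A),
      (∀ (k : ℕ) (f : qMZFil N k), HasExp N k f (Polynomial.C (Z k f : ℂ))) ∧
      Z 0 ⟨1, isFilteredAlg_qMZ.one_mem⟩ = 1 ∧
      (∀ (j k : ℕ) (f : qMZFil N j) (g : qMZFil N k),
        Z (j + k) ⟨f * g, isFilteredAlg_qMZ.mul_mem f.2 g.2⟩ = Z j f * Z k g) ∧
      (∀ (k : ℕ) (f : qMZFil N k),
        Z (k + 1) ⟨f, isFilteredAlg_qMZ.mono (Nat.le_succ k) f.2⟩ = 0) ∧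
      ∀ (k : ℕ) (f : qMZFil N k), Zbar (symb isFilteredAlg_qMZ k f) = Z k f := by
  choose Z hZ using exists_qMZ_map hA
  have hZ1 : Z 0 ⟨1, isFilteredAlg_qMZ.one_mem⟩ = 1 :=
    C_coe_injective ((hZ 0 ⟨1, isFilteredAlg_qMZ.one_mem⟩).unique hasExp_one)
  have hZmul : ∀ (j k : ℕ) (f : qMZFil N j) (g : qMZFil N k),
      Z (j + k) ⟨f * g, isFilteredAlg_qMZ.mul_mem f.2 g.2⟩ = Z j f * Z k g := fun j k f g =>
    C_coe_injective (((hZ (j + k) ⟨f * g, isFilteredAlg_qMZ.mul_mem f.2 g.2⟩).unique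
      ((hZ j f).mul (hZ k g))).trans Polynomial.C_mul.symm)
  have hZlow : ∀ (k : ℕ) (f : qMZFil N k),
      Z (k + 1) ⟨f, isFilteredAlg_qMZ.mono (Nat.le_succ k) f.2⟩ = 0 := fun k f =>
    C_coe_injective (((hZ (k + 1) ⟨f, isFilteredAlg_qMZ.mono (Nat.le_succ k) f.2⟩).unique
      (hZ k f).succ).trans Polynomial.C_0.symm)
  obtain ⟨Zbar, hZbar⟩ := exists_grLift isFilteredAlg_qMZ Z hZ1 hZmul hZlow
  exact ⟨Z, Zbar, hZ, hZ1, hZmul, hZlow, hZbar⟩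

theorem exists_MD_hom (hA : Subalgebra.toSubmodule A = MZ N) :
    ∃ (W : ∀ k, MDFil N k →ₗ[QN N] A[X])
      (Wbar : AssocGr (isFilteredAlg_MD (N := N)) →ₐ[QN N] A[X]),
      (∀ (k : ℕ) (f : MDFil N k), HasExp N k f ((W k f).map (algebraMap A ℂ))) ∧
      (∀ (j k : ℕ) (f : MDFil N j) (g : MDFil N k),
        W (j + k) ⟨f * g, isFilteredAlg_MD.mul_mem f.2 g.2⟩ = W j f * W k g) ∧
      (∀ (k : ℕ) (f : MDFil N k),
        W (k + 1) ⟨f, isFilteredAlg_MD.mono (Nat.le_succ k) f.2⟩ = 0) ∧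
      ∀ (k : ℕ) (f : MDFil N k), Wbar (symb isFilteredAlg_MD k f) = W k f := by
  choose W hW using exists_MD_map hA
  have hW1 : W 0 ⟨1, isFilteredAlg_MD.one_mem⟩ = 1 :=
    map_coe_injective (((hW 0 ⟨1, isFilteredAlg_MD.one_mem⟩).unique hasExp_one).trans
      (Polynomial.map_one _).symm)
  have hWmul : ∀ (j k : ℕ) (f : MDFil N j) (g : MDFil N k),
      W (j + k) ⟨f * g, isFilteredAlg_MD.mul_mem f.2 g.2⟩ = W j f * W k g := fun j k f g =>
    map_coe_injective (((hW (j + k) ⟨f * g, isFilteredAlg_MD.mul_mem f.2 g.2⟩).unique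
      ((hW j f).mul (hW k g))).trans (Polynomial.map_mul _).symm)
  have hWlow : ∀ (k : ℕ) (f : MDFil N k),
      W (k + 1) ⟨f, isFilteredAlg_MD.mono (Nat.le_succ k) f.2⟩ = 0 := fun k f =>
    map_coe_injective (((hW (k + 1) ⟨f, isFilteredAlg_MD.mono (Nat.le_succ k) f.2⟩).unique
      (hW k f).succ).trans (Polynomial.map_zero _).symm)
  obtain ⟨Wbar, hWbar⟩ := exists_grLift isFilteredAlg_MD W hW1 hWmul hWlow
  exact ⟨W, Wbar, hW, hWmul, hWlow, hWbar⟩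

theorem exists_gr_polyHom :
    ∃ φ : (AssocGr (isFilteredAlg_qMZ (N := N)))[X] →ₐ[QN N] AssocGr (isFilteredAlg_MD (N := N)),
      (∀ (k : ℕ) (f : qMZFil N k), φ (Polynomial.C (symb isFilteredAlg_qMZ k f)) =
        symb isFilteredAlg_MD k ⟨f, qMZFil_le_MDFil k f.2⟩) ∧
      φ Polynomial.X = symb isFilteredAlg_MD 1 ⟨tN N, tN_mem_MDFil⟩ := by
  obtain ⟨ι, hι⟩ := exists_grInclusion (N := N)
  refine ⟨Polynomial.eval₂AlgHom ι (symb isFilteredAlg_MD 1 ⟨tN N, tN_mem_MDFil⟩)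
    fun _ => Commute.all _ _, fun k f => ?_, ?_⟩
  · exact (Polynomial.eval₂_C _ _).trans (hι k f)
  · exact Polynomial.eval₂_X _ _

theorem MD_map_mul_pow {k r : ℕ} {Z : qMZFil N k →ₗ[QN N] A} {W : MDFil N (k + r) →ₗ[QN N] A[X]}
    (hZ : ∀ f : qMZFil N k, HasExp N k f (Polynomial.C (Z f : ℂ)))
    (hW : ∀ F : MDFil N (k + r), HasExp N (k + r) F ((W F).map (algebraMap A ℂ)))
    (f : qMZFil N k) (F : MDFil N (k + r)) (hF : (F : ℂ⟦X⟧) = f * tN N ^ r) :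
    W F = Polynomial.C (Z f) * Polynomial.X ^ r := by
  refine map_coe_injective ((hW F).unique ?_)
  rw [hF]
  have h := (hZ f).mul ((hasExp_tN (N := N)).pow r)
  have e : (Polynomial.C (Z f) * Polynomial.X ^ r).map (algebraMap A ℂ) =
      Polynomial.C (Z f : ℂ) * Polynomial.X ^ r := by
    rw [Polynomial.map_mul, Polynomial.map_pow, Polynomial.map_X, Polynomial.map_C]
    rfl
  rw [← e] at h
  exact h

/-- Both sides are algebra homomorphisms on a polynomial ring, so it suffices to compare them on
classes from qMZ (the case r = 0) and on X (the case f = 1, r = 1). -/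
theorem comp_eq_mapAlgHom {Z : ∀ k, qMZFil N k →ₗ[QN N] A} {W : ∀ k, MDFil N k →ₗ[QN N] A[X]}
    {Zbar : AssocGr (isFilteredAlg_qMZ (N := N)) →ₐ[QN N] A}
    {Wbar : AssocGr (isFilteredAlg_MD (N := N)) →ₐ[QN N] A[X]}
    {φ : (AssocGr (isFilteredAlg_qMZ (N := N)))[X] →ₐ[QN N] AssocGr (isFilteredAlg_MD (N := N))}
    (hφC : ∀ (k : ℕ) (f : qMZFil N k), φ (Polynomial.C (symb isFilteredAlg_qMZ k f)) =
      symb isFilteredAlg_MD k ⟨f, qMZFil_le_MDFil k f.2⟩)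
    (hφX : φ Polynomial.X = symb isFilteredAlg_MD 1 ⟨tN N, tN_mem_MDFil⟩)
    (hZ1 : Z 0 ⟨1, isFilteredAlg_qMZ.one_mem⟩ = 1)
    (hZbar : ∀ (k : ℕ) (f : qMZFil N k), Zbar (symb isFilteredAlg_qMZ k f) = Z k f)
    (hWbar : ∀ (k : ℕ) (f : MDFil N k), Wbar (symb isFilteredAlg_MD k f) = W k f)
    (hWt : ∀ (k r : ℕ) (f : qMZFil N k) (F : MDFil N (k + r)), (F : ℂ⟦X⟧) = f * tN N ^ r →
      W (k + r) F = Polynomial.C (Z k f) * Polynomial.X ^ r) :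
    Wbar.comp φ = Polynomial.mapAlgHom Zbar := by
  refine Polynomial.algHom_ext' (assocGr_algHom_ext _ fun k f => ?_) ?_
  · change Wbar (φ (Polynomial.C (symb isFilteredAlg_qMZ k f))) =
      (Polynomial.C (symb isFilteredAlg_qMZ k f)).map _
    rw [hφC, hWbar, Polynomial.map_C]
    have h := hWt k 0 f ⟨f, qMZFil_le_MDFil k f.2⟩ (by simp)
    rw [pow_zero, mul_one] at h
    exact h.trans (congrArg Polynomial.C (hZbar k f).symm)
  · change Wbar (φ Polynomial.X) = Polynomial.X.map _
    rw [hφX, hWbar, Polynomial.map_X]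
    have h := hWt 0 1 ⟨1, isFilteredAlg_qMZ.one_mem⟩ ⟨tN N, tN_mem_MDFil⟩ (by simp)
    rwa [hZ1, Polynomial.C_1, one_mul, pow_one] at h

/-- Restriction of a ring homomorphism to rational subalgebras. -/
theorem exists_ratRestrict {R S C : Type*} [Ring R] [Algebra ℚ R] [Ring S] [Algebra ℚ S]
    [Semiring C] [Algebra ℚ C] (Φ : R →+* S) (G : Subalgebra ℚ R) (j : C →ₐ[ℚ] S)
    (hj : Function.Injective j) (h : ∀ x ∈ G, ∃ c, j c = Φ x) :
    ∃ Ψ : G →ₐ[ℚ] C, ∀ x : G, j (Ψ x) = Φ x := by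
  let ψ : G →ₐ[ℚ] j.range := (Φ.toRatAlgHom.comp G.val).codRestrict j.range fun x => h x x.2
  refine ⟨(AlgEquiv.ofInjective j hj).symm.toAlgHom.comp ψ, fun x => ?_⟩
  exact congrArg Subtype.val ((AlgEquiv.ofInjective j hj).apply_symm_apply (ψ x))


theorem exists_qMZ_ratHom {B : Subalgebra ℚ ℂ} (hB : Subalgebra.toSubmodule B = MZQ N)
    {G : Subalgebra ℚ (AssocGr (isFilteredAlg_qMZ (N := N)))}
    (hG : Subalgebra.toSubmodule G = qMZbarQ isFilteredAlg_qMZ)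
    {Φ : AssocGr (isFilteredAlg_qMZ (N := N)) →ₐ[QN N] A}
    (hΦ : ∀ (k : ℕ) (f : qMZFil N k),
      HasExp N k f (Polynomial.C (Φ (symb isFilteredAlg_qMZ k f) : ℂ))) :
    ∃ Ψ : G →ₐ[ℚ] B, ∀ x : G, (Ψ x : ℂ) = Φ (x : AssocGr isFilteredAlg_qMZ) := by
  refine exists_ratRestrict ((A.val.comp Φ : _ →ₐ[QN N] ℂ) : _ →+* ℂ) G B.val
    Subtype.val_injective fun x hx => ?_
  rw [← Subalgebra.mem_toSubmodule, hG] at hx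
  have h := apply_mem_MZQ hΦ hx
  rw [← hB] at h
  exact ⟨⟨_, h⟩, rfl⟩

/-- It suffices to look at the generators of the ℚ-subalgebra: t_N goes to T, and classes from the
ℚ-form go to constants in `B`. -/
theorem exists_MD_ratHom {B : Subalgebra ℚ ℂ}
    {G : Subalgebra ℚ (AssocGr (isFilteredAlg_qMZ (N := N)))}
    {Zbar : AssocGr (isFilteredAlg_qMZ (N := N)) →ₐ[QN N] A} {ZbarQ : G →ₐ[ℚ] B}
    (hQ : ∀ x : G, (ZbarQ x : ℂ) = Zbar (x : AssocGr isFilteredAlg_qMZ))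
    {Wbar : AssocGr (isFilteredAlg_MD (N := N)) →ₐ[QN N] A[X]}
    {φ : (AssocGr (isFilteredAlg_qMZ (N := N)))[X] →ₐ[QN N] AssocGr (isFilteredAlg_MD (N := N))}
    (hcomp : Wbar.comp φ = Polynomial.mapAlgHom Zbar)
    (hφX : φ Polynomial.X = symb isFilteredAlg_MD 1 ⟨tN N, tN_mem_MDFil⟩) :
    ∃ WbarQ : Algebra.adjoin ℚ
        (insert (symb isFilteredAlg_MD 1 ⟨tN N, tN_mem_MDFil⟩)
          {y | ∃ x ∈ G, y = φ (Polynomial.C x)}) →ₐ[ℚ] B[X],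
      ∀ x, (WbarQ x).map (algebraMap B ℂ) =
        (Wbar (x : AssocGr isFilteredAlg_MD)).map (algebraMap A ℂ) := by
  let Φ : AssocGr (isFilteredAlg_MD (N := N)) →+* ℂ[X] :=
    (Polynomial.mapRingHom (algebraMap A ℂ)).comp (Wbar : _ →+* A[X])
  let j : B[X] →ₐ[ℚ] ℂ[X] := Polynomial.mapAlgHom B.val
  have hj : Function.Injective j := Polynomial.map_injective _ Subtype.val_injective
  have hΦ : ∀ P, Φ (φ P) = (P.map (Zbar : _ →+* A)).map (algebraMap A ℂ) := fun P =>
    congrArg (Polynomial.map (algebraMap A ℂ)) (DFunLike.congr_fun hcomp P)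
  refine exists_ratRestrict Φ _ j hj fun x hx => ?_
  suffices Algebra.adjoin ℚ _ ≤ j.range.comap Φ.toRatAlgHom from this hx
  refine Algebra.adjoin_le ?_
  rintro y (rfl | ⟨x, hx, rfl⟩)
  · refine ⟨Polynomial.X, ?_⟩
    change Polynomial.X.map _ = Φ _
    rw [← hφX, hΦ, Polynomial.map_X, Polynomial.map_X, Polynomial.map_X]
  · refine ⟨Polynomial.C (ZbarQ ⟨x, hx⟩), ?_⟩
    change (Polynomial.C (ZbarQ ⟨x, hx⟩)).map _ = Φ _
    rw [hΦ, Polynomial.map_C, Polynomial.map_C, Polynomial.map_C]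
    exact congrArg Polynomial.C (hQ ⟨x, hx⟩)

end Assembly

end LevelMZV

end

open LevelMZV
theorem mainTheorem4 (N : ℕ) [NeZero N] :
    ∃ (hq : IsFilteredAlg (qMZ N) (qMZFil N)) (_ : IsFilteredAlg (MZ N) (MZFil N))
      (hd : IsFilteredAlg (MD N) (MDFil N))
      (A : Subalgebra (QN N) ℂ) (_ : Subalgebra.toSubmodule A = MZ N)
      (B : Subalgebra ℚ ℂ) (_ : Subalgebra.toSubmodule B = MZQ N)
      (G : Subalgebra ℚ (AssocGr hq)) (_ : Subalgebra.toSubmodule G = qMZbarQ hq),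
    -- part (i): the maps `Z` on the weight filtration, with the prescribed values
    ∃ (Z : ∀ k, qMZFil N k →ₗ[QN N] A) (Zbar : AssocGr hq →ₐ[QN N] A) (ZbarQ : G →ₐ[ℚ] B),
      (∀ (w : Word N) (hw : Adm w),
        (Z (weight w) ⟨bracket w, bracket_mem_qMZFil hw⟩ : ℂ) = zeta w) ∧
      (∀ (β : ZMod N) (w : Word N),
        (Z (weight w + 1) ⟨gser β w, gser_mem_qMZFil β w⟩ : ℂ) = Gam β w) ∧
      -- they form a homomorphism of filtered algebras
      (∀ (k : ℕ) (f : qMZFil N k), (Z k f : ℂ) ∈ MZFil N k) ∧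
      Z 0 ⟨1, hq.one_mem⟩ = 1 ∧
      (∀ (j k : ℕ) (f : qMZFil N j) (g : qMZFil N k),
        Z (j + k) ⟨f * g, hq.mul_mem f.2 g.2⟩ = Z j f * Z k g) ∧
      -- that kills lower weights and factors through the weight-graded algebra
      (∀ (k : ℕ) (f : qMZFil N k), Z (k + 1) ⟨f, hq.mono (Nat.le_succ k) f.2⟩ = 0) ∧
      (∀ (k : ℕ) (f : qMZFil N k), Zbar (symb hq k f) = Z k f) ∧
      -- the weight-graded algebra satisfies the stuffle relations
      (∀ (j k : ℕ), ∀ x ∈ formalGen N j, ∀ y ∈ formalGen N k,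
        ∃ (hx : bracketL x ∈ qMZFil N j) (hy : bracketL y ∈ qMZFil N k)
          (hxy : bracketL (stuffleMul x y) ∈ qMZFil N (j + k)),
          symb hq j ⟨bracketL x, hx⟩ * symb hq k ⟨bracketL y, hy⟩ =
            symb hq (j + k) ⟨bracketL (stuffleMul x y), hxy⟩) ∧
      -- descent to `ℚ`
      (∀ x : G, (ZbarQ x : ℂ) = Zbar (x : AssocGr hq)) ∧
    -- part (ii): the extension to all multiple divisor functions by `t_N ↦ T`
    ∃ (φ : (AssocGr hq)[X] →ₐ[QN N] AssocGr hd)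
      (W : ∀ k, MDFil N k →ₗ[QN N] A[X]) (Wbar : AssocGr hd →ₐ[QN N] A[X])
      (WbarQ : Algebra.adjoin ℚ
          (insert (symb hd 1 ⟨tN N, tN_mem_MDFil⟩)
            {y | ∃ x ∈ G, y = φ (Polynomial.C x)}) →ₐ[ℚ] B[X]),
      -- the weight-graded algebra of `MD N` is generated by that of `qMZ N` and `t_N`
      (∀ (k : ℕ) (f : qMZFil N k),
        φ (Polynomial.C (symb hq k f)) = symb hd k ⟨f, qMZFil_le_MDFil k f.2⟩) ∧
      φ Polynomial.X = symb hd 1 ⟨tN N, tN_mem_MDFil⟩ ∧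
      Function.Surjective φ ∧
      -- the extension and its factorization
      (∀ (k r : ℕ) (f : qMZFil N k) (F : MDFil N (k + r)), (F : ℂ⟦X⟧) = f * tN N ^ r →
        W (k + r) F = Polynomial.C (Z k f) * Polynomial.X ^ r) ∧
      (∀ (j k : ℕ) (f : MDFil N j) (g : MDFil N k),
        W (j + k) ⟨f * g, hd.mul_mem f.2 g.2⟩ = W j f * W k g) ∧
      (∀ (k : ℕ) (f : MDFil N k), W (k + 1) ⟨f, hd.mono (Nat.le_succ k) f.2⟩ = 0) ∧
      (∀ (k : ℕ) (f : MDFil N k), Wbar (symb hd k f) = W k f) ∧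
      Wbar.comp φ = Polynomial.mapAlgHom Zbar ∧
      -- words with `s₁ = 1` go to the regularized values
      (∀ (α : ZMod N) (v : Word N),
        (W (weight ((1, α) :: v)) ⟨bracket ((1, α) :: v), bracket_mem_MDFil _⟩).map
          (algebraMap A ℂ) = zetaStar ((1, α) :: v)) ∧
      -- descent to `ℚ`
      ∀ x, (WbarQ x).map (algebraMap B ℂ) =
        (Wbar (x : AssocGr hd)).map (algebraMap A ℂ) := by
  obtain ⟨A, hA⟩ : ∃ A : Subalgebra (QN N) ℂ, Subalgebra.toSubmodule A = MZ N :=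
    ⟨MZAlg N, Submodule.toSubalgebra_toSubmodule _ _ _⟩
  obtain ⟨B, hB⟩ : ∃ B : Subalgebra ℚ ℂ, Subalgebra.toSubmodule B = MZQ N :=
    ⟨MZQAlg N, Submodule.toSubalgebra_toSubmodule _ _ _⟩
  obtain ⟨G, hG⟩ : ∃ G : Subalgebra ℚ (AssocGr (isFilteredAlg_qMZ (N := N))),
      Subalgebra.toSubmodule G = qMZbarQ isFilteredAlg_qMZ :=
    ⟨qMZbarQAlg N, Submodule.toSubalgebra_toSubmodule _ _ _⟩
  obtain ⟨Z, Zbar, hZ, hZ1, hZmul, hZlow, hZbar⟩ := exists_qMZ_hom hA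
  obtain ⟨W, Wbar, hW, hWmul, hWlow, hWbar⟩ := exists_MD_hom hA
  obtain ⟨φ, hφC, hφX⟩ := exists_gr_polyHom (N := N)
  have hWt := fun k r => MD_map_mul_pow (hZ k) (hW (k + r))
  have hcomp := comp_eq_mapAlgHom hφC hφX hZ1 hZbar hWbar hWt
  obtain ⟨ZbarQ, hZbarQ⟩ := exists_qMZ_ratHom hB hG (Φ := Zbar) fun k f => by
    rw [hZbar]
    exact hZ k f
  obtain ⟨WbarQ, hWbarQ⟩ := exists_MD_ratHom hZbarQ hcomp hφX
  refine ⟨isFilteredAlg_qMZ, isFilteredAlg_MZ, isFilteredAlg_MD, A, hA, B, hB, G, hG, Z, Zbar,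
    ZbarQ, fun w hw => ?_, fun β w => ?_, fun k f => ?_, hZ1, hZmul, hZlow, hZbar,
    fun j k x hx y hy => ⟨_, _, _, symb_mul_eq_symb_stuffle hx hy⟩, hZbarQ, φ, W, Wbar, WbarQ,
    hφC, hφX, gr_surjective hφC hφX, hWt, hWmul, hWlow, hWbar, hcomp, fun α v => ?_, hWbarQ⟩
  -- The prescribed values all follow from uniqueness, since an expansion with the required constant
  -- is already known.
  · exact Polynomial.C_injective ((hZ _ _).unique (hasExp_bracket hw))
  · exact Polynomial.C_injective ((hZ _ _).unique (hasExp_gser β w))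
  · obtain ⟨z, hz, h⟩ := exists_hasExp_qMZ f.2
    rwa [Polynomial.C_injective ((hZ k f).unique h)]
  · exact (hW _ _).unique (hasExp_zetaStar _)
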